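/- For $A\in \mathrm{SL}(2,\mathbb Z)$ let $\mathbb T_A^3$ be the quotient of $[0,1]\times\mathbb T^2$, $\mathbb T^2=\mathbb R^2/\mathbb Z^2$, by the identification $(0,x)\simeq(1,Ax)$, so that $\mathbb T^3_{\mathrm{id}}$ is the 3-torus. Its standard smooth structure is that of the quotient of $\mathbb R^3$, with coordinates $(x,t)\in\mathbb R^2\times\mathbb R$, by the group of the maps $(x,t)\mapsto(A^kx+m,t+k)$, $k\in\mathbb Z$, $m\in\mathbb Z^2$; let $q$ be the quotient map. Call $A$ hyperbolic if it is diagonalizable over $\mathbb R$ with eigenvalues of modulus $\neq 1$, and parabolic if it is unipotent and $\neq \mathrm{id}$. Let $A=\mathrm{id}$, or $A$ hyperbolic, or $A$ parabolic. **Theorem B.** Let $M$ be homeomorphic to $\mathbb T_A^3$. Then $M$ can be endowed with a smooth structure, for which it is diffeomorphic to $\mathbb T^3_A$, and a smooth Lorentz metric $g$ (signature $(-,+,+)$) with the following properties: 1. the isometry group $\mathrm{Iso}(M,g)$ is noncompact, but its identity component $\mathrm{Iso}^o(M,g)$ is compact; 2. no nonempty open subset of $(M,g)$ is locally homogeneous;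 3. if $A$ has positive trace (that is, unless $A$ is hyperbolic with negative eigenvalues), $(M,g)$ is time-orientable. If $M$ is a smooth manifold diffeomorphic to $\mathbb T_A^3$, there is such a metric that is smooth for the given structure. Moreover such metrics are obtained on $M=\mathbb{T}_A^3$ as explicit quotients, as follows. Here "for generic $a$" means for all $a$ in a residual subset of the space of smooth, positive, $1$-periodic functions $a:\mathbb R\to(0,\infty)$ with the $C^\infty$ topology, and $g_a=dt^2+2a(t)\,du\,dv$ on $\mathbb R^3$ with coordinates $(u,v,t)$, $h_a=a(v)(dt^2+2\,du\,dv)$ on $\mathbb R^3$ with coordinates $(u,t,v)$. * If $A$ is hyperbolic and $(u,v)$ are any linear coordinates of $\mathbb R^2$ that diagonalize $A$, then for generic $a$ the metric $g_a$ on $\mathbb R^3$ descends through $q$ to a Lorentz metric on $M$ with properties 1, 2, 3. * If $A=\mathrm{id}$ and $(u,v)$ are any linear coordinates of $\mathbb R^2$ that diagonalize some hyperbolic $B\in\mathrm{SL}(2,\mathbb Z)$, then for generic $a$ the metric $g_a$ descends through $q:\mathbb R^3\to\mathbb R^3/\mathbb Z^3$ to a time-orientable Lorentz metric on $M$ with properties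 1 and 2. * If $A=\mathrm{id}$, then for generic $a$ the metric $h_a$, where $(u,t,v)$ are the standard coordinates of $\mathbb{R}^3$, descends through $q:\mathbb R^3\to\mathbb R^3/\mathbb Z^3$ to a time-orientable Lorentz metric on $M$ with properties 1 and 2. * If $A$ is parabolic, then $M$ is the smooth quotient of $\mathbb R^3$ by a group, independent of $a$, of affine transformations of the form $(u,t,v)\mapsto\left(u+mt-\tfrac{m^2}{2}v+\tfrac r2,\ t-mv+\tfrac s2,\ v+m\right)$ with $m,r,s\in\mathbb Z$, and for generic $a$ the metric $h_a$ descends to a time-orientable Lorentz metric on $M$ with properties 1 and 2. -/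

import Mathlib

open scoped Manifold ContDiff Matrix Topology MatrixGroups

noncomputable section

/-! ### Lorentz metrics, time-orientability, isometries, local homogeneity -/

section Lorentz

variable (n : ℕ) (M : Type*) [TopologicalSpace M] [ChartedSpace (EuclideanSpace ℝ (Fin n)) M]
  [IsManifold (𝓡 n) ∞ M]

/-- A smooth Lorentz metric, of signature `(-, +, …, +)`, on a smooth `n`-manifold: a smooth field
of symmetric bilinear forms on the tangent spaces, each of which is negative on some vector `v` and
positive definite on the orthogonal of `v`. -/
structure LorentzMetric where
  /-- The scalar product on the tangent space at a point. -/
  val : ∀ x : M, TangentSpace (𝓡 n) x →L[ℝ] TangentSpace (𝓡 n) x →L[ℝ] ℝ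
  symm : ∀ (x : M) (v w : TangentSpace (𝓡 n) x), val x v w = val x w v
  signature : ∀ x : M, ∃ v : TangentSpace (𝓡 n) x, val x v v < 0 ∧
    ∀ w : TangentSpace (𝓡 n) x, val x v w = 0 → w ≠ 0 → 0 < val x w w
  smooth : ContMDiff (𝓡 n) ((𝓡 n).prod 𝓘(ℝ, EuclideanSpace ℝ (Fin n) →L[ℝ]
      EuclideanSpace ℝ (Fin n) →L[ℝ] ℝ)) ∞
    (fun x : M ↦ Bundle.TotalSpace.mk' (EuclideanSpace ℝ (Fin n) →L[ℝ]
      EuclideanSpace ℝ (Fin n) →L[ℝ] ℝ)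
      (E := fun x : M ↦ TangentSpace (𝓡 n) x →L[ℝ] TangentSpace (𝓡 n) x →L[ℝ] ℝ) x (val x))

end Lorentz

namespace LorentzMetric

variable {n : ℕ} {M : Type*} [TopologicalSpace M] [ChartedSpace (EuclideanSpace ℝ (Fin n)) M]
  [IsManifold (𝓡 n) ∞ M]

/-- `(M, g)` is time-orientable: it carries a smooth everywhere timelike vector field. -/
def TimeOrientable (g : LorentzMetric n M) : Prop :=
  ∃ X : ∀ x : M, TangentSpace (𝓡 n) x,
    ContMDiff (𝓡 n) (𝓡 n).tangent ∞ (fun x ↦ (⟨x, X x⟩ : TangentBundle (𝓡 n) M)) ∧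
    ∀ x, g.val x (X x) (X x) < 0

/-- `f` preserves `g` at the point `x`. -/
def PreservedAt (g : LorentzMetric n M) (f : M → M) (x : M) : Prop :=
  ∀ v w : TangentSpace (𝓡 n) x,
    g.val (f x) (mfderiv (𝓡 n) (𝓡 n) f x v) (mfderiv (𝓡 n) (𝓡 n) f x w) = g.val x v w

/-- `Iso(M, g)`: the smooth diffeomorphisms of `M` that preserve `g`. -/
def Iso (g : LorentzMetric n M) : Type _ :=
  {f : M ≃ₘ^∞⟮𝓡 n, 𝓡 n⟯ M // ∀ x, g.PreservedAt f x}

/-- `Iso(M, g)` carries the compact-open topology, which is its Lie group topology. -/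
instance (g : LorentzMetric n M) : TopologicalSpace g.Iso :=
  TopologicalSpace.induced (fun f ↦ (⟨f.1, f.1.continuous⟩ : C(M, M))) inferInstance

/-- The identity element of `Iso(M, g)`. -/
def Iso.refl (g : LorentzMetric n M) : g.Iso :=
  ⟨Diffeomorph.refl (𝓡 n) M ∞, fun x v w ↦ by
    rw [Diffeomorph.coe_refl, mfderiv_id]; rfl⟩

/-- The identity component `Iso°(M, g)`. -/
def Iso.identityComponent (g : LorentzMetric n M) : Set g.Iso :=
  connectedComponent (Iso.refl g)

/-- The set `U` with the restriction of `g` is locally homogeneous: any point of `U` is sent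
to any other one by an isometry between open subsets of `U`. -/
def IsLocallyHomogeneousOn (g : LorentzMetric n M) (U : Set M) : Prop :=
  ∀ x ∈ U, ∀ y ∈ U, ∃ f : PartialDiffeomorph (𝓡 n) (𝓡 n) M M ∞,
    f.source ⊆ U ∧ f.target ⊆ U ∧ x ∈ f.source ∧ f x = y ∧ ∀ z ∈ f.source, g.PreservedAt f z

/-- The isometry group is noncompact, its identity component is compact, and no nonempty open
subset is locally homogeneous. -/
structure IsNonhomogeneousWithNoncompactIso (g : LorentzMetric n M) : Prop where
  noncompact_iso : ¬ CompactSpace g.Iso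
  isCompact_identityComponent : IsCompact (Iso.identityComponent g)
  not_locallyHomogeneous : ∀ U : Set M, IsOpen U → U.Nonempty → ¬ g.IsLocallyHomogeneousOn U

/-- The pull-back of `g` by a map `p` from the space `ℝⁿ` to `M` is the field of bilinear forms
`b`. -/
def PullsBackTo (g : LorentzMetric n M) (p : EuclideanSpace ℝ (Fin n) → M)
    (b : EuclideanSpace ℝ (Fin n) → EuclideanSpace ℝ (Fin n) → EuclideanSpace ℝ (Fin n) → ℝ) :
    Prop :=
  ∀ x v w : EuclideanSpace ℝ (Fin n),
    g.val (p x) (mfderiv (𝓡 n) (𝓡 n) p x v) (mfderiv (𝓡 n) (𝓡 n) p x w) = b x v w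

end LorentzMetric

/-! ### Torus bundles -/

/-- `P` is invertible and its columns are eigenvectors of `A`, for the eigenvalues `l`, `l⁻¹`. -/
def Diagonalizes (A : SL(2, ℤ)) (P : Matrix (Fin 2) (Fin 2) ℝ) (l : ℝ) : Prop :=
  P.det ≠ 0 ∧ (A : Matrix (Fin 2) (Fin 2) ℤ).map (fun k : ℤ ↦ (k : ℝ)) * P =
    P * Matrix.diagonal ![l, l⁻¹]

/-- `A` is hyperbolic: diagonalizable over `ℝ`, with eigenvalues of modulus different from `1`. -/
def IsHyperbolicMatrix (A : SL(2, ℤ)) : Prop :=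
  ∃ (P : Matrix (Fin 2) (Fin 2) ℝ) (l : ℝ), Diagonalizes A P l ∧ |l| ≠ 1

/-- `A` is parabolic: unipotent and different from the identity. -/
def IsParabolicMatrix (A : SL(2, ℤ)) : Prop :=
  A ≠ 1 ∧ IsNilpotent ((A : Matrix (Fin 2) (Fin 2) ℤ) - 1)

/-- The transformation of the torus `𝕋² = (ℝ / ℤ)²` induced by `A`. -/
def torusAutomorphism (A : SL(2, ℤ)) (x : Fin 2 → UnitAddCircle) : Fin 2 → UnitAddCircle :=
  fun i ↦ ∑ j, A i j • x j

/-- The torus bundle `𝕋_A³`, as a topological space: the quotient of `[0, 1] × 𝕋²` by the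
identification of `(0, x)` with `(1, A x)`. -/
abbrev TorusBundle (A : SL(2, ℤ)) : Type :=
  Quot (fun p q : Set.Icc (0 : ℝ) 1 × (Fin 2 → UnitAddCircle) ↦
    p.1 = 0 ∧ q.1 = 1 ∧ q.2 = torusAutomorphism A p.2)

section Quotients

variable {M : Type*} [TopologicalSpace M] [ChartedSpace (EuclideanSpace ℝ (Fin 3)) M]

/-- `q : ℝ³ → M` presents the smooth manifold `M` as the torus bundle `𝕋_A³` with its standard
smooth structure, that is, as the quotient of `ℝ³`, with coordinates `(x₁, x₂, t)`, by the group
generated by the unit translations along `x₁` and `x₂` and by `(x, t) ↦ (A x, t + 1)`; the elements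
of this group are the maps `(x, t) ↦ (A ^ k x + m, t + k)` with `k ∈ ℤ` and `m ∈ ℤ²`. -/
structure IsTorusBundleProjection (A : SL(2, ℤ)) (q : EuclideanSpace ℝ (Fin 3) → M) : Prop where
  surjective : Function.Surjective q
  isLocalDiffeomorph : IsLocalDiffeomorph (𝓡 3) (𝓡 3) ∞ q
  eq_iff : ∀ x y, q x = q y ↔ ∃ (k : ℤ) (m : Fin 2 → ℤ), y 2 = x 2 + k ∧
    ∀ i : Fin 2, y i.castSucc = ∑ j : Fin 2, ((A ^ k) i j : ℝ) * x j.castSucc + m i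

/-- The affine transformation of `ℝ³`, with coordinates `(u, t, v)`, with linear part
`!![1, m, -m² / 2; 0, 1, -m; 0, 0, 1]` and translation part `(r / 2, s / 2, m)`. -/
def heisenbergMap (m r s : ℤ) (x : EuclideanSpace ℝ (Fin 3)) : EuclideanSpace ℝ (Fin 3) :=
  !₂[x 0 + m * x 1 - (m : ℝ) ^ 2 / 2 * x 2 + r / 2, x 1 - m * x 2 + s / 2, x 2 + m]

/-- `p : ℝ³ → M` presents the smooth manifold `M` as the quotient of `ℝ³` by some group of
transformations `heisenbergMap m r s`, with `m`, `r`, `s` integers. -/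
structure IsHeisenbergQuotient (p : EuclideanSpace ℝ (Fin 3) → M) : Prop where
  surjective : Function.Surjective p
  isLocalDiffeomorph : IsLocalDiffeomorph (𝓡 3) (𝓡 3) ∞ p
  exists_group : ∃ Γ : Subgroup (Equiv.Perm (EuclideanSpace ℝ (Fin 3))),
    (∀ γ ∈ Γ, ∃ m r s : ℤ, ∀ x, γ x = heisenbergMap m r s x) ∧
    ∀ x y, p x = p y ↔ ∃ γ ∈ Γ, γ x = y

end Quotients

/-! ### The explicit metrics on `ℝ³` -/

/-- The smooth, positive, `1`-periodic functions on the real line. -/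
def PeriodicProfile : Type :=
  {a : ℝ → ℝ // ContDiff ℝ ∞ a ∧ Function.Periodic a 1 ∧ ∀ t, 0 < a t}

/-- The `C^∞` topology: uniform convergence of the functions and of each of their derivatives. -/
instance : TopologicalSpace PeriodicProfile :=
  TopologicalSpace.induced
    (fun a (k : ℕ) ↦ (UniformFun.ofFun (iteratedDeriv k a.1) : UniformFun ℝ ℝ)) inferInstance

/-- The metric `dt² + 2 a(t) du dv` on `ℝ³`, with coordinates `(u, v, t)`. -/
def hyperbolicForm (a : PeriodicProfile) (x v w : EuclideanSpace ℝ (Fin 3)) : ℝ :=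
  v 2 * w 2 + a.1 (x 2) * (v 0 * w 1 + v 1 * w 0)

/-- The metric `a(v) (dt² + 2 du dv)` on `ℝ³`, with coordinates `(u, t, v)`. -/
def parabolicForm (a : PeriodicProfile) (x v w : EuclideanSpace ℝ (Fin 3)) : ℝ :=
  a.1 (x 2) * (v 1 * w 1 + (v 0 * w 2 + v 2 * w 0))

/-- The linear change of coordinates `(u, v, t) ↦ (P (u, v), t)` of `ℝ³`. -/
def planeChange (P : Matrix (Fin 2) (Fin 2) ℝ) (x : EuclideanSpace ℝ (Fin 3)) :
    EuclideanSpace ℝ (Fin 3) :=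
  !₂[P 0 0 * x 0 + P 0 1 * x 1, P 1 0 * x 0 + P 1 1 * x 1, x 2]

end

/-! Each of the two metrics on `ℝ³` is built from one function `a` of one coordinate and a flat
model, so it keeps many affine isometries. Boosts `(α u, α⁻¹ v, t)` and translations in `u, v`
preserve `dt² + 2 a(t) du dv`. Shears and translations in `u, t` preserve `a(v) (dt² + 2 du dv)`. As
`a` is `1`-periodic, these maps may be combined with integral shifts of the distinguished
coordinate. In coordinates diagonalizing `A` the deck group of a hyperbolic bundle acts by boosts
and translations. For parabolic `A` a polynomial change of coordinates turns the deck maps into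
shears with translations. So the metrics descend (`IsDeckFamily.exists_lorentzMetric`).

Noncompactness. Boosts coming from a matrix that commutes with `A`, or shears with suitable integral
parameters, normalize the deck group and descend to isometries. Their powers fix the image of the
origin, yet carry points converging to it to points converging elsewhere. Joint continuity of
evaluation forbids this in a compact group (`LorentzMetric.not_compactSpace_iso`).

Rigidity. Isometries lift to `ℝ³`, and local isometries preserve curvature
(`IsLeviCivita.ricci_eq`). The Ricci tensor of the first metric is a combination of the metric and
`dt²`, which makes `a'' / a` a scalar invariant; that of the second is a multiple of `dv²`, and
comparing it with its covariant derivative gives the invariant `ricciDerivFactor² / ricciFactor³`.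
If these are not constant on any interval, no open set is locally homogeneous. Moreover every
isometry of `ℝ³` is then affine of an explicit form (`hyperbolic_rigidity`, `parabolic_rigidity`).
For the second metric this uses a completeness argument: a certain reciprocal is an affine function
without zeros on a whole line, so it is constant (`parabolic_logDeriv`).

Identity component. Compatibility of an affine lift with the deck group makes its parameters
countable, apart from translations that descend to a compact family. A continuous function with
countable image is constant on a connected set (`LorentzMetric.Iso.eq_of_countable`). Circle-valued
coordinate functions therefore show that the identity component lies in that compact family. For
hyperbolic `A` the whole isometry group is countable.

Genericity. Both conditions fail only if continuous functionals of finite jets at two points vanish,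
and these can be made nonzero by small periodic perturbations; rational intervals give a countable
intersection. An explicit analytic profile satisfying both conditions supplies the bare existence
statements. -/

/-! ### Descent of forms through a quotient of `ℝⁿ` -/

section Quotient

variable {n : ℕ} {M : Type*} [TopologicalSpace M] [ChartedSpace (EuclideanSpace ℝ (Fin n)) M]

/-- A family of differentiable maps of `ℝⁿ` that commute with `p` and act transitively on its
fibres. -/
structure IsDeckFamily (p : EuclideanSpace ℝ (Fin n) → M)
    (D : Set (EuclideanSpace ℝ (Fin n) → EuclideanSpace ℝ (Fin n))) : Prop where
  surjective : Function.Surjective p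
  isLocalDiffeomorph : IsLocalDiffeomorph (𝓡 n) (𝓡 n) ∞ p
  differentiable : ∀ γ ∈ D, Differentiable ℝ γ
  map_deck : ∀ γ ∈ D, ∀ x, p (γ x) = p x
  exists_deck : ∀ x y, p x = p y → ∃ γ ∈ D, γ x = y

/-- The derivative of a local diffeomorphism, as a linear automorphism of the model space. -/
noncomputable def localDiffeoDeriv {p : EuclideanSpace ℝ (Fin n) → M}
    (hp : IsLocalDiffeomorph (𝓡 n) (𝓡 n) ∞ p) (x : EuclideanSpace ℝ (Fin n)) :
    EuclideanSpace ℝ (Fin n) ≃L[ℝ] EuclideanSpace ℝ (Fin n) :=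
  hp.mfderivToContinuousLinearEquiv (by simp) x

theorem mfderiv_comp_differentiable {p : EuclideanSpace ℝ (Fin n) → M}
    (hp : IsLocalDiffeomorph (𝓡 n) (𝓡 n) ∞ p)
    {γ : EuclideanSpace ℝ (Fin n) → EuclideanSpace ℝ (Fin n)} {x : EuclideanSpace ℝ (Fin n)}
    (hγ : DifferentiableAt ℝ γ x) (v : EuclideanSpace ℝ (Fin n)) :
    mfderiv (𝓡 n) (𝓡 n) (p ∘ γ) x v = localDiffeoDeriv hp (γ x) (fderiv ℝ γ x v) := by
  rw [mfderiv_comp x (hp.mdifferentiable (by simp) _) hγ.mdifferentiableAt]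
  rw [mfderiv_eq_fderiv]; rfl

theorem IsDeckFamily.deriv_deck {p : EuclideanSpace ℝ (Fin n) → M}
    {D : Set (EuclideanSpace ℝ (Fin n) → EuclideanSpace ℝ (Fin n))} (h : IsDeckFamily p D)
    {γ : EuclideanSpace ℝ (Fin n) → EuclideanSpace ℝ (Fin n)} (hγ : γ ∈ D)
    (x v : EuclideanSpace ℝ (Fin n)) :
    localDiffeoDeriv h.isLocalDiffeomorph (γ x) (fderiv ℝ γ x v) =
      localDiffeoDeriv h.isLocalDiffeomorph x v := by
  rw [← mfderiv_comp_differentiable h.isLocalDiffeomorph (h.differentiable γ hγ x) v]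
  have : p ∘ γ = p := funext (h.map_deck γ hγ)
  rw [this]; rfl

theorem exists_localInverse {p : EuclideanSpace ℝ (Fin n) → M}
    (hp : IsLocalDiffeomorph (𝓡 n) (𝓡 n) ∞ p) (x : EuclideanSpace ℝ (Fin n)) :
    ∃ (σ : M → EuclideanSpace ℝ (Fin n)) (U : Set M), IsOpen U ∧ p x ∈ U ∧
      ContMDiffOn (𝓡 n) (𝓡 n) ∞ σ U ∧ σ (p x) = x ∧ ∀ y ∈ U, p (σ y) = y :=
  ⟨(hp x).localInverse, (hp x).localInverse.source, (hp x).localInverse.open_source,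
    (hp x).localInverse_mem_source, (hp x).contmdiffOn_localInverse,
    (hp x).localInverse_left_inv (hp x).localInverse_mem_target,
    fun _ hy ↦ (hp x).localInverse_right_inv hy⟩

/-- The derivative of a local inverse. -/
theorem mfderiv_localInverse {p : EuclideanSpace ℝ (Fin n) → M}
    (hp : IsLocalDiffeomorph (𝓡 n) (𝓡 n) ∞ p) {σ : M → EuclideanSpace ℝ (Fin n)} {U : Set M}
    (hU : IsOpen U) (hσ : ContMDiffOn (𝓡 n) (𝓡 n) ∞ σ U) (hpσ : ∀ y ∈ U, p (σ y) = y) {y : M}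
    (hy : y ∈ U) (v : EuclideanSpace ℝ (Fin n)) :
    mfderiv (𝓡 n) (𝓡 n) σ y v = (localDiffeoDeriv hp (σ y)).symm v := by
  have h1 : MDifferentiableAt (𝓡 n) (𝓡 n) σ y :=
    (hσ.contMDiffAt (hU.mem_nhds hy)).mdifferentiableAt (by simp)
  have h2 := mfderiv_comp y (hp.mdifferentiable (by simp) _) h1
  have h3 : p ∘ σ =ᶠ[𝓝 y] id := Filter.eventuallyEq_of_mem (hU.mem_nhds hy) hpσ
  rw [h3.mfderiv_eq, mfderiv_id] at h2
  refine (localDiffeoDeriv hp (σ y)).eq_symm_apply.2 ?_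
  exact (congrArg (fun L : EuclideanSpace ℝ (Fin n) →L[ℝ] EuclideanSpace ℝ (Fin n) => L v) h2).symm

/-- The bilinear form on the tangent space at `p x` that corresponds to `B x`. -/
noncomputable def pushForm {p : EuclideanSpace ℝ (Fin n) → M}
    (hp : IsLocalDiffeomorph (𝓡 n) (𝓡 n) ∞ p)
    (B : EuclideanSpace ℝ (Fin n) → EuclideanSpace ℝ (Fin n) →L[ℝ]
      EuclideanSpace ℝ (Fin n) →L[ℝ] ℝ) (x : EuclideanSpace ℝ (Fin n)) :
    EuclideanSpace ℝ (Fin n) →L[ℝ] EuclideanSpace ℝ (Fin n) →L[ℝ] ℝ :=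
  (B x).bilinearComp
    ((localDiffeoDeriv hp x).symm : EuclideanSpace ℝ (Fin n) →L[ℝ] EuclideanSpace ℝ (Fin n))
    ((localDiffeoDeriv hp x).symm : EuclideanSpace ℝ (Fin n) →L[ℝ] EuclideanSpace ℝ (Fin n))

theorem pushForm_apply {p : EuclideanSpace ℝ (Fin n) → M}
    (hp : IsLocalDiffeomorph (𝓡 n) (𝓡 n) ∞ p)
    (B : EuclideanSpace ℝ (Fin n) → EuclideanSpace ℝ (Fin n) →L[ℝ]
      EuclideanSpace ℝ (Fin n) →L[ℝ] ℝ) (x v w : EuclideanSpace ℝ (Fin n)) :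
    pushForm hp B x v w = B x ((localDiffeoDeriv hp x).symm v) ((localDiffeoDeriv hp x).symm w) :=
  rfl

/-- Deck invariance makes the transported form independent of the preimage. This is what allows the
discontinuous choice `Function.surjInv` in `pushMetric`. -/
theorem IsDeckFamily.pushForm_eq {p : EuclideanSpace ℝ (Fin n) → M}
    {D : Set (EuclideanSpace ℝ (Fin n) → EuclideanSpace ℝ (Fin n))} (h : IsDeckFamily p D)
    {B : EuclideanSpace ℝ (Fin n) → EuclideanSpace ℝ (Fin n) →L[ℝ]
      EuclideanSpace ℝ (Fin n) →L[ℝ] ℝ}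
    (hB : ∀ γ ∈ D, ∀ x v w, B (γ x) (fderiv ℝ γ x v) (fderiv ℝ γ x w) = B x v w)
    {x y : EuclideanSpace ℝ (Fin n)} (hxy : p x = p y) :
    pushForm h.isLocalDiffeomorph B x = pushForm h.isLocalDiffeomorph B y := by
  obtain ⟨γ, hγ, rfl⟩ := h.exists_deck x y hxy
  have key : ∀ v, (localDiffeoDeriv h.isLocalDiffeomorph (γ x)).symm v =
      fderiv ℝ γ x ((localDiffeoDeriv h.isLocalDiffeomorph x).symm v) := fun v ↦ by
    rw [ContinuousLinearEquiv.symm_apply_eq, h.deriv_deck hγ,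
      ContinuousLinearEquiv.apply_symm_apply]
  ext v w
  simp only [pushForm_apply, key, hB γ hγ]

/-- The field of bilinear forms on `M` whose pull-back by `p` is `B`. -/
noncomputable def pushMetric {p : EuclideanSpace ℝ (Fin n) → M}
    {D : Set (EuclideanSpace ℝ (Fin n) → EuclideanSpace ℝ (Fin n))} (h : IsDeckFamily p D)
    (B : EuclideanSpace ℝ (Fin n) → EuclideanSpace ℝ (Fin n) →L[ℝ]
      EuclideanSpace ℝ (Fin n) →L[ℝ] ℝ) (y : M) :
    TangentSpace (𝓡 n) y →L[ℝ] TangentSpace (𝓡 n) y →L[ℝ] ℝ :=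
  pushForm h.isLocalDiffeomorph B (Function.surjInv h.surjective y)

theorem contDiff_flip : ContDiff ℝ ∞ (fun f : EuclideanSpace ℝ (Fin n) →L[ℝ]
    EuclideanSpace ℝ (Fin n) →L[ℝ] ℝ ↦ f.flip) := by
  apply IsBoundedLinearMap.contDiff
  refine ⟨⟨fun f g ↦ rfl, fun c f ↦ rfl⟩, 1, one_pos, fun f ↦ ?_⟩
  rw [ContinuousLinearMap.opNorm_flip, one_mul]

/-- `bilinearComp` is composition, flip, composition, flip, and each of these operations is smooth.
-/
theorem contMDiffAt_bilinearComp {B : M → EuclideanSpace ℝ (Fin n) →L[ℝ]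
      EuclideanSpace ℝ (Fin n) →L[ℝ] ℝ} {L : M → EuclideanSpace ℝ (Fin n) →L[ℝ]
      EuclideanSpace ℝ (Fin n)} {y₀ : M}
    (hB : ContMDiffAt (𝓡 n) 𝓘(ℝ, EuclideanSpace ℝ (Fin n) →L[ℝ]
      EuclideanSpace ℝ (Fin n) →L[ℝ] ℝ) ∞ B y₀)
    (hL : ContMDiffAt (𝓡 n) 𝓘(ℝ, EuclideanSpace ℝ (Fin n) →L[ℝ]
      EuclideanSpace ℝ (Fin n)) ∞ L y₀) :
    ContMDiffAt (𝓡 n) 𝓘(ℝ, EuclideanSpace ℝ (Fin n) →L[ℝ]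
      EuclideanSpace ℝ (Fin n) →L[ℝ] ℝ) ∞ (fun y ↦ (B y).bilinearComp (L y) (L y)) y₀ := by
  have h1 : ContMDiffAt (𝓡 n) 𝓘(ℝ, EuclideanSpace ℝ (Fin n) →L[ℝ]
    EuclideanSpace ℝ (Fin n) →L[ℝ] ℝ) ∞ (fun y ↦ (B y).comp (L y)) y₀ := hB.clm_comp hL
  have hf := (contDiff_flip (n := n)).contMDiff
  have h2 := (hf.contMDiffAt.comp y₀ h1).clm_comp hL
  exact hf.contMDiffAt.comp y₀ h2

variable [IsManifold (𝓡 n) ∞ M]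

/-- The derivative of a local inverse, read in a trivialization of the tangent bundle of `M`. -/
noncomputable def localInverseDeriv (σ : M → EuclideanSpace ℝ (Fin n)) (y₀ y : M) :
    EuclideanSpace ℝ (Fin n) →L[ℝ] EuclideanSpace ℝ (Fin n) :=
  inTangentCoordinates (𝓡 n) (𝓡 n) id σ (mfderiv (𝓡 n) (𝓡 n) σ) y₀ y

theorem localInverseDeriv_apply (σ : M → EuclideanSpace ℝ (Fin n)) (y₀ y : M)
    (hy : y ∈ (trivializationAt (EuclideanSpace ℝ (Fin n))
      (TangentSpace (𝓡 n) : M → Type _) y₀).baseSet)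
    (v : EuclideanSpace ℝ (Fin n)) : localInverseDeriv σ y₀ y v =
      mfderiv (𝓡 n) (𝓡 n) σ y ((trivializationAt (EuclideanSpace ℝ (Fin n))
      (TangentSpace (𝓡 n) : M → Type _) y₀).symm y v) := by
  have h1 : localInverseDeriv σ y₀ y v = (trivializationAt (EuclideanSpace ℝ (Fin n))
      (TangentSpace (𝓡 n) : EuclideanSpace ℝ (Fin n) → Type _)
        (σ y₀)).continuousLinearMapAt ℝ (σ y) (mfderiv (𝓡 n) (𝓡 n) σ y
        ((trivializationAt (EuclideanSpace ℝ (Fin n))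
      (TangentSpace (𝓡 n) : M → Type _) y₀).symmL ℝ y v)) := rfl
  rw [h1, TangentBundle.continuousLinearMapAt_model_space]
  exact congrArg (fun u ↦ (mfderiv (𝓡 n) (𝓡 n) σ y :
    EuclideanSpace ℝ (Fin n) →L[ℝ] EuclideanSpace ℝ (Fin n)) u)
    (Bundle.Trivialization.symmL_apply _ hy v)

theorem inCoordinates_bilinear {y₀ y : M}
    (hy : y ∈ (trivializationAt (EuclideanSpace ℝ (Fin n))
      (TangentSpace (𝓡 n) : M → Type _) y₀).baseSet)
    (φ : TangentSpace (𝓡 n) y →L[ℝ] TangentSpace (𝓡 n) y →L[ℝ] ℝ)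
    (v w : EuclideanSpace ℝ (Fin n)) :
    ContinuousLinearMap.inCoordinates (EuclideanSpace ℝ (Fin n)) (TangentSpace (𝓡 n) : M → Type _)
      (EuclideanSpace ℝ (Fin n) →L[ℝ] ℝ) (fun x : M ↦ TangentSpace (𝓡 n) x →L[ℝ] ℝ) y₀ y y₀ y φ
      v w = φ ((trivializationAt (EuclideanSpace ℝ (Fin n))
      (TangentSpace (𝓡 n) : M → Type _) y₀).symm y v) ((trivializationAt (EuclideanSpace ℝ (Fin n))
      (TangentSpace (𝓡 n) : M → Type _) y₀).symm y w) := by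
  refine (inCoordinates_apply_eq₂ hy hy (by simp)).trans ?_
  simp only [Bundle.Trivial.fiberBundle_trivializationAt',
    Bundle.Trivial.linearMapAt_trivialization, LinearMap.id_coe, id_eq]

theorem localInverse_bilinear {p : EuclideanSpace ℝ (Fin n) → M}
    (hp : IsLocalDiffeomorph (𝓡 n) (𝓡 n) ∞ p) {σ : M → EuclideanSpace ℝ (Fin n)} {U : Set M}
    (hU : IsOpen U) (hσ : ContMDiffOn (𝓡 n) (𝓡 n) ∞ σ U) (hpσ : ∀ y ∈ U, p (σ y) = y) {y₀ y : M}
    (hyU : y ∈ U) (hy : y ∈ (trivializationAt (EuclideanSpace ℝ (Fin n))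
      (TangentSpace (𝓡 n) : M → Type _) y₀).baseSet)
    (B : EuclideanSpace ℝ (Fin n) → EuclideanSpace ℝ (Fin n) →L[ℝ]
      EuclideanSpace ℝ (Fin n) →L[ℝ] ℝ) (v w : EuclideanSpace ℝ (Fin n)) :
    (B (σ y)).bilinearComp (localInverseDeriv σ y₀ y) (localInverseDeriv σ y₀ y) v w =
      pushForm hp B (σ y) ((trivializationAt (EuclideanSpace ℝ (Fin n))
      (TangentSpace (𝓡 n) : M → Type _) y₀).symm y v) ((trivializationAt (EuclideanSpace ℝ (Fin n))
      (TangentSpace (𝓡 n) : M → Type _) y₀).symm y w) := by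
  rw [ContinuousLinearMap.bilinearComp_apply, localInverseDeriv_apply _ _ _ hy,
    localInverseDeriv_apply _ _ _ hy]
  exact (congrArg₂ (fun a b : EuclideanSpace ℝ (Fin n) ↦ B (σ y) a b)
    (mfderiv_localInverse hp hU hσ hpσ hyU _) (mfderiv_localInverse hp hU hσ hpσ hyU _)).trans
    (pushForm_apply hp B _ _ _).symm

/-- Near `p x₀` the metric is the pull-back of `B` by a smooth local section `σ` of `p`, whatever
preimages `surjInv` selects. In a trivialization it is `B ∘ σ` composed in both arguments with the
derivative of `σ`. -/
theorem contMDiff_pushMetric {p : EuclideanSpace ℝ (Fin n) → M}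
    {D : Set (EuclideanSpace ℝ (Fin n) → EuclideanSpace ℝ (Fin n))} (h : IsDeckFamily p D)
    {B : EuclideanSpace ℝ (Fin n) → EuclideanSpace ℝ (Fin n) →L[ℝ]
      EuclideanSpace ℝ (Fin n) →L[ℝ] ℝ} (hBs : ContDiff ℝ ∞ B)
    (hB : ∀ γ ∈ D, ∀ x v w, B (γ x) (fderiv ℝ γ x v) (fderiv ℝ γ x w) = B x v w) :
    ContMDiff (𝓡 n) ((𝓡 n).prod 𝓘(ℝ, EuclideanSpace ℝ (Fin n) →L[ℝ]
      EuclideanSpace ℝ (Fin n) →L[ℝ] ℝ)) ∞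
    (fun y : M ↦ Bundle.TotalSpace.mk' (EuclideanSpace ℝ (Fin n) →L[ℝ]
      EuclideanSpace ℝ (Fin n) →L[ℝ] ℝ)
      (E := fun x : M ↦ TangentSpace (𝓡 n) x →L[ℝ] TangentSpace (𝓡 n) x →L[ℝ] ℝ) y
        (pushMetric h B y)) := by
  intro y₀
  have hp := h.isLocalDiffeomorph
  obtain ⟨x₀, rfl⟩ := h.surjective y₀
  rw [contMDiffAt_hom_bundle]
  refine ⟨contMDiffAt_id, ?_⟩
  obtain ⟨σ, U, hU, hxU, hσ, hσx, hpσ⟩ := exists_localInverse hp x₀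
  have hσs : ContMDiffAt (𝓡 n) (𝓡 n) ∞ σ (p x₀) := hσ.contMDiffAt (hU.mem_nhds hxU)
  have hL : ContMDiffAt (𝓡 n) 𝓘(ℝ, EuclideanSpace ℝ (Fin n) →L[ℝ] EuclideanSpace ℝ (Fin n)) ∞
    (localInverseDeriv σ (p x₀)) (p x₀) := hσs.mfderiv_const (m := ∞) (by simp)
  have hsm := contMDiffAt_bilinearComp (hBs.contMDiff.contMDiffAt.comp (p x₀) hσs) hL
  refine hsm.congr_of_eventuallyEq ?_
  have e2 : ∀ᶠ y in 𝓝 (p x₀), y ∈ (trivializationAt (EuclideanSpace ℝ (Fin n))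
      (TangentSpace (𝓡 n) : M → Type _) (p x₀)).baseSet :=
    (trivializationAt (EuclideanSpace ℝ (Fin n))
      (TangentSpace (𝓡 n) : M → Type _) (p x₀)).open_baseSet.mem_nhds
        (FiberBundle.mem_baseSet_trivializationAt' _)
  filter_upwards [hU.mem_nhds hxU, e2] with y hy hy2
  have hpy : pushForm hp B (Function.surjInv h.surjective y) = pushForm hp B (σ y) :=
    h.pushForm_eq hB ((Function.surjInv_eq h.surjective y).trans (hpσ y hy).symm)
  refine ContinuousLinearMap.ext fun v ↦ ContinuousLinearMap.ext fun w ↦ ?_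
  refine (inCoordinates_bilinear hy2 (pushMetric h B y) v w).trans ?_
  refine Eq.trans ?_ (localInverse_bilinear hp hU hσ hpσ hy hy2 B v w).symm
  rw [← hpy]
  rfl

end Quotient

/-! ### Metrics, isometries and time orientations of the quotient -/

section Quotient

variable {n : ℕ} {M : Type*} [TopologicalSpace M] [ChartedSpace (EuclideanSpace ℝ (Fin n)) M]
  [IsManifold (𝓡 n) ∞ M]

/-- All tangent spaces are the same model space, so a form can be moved along an equality of base
points without casts. -/
theorem LorentzMetric.val_congr (g : LorentzMetric n M) {y y' : M} (h : y = y')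
    (v w : EuclideanSpace ℝ (Fin n)) :
    (g.val y : EuclideanSpace ℝ (Fin n) →L[ℝ] EuclideanSpace ℝ (Fin n) →L[ℝ] ℝ) v w =
      (g.val y' : EuclideanSpace ℝ (Fin n) →L[ℝ] EuclideanSpace ℝ (Fin n) →L[ℝ] ℝ) v w := by
  subst h; rfl

/-- A Lorentz metric of `ℝⁿ` that is invariant under the deck maps descends to the quotient. -/
theorem IsDeckFamily.exists_lorentzMetric {p : EuclideanSpace ℝ (Fin n) → M}
    {D : Set (EuclideanSpace ℝ (Fin n) → EuclideanSpace ℝ (Fin n))} (h : IsDeckFamily p D)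
    {B : EuclideanSpace ℝ (Fin n) → EuclideanSpace ℝ (Fin n) →L[ℝ]
      EuclideanSpace ℝ (Fin n) →L[ℝ] ℝ} (hBs : ContDiff ℝ ∞ B)
    (hB : ∀ γ ∈ D, ∀ x v w, B (γ x) (fderiv ℝ γ x v) (fderiv ℝ γ x w) = B x v w)
    (hsymm : ∀ x v w, B x v w = B x w v)
    (hsign : ∀ x, ∃ v, B x v v < 0 ∧ ∀ w, B x v w = 0 → w ≠ 0 → 0 < B x w w) :
    ∃ g : LorentzMetric n M, g.PullsBackTo p (fun x v w ↦ B x v w) := by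
  have hp := h.isLocalDiffeomorph
  refine ⟨⟨pushMetric h B, fun y v w ↦ ?_, fun y ↦ ?_, contMDiff_pushMetric h hBs hB⟩,
    fun x v w ↦ ?_⟩
  · exact hsymm _ _ _
  · obtain ⟨v, hv, hw⟩ := hsign (Function.surjInv h.surjective y)
    set e := localDiffeoDeriv hp (Function.surjInv h.surjective y) with he
    refine ⟨e v, ?_, fun w h1 h2 ↦ ?_⟩
    · change B _ (e.symm (e v)) (e.symm (e v)) < 0
      rwa [e.symm_apply_apply]
    · change B _ (e.symm (e v)) (e.symm w) = 0 at h1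
      change 0 < B _ (e.symm w) (e.symm w)
      rw [e.symm_apply_apply] at h1
      exact hw _ h1 (fun h3 ↦ h2 (e.symm.map_eq_zero_iff.1 h3))
  · change pushForm hp B (Function.surjInv h.surjective (p x)) (localDiffeoDeriv hp x v)
      (localDiffeoDeriv hp x w) = B x v w
    rw [h.pushForm_eq hB (Function.surjInv_eq h.surjective (p x)), pushForm_apply,
      ContinuousLinearEquiv.symm_apply_apply, ContinuousLinearEquiv.symm_apply_apply]

theorem LorentzMetric.PullsBackTo.val_deriv {g : LorentzMetric n M}
    {p : EuclideanSpace ℝ (Fin n) → M} (hp : IsLocalDiffeomorph (𝓡 n) (𝓡 n) ∞ p)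
    {b : EuclideanSpace ℝ (Fin n) → EuclideanSpace ℝ (Fin n) → EuclideanSpace ℝ (Fin n) → ℝ}
    (hg : g.PullsBackTo p b) (x v w : EuclideanSpace ℝ (Fin n)) :
    (g.val (p x) : EuclideanSpace ℝ (Fin n) →L[ℝ] EuclideanSpace ℝ (Fin n) →L[ℝ] ℝ)
      (localDiffeoDeriv hp x v) (localDiffeoDeriv hp x w) = b x v w :=
  hg x v w

/-- The bridge between `M` and `ℝⁿ`. It asks for `p ∘ F = f ∘ p` only near `x`, so that it serves
for descended maps, for global lifts and for lifts of local isometries. -/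
theorem LorentzMetric.PullsBackTo.preservedAt_iff {g : LorentzMetric n M}
    {p : EuclideanSpace ℝ (Fin n) → M} (hp : IsLocalDiffeomorph (𝓡 n) (𝓡 n) ∞ p)
    {b : EuclideanSpace ℝ (Fin n) → EuclideanSpace ℝ (Fin n) → EuclideanSpace ℝ (Fin n) → ℝ}
    (hg : g.PullsBackTo p b) {f : M → M}
    {F : EuclideanSpace ℝ (Fin n) → EuclideanSpace ℝ (Fin n)} {x : EuclideanSpace ℝ (Fin n)}
    (hf : MDifferentiableAt (𝓡 n) (𝓡 n) f (p x)) (hF : DifferentiableAt ℝ F x)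
    (hfF : p ∘ F =ᶠ[𝓝 x] f ∘ p) :
    g.PreservedAt f (p x) ↔ ∀ v w, b (F x) (fderiv ℝ F x v) (fderiv ℝ F x w) = b x v w := by
  have key : ∀ v : EuclideanSpace ℝ (Fin n),
      (mfderiv (𝓡 n) (𝓡 n) f (p x) : EuclideanSpace ℝ (Fin n) →L[ℝ] EuclideanSpace ℝ (Fin n))
        (localDiffeoDeriv hp x v) = localDiffeoDeriv hp (F x) (fderiv ℝ F x v) := fun v ↦ by
    have h1 := mfderiv_comp x hf (hp.mdifferentiable (by simp) x)
    rw [← hfF.mfderiv_eq] at h1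
    rw [← mfderiv_comp_differentiable hp hF v]
    exact (congrArg (fun L : EuclideanSpace ℝ (Fin n) →L[ℝ] EuclideanSpace ℝ (Fin n) => L v)
      h1).symm
  have key2 : ∀ v w : EuclideanSpace ℝ (Fin n),
      (g.val (f (p x)) : EuclideanSpace ℝ (Fin n) →L[ℝ] EuclideanSpace ℝ (Fin n) →L[ℝ] ℝ)
      ((mfderiv (𝓡 n) (𝓡 n) f (p x) : EuclideanSpace ℝ (Fin n) →L[ℝ] EuclideanSpace ℝ (Fin n))
        (localDiffeoDeriv hp x v))
      ((mfderiv (𝓡 n) (𝓡 n) f (p x) : EuclideanSpace ℝ (Fin n) →L[ℝ] EuclideanSpace ℝ (Fin n))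
        (localDiffeoDeriv hp x w)) = b (F x) (fderiv ℝ F x v) (fderiv ℝ F x w) := fun v w ↦ by
    rw [key, key, ← hg.val_deriv hp]
    exact g.val_congr hfF.eq_of_nhds.symm _ _
  constructor
  · intro h v w
    rw [← key2, ← hg.val_deriv hp]
    exact h _ _
  · intro h v w
    obtain ⟨v', rfl⟩ : ∃ v' : EuclideanSpace ℝ (Fin n), localDiffeoDeriv hp x v' = v :=
      (localDiffeoDeriv hp x).surjective v
    obtain ⟨w', rfl⟩ : ∃ w' : EuclideanSpace ℝ (Fin n), localDiffeoDeriv hp x w' = w :=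
      (localDiffeoDeriv hp x).surjective w
    exact (key2 v' w').trans ((h _ _).trans (hg.val_deriv hp _ _ _).symm)

omit [IsManifold (𝓡 n) ∞ M] in
theorem contMDiff_descend {p : EuclideanSpace ℝ (Fin n) → M} (hs : Function.Surjective p)
    (hp : IsLocalDiffeomorph (𝓡 n) (𝓡 n) ∞ p)
    {F : EuclideanSpace ℝ (Fin n) → EuclideanSpace ℝ (Fin n)} (hF : ContDiff ℝ ∞ F)
    {f : M → M} (hfF : ∀ x, f (p x) = p (F x)) : ContMDiff (𝓡 n) (𝓡 n) ∞ f := by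
  intro y
  obtain ⟨x, rfl⟩ := hs y
  obtain ⟨σ, U, hU, hxU, hσ, hσx, hpσ⟩ := exists_localInverse hp x
  have h1 : ContMDiffAt (𝓡 n) (𝓡 n) ∞ (fun z ↦ p (F (σ z))) (p x) :=
    (hp.contMDiff.comp hF.contMDiff).contMDiffAt.comp (p x) (hσ.contMDiffAt (hU.mem_nhds hxU))
  refine h1.congr_of_eventuallyEq (Filter.eventuallyEq_of_mem (hU.mem_nhds hxU) fun z hz ↦ ?_)
  rw [← hfF, hpσ z hz]

/-- A diffeomorphism of `ℝⁿ` that is compatible with `p` and preserves the form `b` induces an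
isometry of the quotient. -/
theorem LorentzMetric.PullsBackTo.exists_iso {g : LorentzMetric n M}
    {p : EuclideanSpace ℝ (Fin n) → M} (hs : Function.Surjective p)
    (hp : IsLocalDiffeomorph (𝓡 n) (𝓡 n) ∞ p)
    {b : EuclideanSpace ℝ (Fin n) → EuclideanSpace ℝ (Fin n) → EuclideanSpace ℝ (Fin n) → ℝ}
    (hg : g.PullsBackTo p b) {F G : EuclideanSpace ℝ (Fin n) → EuclideanSpace ℝ (Fin n)}
    (hF : ContDiff ℝ ∞ F) (hG : ContDiff ℝ ∞ G) (hFG : ∀ x, F (G x) = x) (hGF : ∀ x, G (F x) = x)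
    (hFp : ∀ x y, p x = p y → p (F x) = p (F y)) (hGp : ∀ x y, p x = p y → p (G x) = p (G y))
    (hFb : ∀ x v w, b (F x) (fderiv ℝ F x v) (fderiv ℝ F x w) = b x v w) :
    ∃ f : g.Iso, ∀ x, f.1 (p x) = p (F x) := by
  have hf : ∀ x, p (F (Function.surjInv hs (p x))) = p (F x) :=
    fun x ↦ hFp _ _ (Function.surjInv_eq hs _)
  have hk : ∀ x, p (G (Function.surjInv hs (p x))) = p (G x) :=
    fun x ↦ hGp _ _ (Function.surjInv_eq hs _)
  have hfs : ContMDiff (𝓡 n) (𝓡 n) ∞ (fun y ↦ p (F (Function.surjInv hs y))) :=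
    contMDiff_descend hs hp hF hf
  refine ⟨⟨⟨⟨fun y ↦ p (F (Function.surjInv hs y)), fun y ↦ p (G (Function.surjInv hs y)),
    fun y ↦ ?_, fun y ↦ ?_⟩, hfs, contMDiff_descend hs hp hG hk⟩, fun y ↦ ?_⟩, fun x ↦ hf x⟩
  · obtain ⟨x, rfl⟩ := hs y
    simp only [hf, hk, hGF]
  · obtain ⟨x, rfl⟩ := hs y
    simp only [hf, hk, hFG]
  · obtain ⟨x, rfl⟩ := hs y
    refine (hg.preservedAt_iff hp (hfs.mdifferentiable (by simp) _)
      (hF.differentiable (by simp) x) ?_).2 (hFb x)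
    exact Filter.Eventually.of_forall fun z ↦ (hf z).symm

omit [IsManifold (𝓡 n) ∞ M] in
-- By continuity `F` stays in a domain on which `p` is invertible, so near `x` it is a local inverse
-- of `p` applied to `f ∘ p`.
theorem contDiffAt_lift {p : EuclideanSpace ℝ (Fin n) → M}
    (hp : IsLocalDiffeomorph (𝓡 n) (𝓡 n) ∞ p) {f : M → M}
    {F : EuclideanSpace ℝ (Fin n) → EuclideanSpace ℝ (Fin n)} {x : EuclideanSpace ℝ (Fin n)}
    (hf : ContMDiffAt (𝓡 n) (𝓡 n) ∞ f (p x)) (hF : ContinuousAt F x)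
    (hfF : p ∘ F =ᶠ[𝓝 x] f ∘ p) : ContDiffAt ℝ ∞ F x := by
  obtain ⟨Φ, hx, hΦ⟩ := hp (F x)
  have h1 : ContMDiffAt (𝓡 n) (𝓡 n) ∞ Φ.symm (f (p x)) := by
    refine Φ.symm.contMDiffOn.contMDiffAt (Φ.open_target.mem_nhds ?_)
    rw [show f (p x) = Φ (F x) from hfF.eq_of_nhds.symm.trans (hΦ hx)]
    exact Φ.map_source hx
  have h2 : ContMDiffAt (𝓡 n) (𝓡 n) ∞ (Φ.symm ∘ f ∘ p) x :=
    h1.comp x (hf.comp x (hp.contMDiff x))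
  refine (h2.congr_of_eventuallyEq ?_).contDiffAt
  filter_upwards [hfF, hF.preimage_mem_nhds (Φ.open_source.mem_nhds hx)] with z hz hz2
  change F z = Φ.symm (f (p z))
  rw [show f (p z) = Φ (F z) from hz.symm.trans (hΦ hz2)]
  exact (Φ.left_inv hz2).symm

/-- Isometries lift to the universal covering. -/
theorem LorentzMetric.PullsBackTo.exists_lift {g : LorentzMetric n M}
    {p : EuclideanSpace ℝ (Fin n) → M} (hs : Function.Surjective p) (hc : IsCoveringMap p)
    (hp : IsLocalDiffeomorph (𝓡 n) (𝓡 n) ∞ p)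
    {b : EuclideanSpace ℝ (Fin n) → EuclideanSpace ℝ (Fin n) → EuclideanSpace ℝ (Fin n) → ℝ}
    (hg : g.PullsBackTo p b) (f : g.Iso) :
    ∃ F : EuclideanSpace ℝ (Fin n) → EuclideanSpace ℝ (Fin n), ContDiff ℝ ∞ F ∧
      (∀ x, p (F x) = f.1 (p x)) ∧
      ∀ x v w, b (F x) (fderiv ℝ F x v) (fderiv ℝ F x w) = b x v w := by
  obtain ⟨e₀, he₀⟩ := hs (f.1 (p 0))
  -- `ℝⁿ` is simply connected and locally path connected, so `f ∘ p` lifts through the covering.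
  obtain ⟨F, ⟨-, hF⟩, -⟩ := hc.existsUnique_continuousMap_lifts
    (⟨fun x ↦ f.1 (p x), f.1.continuous.comp hp.contMDiff.continuous⟩ :
      C(EuclideanSpace ℝ (Fin n), M)) 0 e₀ he₀
  have hF' : ∀ x, p (F x) = f.1 (p x) := fun x ↦ congrFun hF x
  have hsm : ContDiff ℝ ∞ F := contDiff_iff_contDiffAt.2 fun x ↦
    contDiffAt_lift hp (f.1.contMDiff (p x)) F.continuous.continuousAt
      (Filter.Eventually.of_forall hF')
  exact ⟨F, hsm, hF', fun x ↦ (hg.preservedAt_iff hp (f.1.contMDiff.mdifferentiable (by simp) _)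
    (hsm.differentiable (by simp) x) (Filter.Eventually.of_forall hF')).1 (f.2 (p x))⟩

/-- A local isometry between neighbourhoods of `p x` and `p y` lifts to a local isometry between
neighbourhoods of `x` and `y`. -/
theorem LorentzMetric.PullsBackTo.exists_local_lift {g : LorentzMetric n M}
    {p : EuclideanSpace ℝ (Fin n) → M} (hp : IsLocalDiffeomorph (𝓡 n) (𝓡 n) ∞ p)
    {b : EuclideanSpace ℝ (Fin n) → EuclideanSpace ℝ (Fin n) → EuclideanSpace ℝ (Fin n) → ℝ}
    (hg : g.PullsBackTo p b) {U : Set M} (hU : g.IsLocallyHomogeneousOn U)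
    {x y : EuclideanSpace ℝ (Fin n)} (hx : p x ∈ U) (hy : p y ∈ U) :
    ∃ F : EuclideanSpace ℝ (Fin n) → EuclideanSpace ℝ (Fin n), F x = y ∧
      ∀ᶠ z in 𝓝 x, ContDiffAt ℝ ∞ F z ∧
        ∀ v w, b (F z) (fderiv ℝ F z v) (fderiv ℝ F z w) = b z v w := by
  obtain ⟨f, -, -, hxs, hfx, hf⟩ := hU _ hx _ hy
  obtain ⟨σ, V, hV, hyV, hσ, hσy, hpσ⟩ := exists_localInverse hp y
  have hfc : ContinuousAt (fun z ↦ f (p z)) x :=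
    ContinuousAt.comp (x := x) (f := p) (g := f)
      ((f.contMDiffOn.continuousOn.continuousAt (f.open_source.mem_nhds hxs)))
      hp.contMDiff.continuous.continuousAt
  have e1 : ∀ᶠ z in 𝓝 x, p z ∈ f.source :=
    hp.contMDiff.continuous.continuousAt.preimage_mem_nhds (f.open_source.mem_nhds hxs)
  have e2 : ∀ᶠ z in 𝓝 x, f (p z) ∈ V :=
    hfc.preimage_mem_nhds (hV.mem_nhds (by rw [hfx]; exact hyV))
  refine ⟨fun z ↦ σ (f (p z)), ?_, ?_⟩
  · change σ (f (p x)) = y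
    rw [hfx, hσy]
  filter_upwards [e1.eventually_nhds, e2.eventually_nhds] with z h1 h2
  have hfz := f.contMDiffOn.contMDiffAt (f.open_source.mem_nhds h1.self_of_nhds)
  have hsm : ContDiffAt ℝ ∞ (fun z ↦ σ (f (p z))) z :=
    ((hσ.contMDiffAt (hV.mem_nhds h2.self_of_nhds)).comp z
      (hfz.comp z (hp.contMDiff z))).contDiffAt
  refine ⟨hsm, (hg.preservedAt_iff hp (hfz.mdifferentiableAt (by simp))
    (hsm.differentiableAt (by simp)) ?_).1 (hf _ h1.self_of_nhds)⟩
  filter_upwards [h2] with w hw using hpσ _ hw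

/-- A timelike vector field of `ℝⁿ` that is invariant under the deck maps induces a time
orientation of the quotient. -/
theorem LorentzMetric.PullsBackTo.timeOrientable {g : LorentzMetric n M}
    {p : EuclideanSpace ℝ (Fin n) → M}
    {D : Set (EuclideanSpace ℝ (Fin n) → EuclideanSpace ℝ (Fin n))} (h : IsDeckFamily p D)
    {b : EuclideanSpace ℝ (Fin n) → EuclideanSpace ℝ (Fin n) → EuclideanSpace ℝ (Fin n) → ℝ}
    (hg : g.PullsBackTo p b) {X : EuclideanSpace ℝ (Fin n) → EuclideanSpace ℝ (Fin n)}
    (hX : ContDiff ℝ ∞ X) (hXD : ∀ γ ∈ D, ∀ x, fderiv ℝ γ x (X x) = X (γ x))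
    (hXb : ∀ x, b x (X x) (X x) < 0) : g.TimeOrientable := by
  have hp := h.isLocalDiffeomorph
  have key : ∀ x y, p x = p y → localDiffeoDeriv hp x (X x) = localDiffeoDeriv hp y (X y) := by
    intro x y hxy
    obtain ⟨γ, hγ, rfl⟩ := h.exists_deck x y hxy
    rw [← hXD γ hγ, h.deriv_deck hγ]
  set s := Function.surjInv h.surjective with hs
  have hps : ∀ y, p (s y) = y := Function.surjInv_eq h.surjective
  refine ⟨fun y ↦ localDiffeoDeriv hp (s y) (X (s y)), fun y ↦ ?_, fun y ↦ ?_⟩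
  · obtain ⟨x, rfl⟩ := h.surjective y
    obtain ⟨σ, U, hU, hxU, hσ, hσx, hpσ⟩ := exists_localInverse hp x
    have h1 : ContMDiff (𝓡 n) (𝓡 n).tangent ∞
        (fun x ↦ (⟨x, X x⟩ : TangentBundle (𝓡 n) (EuclideanSpace ℝ (Fin n)))) :=
      contMDiff_vectorSpace_iff_contDiff.2 hX
    have h2 := ((hp.contMDiff.contMDiff_tangentMap (m := ∞) (by simp)).comp h1).contMDiffAt.comp
      (p x) (hσ.contMDiffAt (hU.mem_nhds hxU))
    refine h2.congr_of_eventuallyEq (Filter.eventuallyEq_of_mem (hU.mem_nhds hxU) fun z hz ↦ ?_)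
    have h3 : ∀ z' : M, z' = z → (⟨z, localDiffeoDeriv hp (s z) (X (s z))⟩ : TangentBundle (𝓡 n) M)
        = ⟨z', localDiffeoDeriv hp (s z) (X (s z))⟩ := fun z' hz' ↦ by subst hz'; rfl
    refine (h3 (p (σ z)) (hpσ z hz)).trans ?_
    exact congrArg (fun u : EuclideanSpace ℝ (Fin n) ↦ (⟨p (σ z), u⟩ : TangentBundle (𝓡 n) M))
      (key (s z) (σ z) ((hps z).trans (hpσ z hz).symm))
  · refine lt_of_eq_of_lt ?_ (hXb (s y))
    rw [← hg.val_deriv hp]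
    exact g.val_congr (hps y).symm _ _

end Quotient

/-! ### Invariance of the curvature under local isometries -/

section Curvature

variable {E : Type*} [NormedAddCommGroup E] [NormedSpace ℝ E]

/-- `F` preserves the field of bilinear forms `G` near `x`, and is smooth there. -/
def IsLocalIsometryAt (G : E → E →L[ℝ] E →L[ℝ] ℝ) (F : E → E) (x : E) : Prop :=
  ∀ᶠ z in 𝓝 x, ContDiffAt ℝ ∞ F z ∧ ∀ v w, G (F z) (fderiv ℝ F z v) (fderiv ℝ F z w) = G z v w

/-- `Γ` is the Levi-Civita connection of the field of nondegenerate symmetric forms `G`. -/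
structure IsLeviCivita (G : E → E →L[ℝ] E →L[ℝ] ℝ) (Γ : E → E →L[ℝ] E →L[ℝ] E) : Prop where
  contDiff_form : ContDiff ℝ ∞ G
  contDiff_christoffel : ContDiff ℝ ∞ Γ
  symm : ∀ x v w, G x v w = G x w v
  nondegenerate : ∀ x v, (∀ w, G x v w = 0) → v = 0
  koszul : ∀ x u v w, 2 * G x (Γ x u v) w =
    fderiv ℝ G x u v w + fderiv ℝ G x v u w - fderiv ℝ G x w u v

/-- The curvature tensor of the connection `Γ`. -/
noncomputable def curvature (Γ : E → E →L[ℝ] E →L[ℝ] E) (x v w : E) : E →L[ℝ] E :=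
  ((fderiv ℝ Γ x).flip v).flip w - (fderiv ℝ Γ x v).flip w + (Γ x).flip (Γ x v w) -
    (Γ x v).comp ((Γ x).flip w)

theorem curvature_apply (Γ : E → E →L[ℝ] E →L[ℝ] E) (x u v w : E) :
    curvature Γ x v w u = fderiv ℝ Γ x u v w - fderiv ℝ Γ x v u w + Γ x u (Γ x v w) -
      Γ x v (Γ x u w) := rfl

/-- The Ricci tensor of the connection `Γ`. -/
noncomputable def ricci (Γ : E → E →L[ℝ] E →L[ℝ] E) (x v w : E) : ℝ :=
  LinearMap.trace ℝ E (curvature Γ x v w : E →ₗ[ℝ] E)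

variable {G : E → E →L[ℝ] E →L[ℝ] ℝ} {Γ : E → E →L[ℝ] E →L[ℝ] E} {F : E → E} {x : E}

theorem IsLocalIsometryAt.eventually (h : IsLocalIsometryAt G F x) :
    ∀ᶠ z in 𝓝 x, IsLocalIsometryAt G F z :=
  h.eventually_nhds

theorem IsLocalIsometryAt.contDiffAt (h : IsLocalIsometryAt G F x) : ContDiffAt ℝ ∞ F x :=
  h.self_of_nhds.1

theorem IsLocalIsometryAt.form_eq (h : IsLocalIsometryAt G F x) (v w : E) :
    G (F x) (fderiv ℝ F x v) (fderiv ℝ F x w) = G x v w :=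
  h.self_of_nhds.2 v w

/-- A vector killed by the derivative of an isometry is orthogonal to every vector. -/
theorem IsLeviCivita.injective_fderiv (hG : IsLeviCivita G Γ) (h : IsLocalIsometryAt G F x) :
    Function.Injective (fderiv ℝ F x) := by
  rw [injective_iff_map_eq_zero]
  intro v hv
  refine hG.nondegenerate x v fun w ↦ ?_
  rw [← h.form_eq v w, hv, map_zero, zero_apply]

theorem IsLeviCivita.surjective_fderiv [FiniteDimensional ℝ E] (hG : IsLeviCivita G Γ)
    (h : IsLocalIsometryAt G F x) : Function.Surjective (fderiv ℝ F x) :=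
  (LinearMap.injective_iff_surjective (f := (fderiv ℝ F x : E →ₗ[ℝ] E))).1
    (hG.injective_fderiv h)

theorem hasFDerivAt_fderiv {E' : Type*} [NormedAddCommGroup E'] [NormedSpace ℝ E'] {F : E → E'}
    (h : ContDiffAt ℝ ∞ F x) :
    HasFDerivAt (fderiv ℝ F) (fderiv ℝ (fderiv ℝ F) x) x :=
  ((h.fderiv_right (m := ∞) (by simp)).differentiableAt (by simp)).hasFDerivAt

/-- The isometry equation differentiated in the direction `u`. Three copies of it yield the rule for
Christoffel symbols, as in the uniqueness proof of the Levi-Civita connection. -/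
theorem IsLocalIsometryAt.fderiv_form_eq (hG : ContDiff ℝ ∞ G) (h : IsLocalIsometryAt G F x)
    (u v w : E) :
    fderiv ℝ G (F x) (fderiv ℝ F x u) (fderiv ℝ F x v) (fderiv ℝ F x w) +
      G (F x) (fderiv ℝ (fderiv ℝ F) x u v) (fderiv ℝ F x w) +
      G (F x) (fderiv ℝ F x v) (fderiv ℝ (fderiv ℝ F) x u w) = fderiv ℝ G x u v w := by
  have hF := (h.contDiffAt.differentiableAt (by simp)).hasFDerivAt
  have hF2 := hasFDerivAt_fderiv h.contDiffAt
  have hGd : ∀ y, HasFDerivAt G (fderiv ℝ G y) y :=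
    fun y ↦ (hG.differentiable (by simp) y).hasFDerivAt
  have h0 : HasFDerivAt (fun z ↦ G (F z)) ((fderiv ℝ G (F x)).comp (fderiv ℝ F x)) x :=
    HasFDerivAt.comp (G := E →L[ℝ] E →L[ℝ] ℝ) x (hGd (F x)) hF
  have h1 := (h0.clm_apply (hF2.clm_apply (hasFDerivAt_const v x))).clm_apply
    (hF2.clm_apply (hasFDerivAt_const w x))
  have h2 := ((hGd x).clm_apply (hasFDerivAt_const v x)).clm_apply (hasFDerivAt_const w x)
  have h3 : (fun z ↦ (G (F z) (fderiv ℝ F z v)) (fderiv ℝ F z w)) =ᶠ[𝓝 x]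
      (fun z ↦ G z v w) := h.mono fun z hz ↦ hz.2 v w
  have h4 := congrArg (fun L : E →L[ℝ] ℝ ↦ L u) ((h1.congr_of_eventuallyEq h3.symm).unique h2)
  simp at h4
  linarith

theorem fderiv_fderiv_symm {E' : Type*} [NormedAddCommGroup E'] [NormedSpace ℝ E'] {F : E → E'}
    (h : ContDiffAt ℝ ∞ F x) (u v : E) :
    fderiv ℝ (fderiv ℝ F) x u v = fderiv ℝ (fderiv ℝ F) x v u :=
  (h.isSymmSndFDerivAt (by simpa using WithTop.coe_le_coe.2 (le_top : (2 : ℕ∞) ≤ ⊤))) u v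

/-- The transformation rule of the Christoffel symbols under isometries. -/
theorem IsLeviCivita.fderiv_fderiv [FiniteDimensional ℝ E] (hG : IsLeviCivita G Γ)
    (h : IsLocalIsometryAt G F x) (u v : E) :
    fderiv ℝ (fderiv ℝ F) x u v =
      fderiv ℝ F x (Γ x u v) - Γ (F x) (fderiv ℝ F x u) (fderiv ℝ F x v) := by
  rw [eq_sub_iff_add_eq, ← sub_eq_zero]
  refine hG.nondegenerate (F x) _ fun w' ↦ ?_
  obtain ⟨w, rfl⟩ := hG.surjective_fderiv h w'
  have s := fderiv_fderiv_symm h.contDiffAt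
  -- In the Koszul combination `h1 + h2 - h3` the symmetry of the second derivative cancels every
  -- second order term except twice the product of `D²F (u, v)` with `DF w`.
  have h1 := h.fderiv_form_eq hG.contDiff_form u v w
  have h2 := h.fderiv_form_eq hG.contDiff_form v u w
  have h3 := h.fderiv_form_eq hG.contDiff_form w u v
  have k1 := hG.koszul x u v w
  have k2 := hG.koszul (F x) (fderiv ℝ F x u) (fderiv ℝ F x v) (fderiv ℝ F x w)
  rw [s v u] at h2
  rw [s w u, s w v, hG.symm (F x) (fderiv ℝ (fderiv ℝ F) x u w)] at h3
  rw [← h.form_eq] at k1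
  simp only [map_add, map_sub, add_apply, sub_apply]
  linarith

/-- Isometries preserve the curvature tensor. -/
theorem IsLeviCivita.map_curvature [FiniteDimensional ℝ E] (hG : IsLeviCivita G Γ)
    (h : IsLocalIsometryAt G F x) (u v w : E) :
    fderiv ℝ F x (curvature Γ x v w u) =
      curvature Γ (F x) (fderiv ℝ F x v) (fderiv ℝ F x w) (fderiv ℝ F x u) := by
  have hF := (h.contDiffAt.differentiableAt (by simp)).hasFDerivAt
  have hF2 := hasFDerivAt_fderiv h.contDiffAt
  have hF3 := hasFDerivAt_fderiv (F := fderiv ℝ F) (h.contDiffAt.fderiv_right (m := ∞) (by simp))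
  have hΓ : ∀ y, HasFDerivAt Γ (fderiv ℝ Γ y) y :=
    fun y ↦ (hG.contDiff_christoffel.differentiable (by simp) y).hasFDerivAt
  -- The Christoffel rule, differentiated once more, expresses the third derivative of `F`. Its
  -- symmetry in `u` and `v`, after second derivatives are eliminated by the same rule, is the
  -- invariance of the curvature.
  have key : ∀ u v : E, fderiv ℝ (fderiv ℝ (fderiv ℝ F)) x u v w =
      fderiv ℝ (fderiv ℝ F) x u (Γ x v w) + fderiv ℝ F x (fderiv ℝ Γ x u v w) -
      (fderiv ℝ Γ (F x) (fderiv ℝ F x u) (fderiv ℝ F x v) (fderiv ℝ F x w) +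
        Γ (F x) (fderiv ℝ (fderiv ℝ F) x u v) (fderiv ℝ F x w) +
        Γ (F x) (fderiv ℝ F x v) (fderiv ℝ (fderiv ℝ F) x u w)) := by
    intro u v
    have h0 : HasFDerivAt (fun z ↦ Γ (F z)) ((fderiv ℝ Γ (F x)).comp (fderiv ℝ F x)) x :=
      HasFDerivAt.comp (G := E →L[ℝ] E →L[ℝ] E) x (hΓ (F x)) hF
    have h1 := (hF3.clm_apply (hasFDerivAt_const v x)).clm_apply (hasFDerivAt_const w x)
    have k1 := ((hΓ x).clm_apply (hasFDerivAt_const v x)).clm_apply (hasFDerivAt_const w x)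
    have k2 := (h0.clm_apply (hF2.clm_apply (hasFDerivAt_const v x))).clm_apply
      (hF2.clm_apply (hasFDerivAt_const w x))
    have h2 := (hF2.clm_apply k1).sub k2
    have h3 : (fun z ↦ fderiv ℝ (fderiv ℝ F) z v w) =ᶠ[𝓝 x] _ :=
      h.eventually.mono fun z hz ↦ hG.fderiv_fderiv hz v w
    have h4 := congrArg (fun L : E →L[ℝ] E ↦ L u) ((h2.congr_of_eventuallyEq h3).unique h1)
    simp at h4
    rw [← h4]
    abel
  have s := fderiv_fderiv_symm (F := fderiv ℝ F) (h.contDiffAt.fderiv_right (m := ∞) (by simp)) u v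
  have s' := congrArg (fun L : E →L[ℝ] E ↦ L w) s
  simp only [key] at s'
  have d := hG.fderiv_fderiv h
  simp only [d, map_sub, sub_apply] at s'
  have hs2 : fderiv ℝ F x (Γ x u v) - Γ (F x) (fderiv ℝ F x u) (fderiv ℝ F x v) =
      fderiv ℝ F x (Γ x v u) - Γ (F x) (fderiv ℝ F x v) (fderiv ℝ F x u) := by
    rw [← d, ← d, fderiv_fderiv_symm h.contDiffAt]
  have hs3 := congrArg (fun y ↦ Γ (F x) y (fderiv ℝ F x w)) hs2
  simp only [map_sub, sub_apply] at hs3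
  simp only [curvature_apply, map_sub, map_add]
  rw [← sub_eq_zero] at s' ⊢
  rw [← sub_eq_zero] at hs3
  rw [← s', ← sub_zero (_ - _ : E), ← hs3]
  abel

/-- Isometries preserve the Ricci tensor. -/
theorem IsLeviCivita.ricci_eq [FiniteDimensional ℝ E] (hG : IsLeviCivita G Γ)
    (h : IsLocalIsometryAt G F x) (v w : E) :
    ricci Γ (F x) (fderiv ℝ F x v) (fderiv ℝ F x w) = ricci Γ x v w := by
  set e : E ≃ₗ[ℝ] E := LinearEquiv.ofBijective (fderiv ℝ F x : E →ₗ[ℝ] E)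
    ⟨hG.injective_fderiv h, hG.surjective_fderiv h⟩ with he
  have : (curvature Γ (F x) (fderiv ℝ F x v) (fderiv ℝ F x w) : E →ₗ[ℝ] E) =
      e.conj (curvature Γ x v w : E →ₗ[ℝ] E) := by
    ext y
    obtain ⟨u, rfl⟩ := e.surjective y
    rw [LinearEquiv.conj_apply_apply, e.symm_apply_apply]
    exact (hG.map_curvature h u v w).symm
  rw [ricci, ricci, this, LinearMap.trace_conj']

end Curvature

/-! ### Coordinate calculus and periodic profiles -/

section Coordinates

/-- The bilinear form `(v, w) ↦ v i * w j`. -/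
noncomputable def coordForm (i j : Fin 3) :
    EuclideanSpace ℝ (Fin 3) →L[ℝ] EuclideanSpace ℝ (Fin 3) →L[ℝ] ℝ :=
  (EuclideanSpace.proj i : EuclideanSpace ℝ (Fin 3) →L[ℝ] ℝ).smulRight
    (EuclideanSpace.proj j : EuclideanSpace ℝ (Fin 3) →L[ℝ] ℝ)

theorem coordForm_apply (i j : Fin 3) (v w : EuclideanSpace ℝ (Fin 3)) :
    coordForm i j v w = v i * w j := by
  simp [coordForm]

/-- The bilinear map `(v, w) ↦ v i * w j` with values in the `k`-th coordinate axis. -/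
noncomputable def coordMap (i j k : Fin 3) :
    EuclideanSpace ℝ (Fin 3) →L[ℝ] EuclideanSpace ℝ (Fin 3) →L[ℝ] EuclideanSpace ℝ (Fin 3) :=
  (EuclideanSpace.proj i : EuclideanSpace ℝ (Fin 3) →L[ℝ] ℝ).smulRight
    ((EuclideanSpace.proj j : EuclideanSpace ℝ (Fin 3) →L[ℝ] ℝ).smulRight
      (EuclideanSpace.single k (1 : ℝ)))

theorem coordMap_apply (i j k l : Fin 3) (v w : EuclideanSpace ℝ (Fin 3)) :
    coordMap i j k v w l = if l = k then v i * w j else 0 := by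
  simp [coordMap]

theorem euclidean_ext {v w : EuclideanSpace ℝ (Fin 3)} (h0 : v 0 = w 0) (h1 : v 1 = w 1)
    (h2 : v 2 = w 2) : v = w := by
  ext i; fin_cases i <;> assumption

theorem trace_euclidean (L : EuclideanSpace ℝ (Fin 3) →L[ℝ] EuclideanSpace ℝ (Fin 3)) :
    LinearMap.trace ℝ _ (L : EuclideanSpace ℝ (Fin 3) →ₗ[ℝ] EuclideanSpace ℝ (Fin 3)) =
      L (EuclideanSpace.single 0 1) 0 + L (EuclideanSpace.single 1 1) 1 +
        L (EuclideanSpace.single 2 1) 2 := by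
  rw [LinearMap.trace_eq_matrix_trace ℝ (EuclideanSpace.basisFun (Fin 3) ℝ).toBasis,
    Matrix.trace, Fin.sum_univ_three]
  simp [Matrix.diag, LinearMap.toMatrix_apply]

theorem hasFDerivAt_coord_smul {V : Type*} [NormedAddCommGroup V] [NormedSpace ℝ V] {φ : ℝ → ℝ}
    {φ' : ℝ} {x : EuclideanSpace ℝ (Fin 3)} (h : HasDerivAt φ φ' (x 2)) (T : V) :
    HasFDerivAt (fun y : EuclideanSpace ℝ (Fin 3) ↦ φ (y 2) • T)
      ((φ' • (EuclideanSpace.proj 2 : EuclideanSpace ℝ (Fin 3) →L[ℝ] ℝ)).smulRight T) x := by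
  have h1 : HasFDerivAt (fun y : EuclideanSpace ℝ (Fin 3) ↦ y 2)
    (EuclideanSpace.proj 2 : EuclideanSpace ℝ (Fin 3) →L[ℝ] ℝ) x :=
    (EuclideanSpace.proj 2 : EuclideanSpace ℝ (Fin 3) →L[ℝ] ℝ).hasFDerivAt
  have h2 := h.comp_hasFDerivAt x h1
  exact h2.smul_const T

theorem contDiff_coord_smul {V : Type*} [NormedAddCommGroup V] [NormedSpace ℝ V] {φ : ℝ → ℝ}
    (h : ContDiff ℝ ∞ φ) (T : V) :
    ContDiff ℝ ∞ (fun y : EuclideanSpace ℝ (Fin 3) ↦ φ (y 2) • T) :=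
  (h.comp (EuclideanSpace.proj 2 : EuclideanSpace ℝ (Fin 3) →L[ℝ] ℝ).contDiff).smul contDiff_const

end Coordinates

namespace PeriodicProfile

variable (a : PeriodicProfile)

theorem contDiff : ContDiff ℝ ∞ a.1 := a.2.1

theorem pos (t : ℝ) : 0 < a.1 t := a.2.2.2 t

theorem periodic : Function.Periodic a.1 1 := a.2.2.1

theorem contDiff_deriv : ContDiff ℝ ∞ (deriv a.1) := (contDiff_infty_iff_deriv.1 a.contDiff).2

theorem hasDerivAt (t : ℝ) : HasDerivAt a.1 (deriv a.1 t) t :=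
  (a.contDiff.differentiable (by simp) t).hasDerivAt

theorem hasDerivAt_deriv (t : ℝ) : HasDerivAt (deriv a.1) (deriv (deriv a.1) t) t :=
  (a.contDiff_deriv.differentiable (by simp) t).hasDerivAt

/-- Half of the logarithmic derivative. -/
noncomputable def halfLogDeriv (t : ℝ) : ℝ := deriv a.1 t / (2 * a.1 t)

theorem contDiff_halfLogDeriv : ContDiff ℝ ∞ a.halfLogDeriv :=
  a.contDiff_deriv.div (contDiff_const.mul a.contDiff)
    fun t ↦ mul_ne_zero two_ne_zero (a.pos t).ne'

theorem hasDerivAt_halfLogDeriv (t : ℝ) : HasDerivAt a.halfLogDeriv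
    ((deriv (deriv a.1) t * a.1 t - deriv a.1 t ^ 2) / (2 * a.1 t ^ 2)) t := by
  have h := (a.hasDerivAt_deriv t).div ((a.hasDerivAt t).const_mul 2)
    (mul_ne_zero two_ne_zero (a.pos t).ne')
  convert! h using 1
  have := (a.pos t).ne'
  field_simp

theorem hasDerivAt_neg_half_deriv (t : ℝ) :
    HasDerivAt (fun s ↦ -(deriv a.1 s / 2)) (-(deriv (deriv a.1) t / 2)) t :=
  ((a.hasDerivAt_deriv t).div_const 2).neg

end PeriodicProfile

/-! ### Curvature of `dt² + 2 a(t) du dv` -/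

section Hyperbolic

variable (a : PeriodicProfile)

/-- The metric `dt² + 2 a(t) du dv` as a field of continuous bilinear forms. -/
noncomputable def hyperbolicField (x : EuclideanSpace ℝ (Fin 3)) :
    EuclideanSpace ℝ (Fin 3) →L[ℝ] EuclideanSpace ℝ (Fin 3) →L[ℝ] ℝ :=
  coordForm 2 2 + a.1 (x 2) • (coordForm 0 1 + coordForm 1 0)

theorem hyperbolicField_apply (x v w : EuclideanSpace ℝ (Fin 3)) :
    hyperbolicField a x v w = hyperbolicForm a x v w := by
  change coordForm 2 2 v w + a.1 (x 2) * (coordForm 0 1 v w + coordForm 1 0 v w) = _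
  simp only [hyperbolicForm, coordForm_apply]

/-- The Levi-Civita connection of the metric `dt² + 2 a(t) du dv`. -/
noncomputable def hyperbolicConnection (x : EuclideanSpace ℝ (Fin 3)) :
    EuclideanSpace ℝ (Fin 3) →L[ℝ] EuclideanSpace ℝ (Fin 3) →L[ℝ] EuclideanSpace ℝ (Fin 3) :=
  a.halfLogDeriv (x 2) • (coordMap 0 2 0 + coordMap 2 0 0 + coordMap 1 2 1 + coordMap 2 1 1) +
    (-(deriv a.1 (x 2) / 2)) • (coordMap 0 1 2 + coordMap 1 0 2)

theorem hyperbolicConnection_apply (x v w : EuclideanSpace ℝ (Fin 3)) :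
    hyperbolicConnection a x v w = !₂[a.halfLogDeriv (x 2) * (v 0 * w 2 + v 2 * w 0),
      a.halfLogDeriv (x 2) * (v 1 * w 2 + v 2 * w 1),
      -(deriv a.1 (x 2) / 2) * (v 0 * w 1 + v 1 * w 0)] := by
  have h : ∀ l, hyperbolicConnection a x v w l =
      a.halfLogDeriv (x 2) * (coordMap 0 2 0 v w l + coordMap 2 0 0 v w l + coordMap 1 2 1 v w l +
        coordMap 2 1 1 v w l) +
      (-(deriv a.1 (x 2) / 2)) * (coordMap 0 1 2 v w l + coordMap 1 0 2 v w l) := fun l ↦ rfl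
  apply euclidean_ext <;> simp [h, coordMap_apply]

theorem fderiv_hyperbolicField (x u v w : EuclideanSpace ℝ (Fin 3)) :
    fderiv ℝ (hyperbolicField a) x u v w =
      u 2 * deriv a.1 (x 2) * (v 0 * w 1 + v 1 * w 0) := by
  have h := (hasFDerivAt_coord_smul (a.hasDerivAt (x 2)) (coordForm 0 1 + coordForm 1 0)).const_add
    (coordForm 2 2)
  rw [show hyperbolicField a = fun y ↦ coordForm 2 2 + a.1 (y 2) • (coordForm 0 1 + coordForm 1 0)
    from rfl, h.fderiv]
  change deriv a.1 (x 2) * u 2 * (coordForm 0 1 v w + coordForm 1 0 v w) = _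
  simp only [coordForm_apply]
  ring

theorem fderiv_hyperbolicConnection (x u v w : EuclideanSpace ℝ (Fin 3)) :
    fderiv ℝ (hyperbolicConnection a) x u v w = u 2 • !₂[
      ((deriv (deriv a.1) (x 2) * a.1 (x 2) - deriv a.1 (x 2) ^ 2) / (2 * a.1 (x 2) ^ 2)) *
        (v 0 * w 2 + v 2 * w 0),
      ((deriv (deriv a.1) (x 2) * a.1 (x 2) - deriv a.1 (x 2) ^ 2) / (2 * a.1 (x 2) ^ 2)) *
        (v 1 * w 2 + v 2 * w 1),
      -(deriv (deriv a.1) (x 2) / 2) * (v 0 * w 1 + v 1 * w 0)] := by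
  have h := (hasFDerivAt_coord_smul (a.hasDerivAt_halfLogDeriv (x 2))
    (coordMap 0 2 0 + coordMap 2 0 0 + coordMap 1 2 1 + coordMap 2 1 1)).add
    (hasFDerivAt_coord_smul (a.hasDerivAt_neg_half_deriv (x 2)) (coordMap 0 1 2 + coordMap 1 0 2))
  have h' : HasFDerivAt (hyperbolicConnection a) _ x := h
  rw [h'.fderiv]
  refine Eq.trans (b := u 2 • (((deriv (deriv a.1) (x 2) * a.1 (x 2) - deriv a.1 (x 2) ^ 2) /
    (2 * a.1 (x 2) ^ 2)) • (coordMap 0 2 0 v w + coordMap 2 0 0 v w + coordMap 1 2 1 v w +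
    coordMap 2 1 1 v w) + (-(deriv (deriv a.1) (x 2) / 2)) • (coordMap 0 1 2 v w +
    coordMap 1 0 2 v w))) ?_ ?_
  · rw [smul_add, smul_smul, smul_smul, mul_comm (u 2), mul_comm (u 2)]; rfl
  · apply euclidean_ext <;> simp [coordMap_apply] <;> ring

theorem isLeviCivita_hyperbolic : IsLeviCivita (hyperbolicField a) (hyperbolicConnection a) where
  contDiff_form := contDiff_const.add (contDiff_coord_smul a.contDiff _)
  contDiff_christoffel := (contDiff_coord_smul a.contDiff_halfLogDeriv _).add
    (contDiff_coord_smul (φ := fun s ↦ -(deriv a.1 s / 2)) (a.contDiff_deriv.div_const 2).neg _)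
  symm x v w := by simp only [hyperbolicField_apply, hyperbolicForm]; ring
  nondegenerate x v h := by
    simp only [hyperbolicField_apply, hyperbolicForm] at h
    have h0 := h (EuclideanSpace.single 0 1)
    have h1 := h (EuclideanSpace.single 1 1)
    have h2 := h (EuclideanSpace.single 2 1)
    simp [(a.pos (x 2)).ne'] at h0 h1 h2
    exact euclidean_ext h1 h0 h2
  koszul x u v w := by
    have := (a.pos (x 2)).ne'
    rw [fderiv_hyperbolicField, fderiv_hyperbolicField, fderiv_hyperbolicField,
      hyperbolicField_apply, hyperbolicForm, hyperbolicConnection_apply]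
    simp [PeriodicProfile.halfLogDeriv]
    field_simp
    ring

/-- Apart from a multiple of `dt²` the Ricci tensor is a multiple of the metric, and that multiple
is what `hyperbolic_invariant` extracts. -/
theorem ricci_hyperbolic (x v w : EuclideanSpace ℝ (Fin 3)) :
    ricci (hyperbolicConnection a) x v w =
      -(deriv (deriv a.1) (x 2) / (2 * a.1 (x 2))) * hyperbolicField a x v w +
      (deriv a.1 (x 2) ^ 2 / (2 * a.1 (x 2) ^ 2) - deriv (deriv a.1) (x 2) / (2 * a.1 (x 2))) *
        (v 2 * w 2) := by
  have := (a.pos (x 2)).ne'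
  rw [ricci, trace_euclidean]
  simp only [curvature_apply, fderiv_hyperbolicConnection, hyperbolicConnection_apply]
  simp [hyperbolicField_apply, hyperbolicForm, PeriodicProfile.halfLogDeriv]
  field_simp
  ring

/-- The ratio `a'' / a` is an invariant of the metric `dt² + 2 a(t) du dv`. -/
theorem hyperbolic_invariant {F : EuclideanSpace ℝ (Fin 3) → EuclideanSpace ℝ (Fin 3)}
    {x : EuclideanSpace ℝ (Fin 3)} (h : IsLocalIsometryAt (hyperbolicField a) F x) :
    deriv (deriv a.1) (F x 2) / a.1 (F x 2) = deriv (deriv a.1) (x 2) / a.1 (x 2) := by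
  have hG := isLeviCivita_hyperbolic a
  -- The plane `dt = 0` and the preimage of `dt = 0` under the derivative share a line. For `v` on
  -- it the `dt²` terms drop out on both sides, and the two multiples of the metric can be compared
  -- by nondegeneracy.
  obtain ⟨v, hv0, hv2, hF2⟩ : ∃ v : EuclideanSpace ℝ (Fin 3), v ≠ 0 ∧ v 2 = 0 ∧
      fderiv ℝ F x v 2 = 0 := by
    set e0 : EuclideanSpace ℝ (Fin 3) := EuclideanSpace.single 0 1 with he0
    set e1 : EuclideanSpace ℝ (Fin 3) := EuclideanSpace.single 1 1 with he1
    by_cases hc : fderiv ℝ F x e0 2 = 0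
    · exact ⟨e0, by simp [he0], by simp [he0], hc⟩
    · refine ⟨fderiv ℝ F x e1 2 • e0 - fderiv ℝ F x e0 2 • e1, fun h0 ↦ hc ?_, ?_, ?_⟩
      · simpa [he0, he1] using congrArg (fun v : EuclideanSpace ℝ (Fin 3) ↦ v 1) h0
      · simp [he0, he1]
      · simp only [map_sub, map_smul, PiLp.sub_apply, PiLp.smul_apply, smul_eq_mul]; ring
  by_contra hne
  refine hv0 (hG.nondegenerate x v fun w ↦ ?_)
  have h1 := hG.ricci_eq h v w
  rw [ricci_hyperbolic, ricci_hyperbolic, hF2, hv2, h.form_eq] at h1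
  have h2 : (deriv (deriv a.1) (F x 2) / a.1 (F x 2) - deriv (deriv a.1) (x 2) / a.1 (x 2)) *
      hyperbolicField a x v w = 0 := by
    have e1 : ∀ s, deriv (deriv a.1) s / (2 * a.1 s) = deriv (deriv a.1) s / a.1 s / 2 :=
      fun s ↦ by rw [div_div, mul_comm]
    rw [e1, e1] at h1
    linarith
  exact (mul_eq_zero.1 h2).resolve_left (sub_ne_zero.2 hne)

end Hyperbolic

/-! ### Isometries of `dt² + 2 a(t) du dv` are affine -/

section Rigidity

/-- A twice differentiable map with vanishing second derivative is affine. -/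
theorem eq_affine_of_fderiv_fderiv_eq_zero {E : Type*} [NormedAddCommGroup E] [NormedSpace ℝ E]
    {F : E → E} (hF : ContDiff ℝ ∞ F) (h : ∀ x, fderiv ℝ (fderiv ℝ F) x = 0) (x : E) :
    F x = fderiv ℝ F 0 x + F 0 := by
  have h1 : ∀ y, fderiv ℝ F y = fderiv ℝ F 0 := fun y ↦
    is_const_of_fderiv_eq_zero ((hF.fderiv_right (m := ∞) (by simp)).differentiable (by simp)) h y 0
  have h2 : Differentiable ℝ (fun y ↦ F y - fderiv ℝ F 0 y) :=
    (hF.differentiable (by simp)).sub (fderiv ℝ F 0).differentiable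
  have h3 := is_const_of_fderiv_eq_zero h2 (fun y ↦ by
    rw [fderiv_fun_sub (hF.differentiable (by simp) y) (fderiv ℝ F 0).differentiableAt,
      (fderiv ℝ F 0).fderiv, h1 y, sub_self]) x 0
  simp only [map_zero, sub_zero] at h3
  rw [← h3]; abel

theorem dense_coord_preimage {S : Set ℝ} (hS : Dense S) :
    Dense {x : EuclideanSpace ℝ (Fin 3) | x 2 ∈ S} := by
  refine hS.preimage (f := (EuclideanSpace.proj 2 : EuclideanSpace ℝ (Fin 3) →L[ℝ] ℝ)) ?_
  refine ContinuousLinearMap.isOpenMap _ fun t ↦ ⟨EuclideanSpace.single 2 t, by simp⟩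

/-- Genericity controls the derivative of an isometry only over a dense set of values of the last
coordinate. This lemma extends closed conditions from there to all points. -/
theorem mem_of_dense_coord {S : Set ℝ} (hS : Dense S) {C : Set (EuclideanSpace ℝ (Fin 3))}
    (hC : IsClosed C) (h : ∀ x : EuclideanSpace ℝ (Fin 3), x 2 ∈ S → x ∈ C)
    (x : EuclideanSpace ℝ (Fin 3)) : x ∈ C := by
  have h' := hC.closure_subset_iff.2 (fun x hx ↦ h x hx :
    {x : EuclideanSpace ℝ (Fin 3) | x 2 ∈ S} ⊆ C)
  rw [(dense_coord_preimage hS).closure_eq] at h'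
  exact h' (Set.mem_univ x)

theorem fderiv_coord_profile {σ : ℝ → ℝ} (hσ : ContDiff ℝ ∞ σ)
    {F : EuclideanSpace ℝ (Fin 3) → EuclideanSpace ℝ (Fin 3)}
    {x : EuclideanSpace ℝ (Fin 3)} (hF : DifferentiableAt ℝ F x)
    (v : EuclideanSpace ℝ (Fin 3)) :
    fderiv ℝ (fun y ↦ σ (F y 2)) x v = deriv σ (F x 2) * fderiv ℝ F x v 2 := by
  have h := (EuclideanSpace.proj 2 : EuclideanSpace ℝ (Fin 3) →L[ℝ] ℝ).hasFDerivAt.comp x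
    hF.hasFDerivAt
  have h2 := (hσ.differentiable (by simp) (F x 2)).hasDerivAt.comp_hasFDerivAt x h
  have h' : HasFDerivAt (fun y ↦ σ (F y 2)) _ x := h2
  rw [h'.fderiv]; simp

/-- A positive periodic function attains its maximum. -/
theorem PeriodicProfile.exists_max (a : PeriodicProfile) : ∃ t₀, ∀ t, a.1 t ≤ a.1 t₀ := by
  obtain ⟨t₀, -, h⟩ := isCompact_Icc.exists_isMaxOn (Set.nonempty_Icc.2 zero_le_one)
    a.contDiff.continuous.continuousOn (s := Set.Icc (0 : ℝ) 1)
  refine ⟨t₀, fun t ↦ ?_⟩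
  obtain ⟨s, hs, hst⟩ := a.periodic.exists_mem_Ico₀ zero_lt_one t
  rw [hst]
  exact h ⟨hs.1, hs.2.le⟩

/-- The map `t ↦ ε t + c` is a bijection of the line, so both sides have the same maximum up to the
factor `ρ`, and that maximum is positive. -/
theorem PeriodicProfile.homothety_ratio (a : PeriodicProfile) {ε c ρ : ℝ} (hε : ε ≠ 0)
    (h : ∀ t, a.1 (ε * t + c) = ρ * a.1 t) : ρ = 1 := by
  obtain ⟨t₀, ht⟩ := a.exists_max
  have h0 := a.pos t₀
  have h1 := h ((t₀ - c) / ε)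
  rw [mul_div_cancel₀ _ hε, sub_add_cancel] at h1
  have h2 := h t₀
  have hρ : 0 < ρ := by
    have := a.pos ((t₀ - c) / ε)
    by_contra hn
    nlinarith
  refine le_antisymm ?_ ?_
  · have := ht (ε * t₀ + c)
    rw [h2] at this
    nlinarith
  · have := ht ((t₀ - c) / ε)
    nlinarith

/-- The genericity condition for `dt² + 2 a(t) du dv`: the ratio `a'' / a` is not constant on any
interval. -/
def PeriodicProfile.HyperbolicGeneric (a : PeriodicProfile) : Prop :=
  ∀ r s : ℝ, r < s → ∃ t ∈ Set.Ioo r s, ∃ t' ∈ Set.Ioo r s,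
    deriv (deriv a.1) t * a.1 t' ≠ deriv (deriv a.1) t' * a.1 t

variable {a : PeriodicProfile}

theorem PeriodicProfile.contDiff_ratio (a : PeriodicProfile) :
    ContDiff ℝ ∞ (fun t ↦ deriv (deriv a.1) t / a.1 t) :=
  (contDiff_infty_iff_deriv.1 a.contDiff_deriv).2.div a.contDiff fun t ↦ (a.pos t).ne'

/-- An interval on which the derivative of `a'' / a` vanished would be one on which the ratio is
constant. -/
theorem PeriodicProfile.HyperbolicGeneric.dense_deriv (h : a.HyperbolicGeneric) :
    Dense {t | deriv (fun t ↦ deriv (deriv a.1) t / a.1 t) t ≠ 0} := by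
  refine dense_iff_inter_open.2 fun U hU ⟨x, hx⟩ ↦ ?_
  obtain ⟨l, r, hlr, hsub⟩ := mem_nhds_iff_exists_Ioo_subset.1 (hU.mem_nhds hx)
  have hlr' : l < r := hlr.1.trans hlr.2
  by_contra hne
  have hz : ∀ t ∈ Set.Ioo l r, deriv (fun t ↦ deriv (deriv a.1) t / a.1 t) t = 0 := by
    intro t ht
    by_contra h0
    exact hne ⟨t, hsub ht, h0⟩
  obtain ⟨t, ht, t', ht', htt⟩ := h l r hlr'
  refine htt ?_
  have := (convex_Ioo l r).is_const_of_fderivWithin_eq_zero (𝕜 := ℝ)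
    (f := fun t ↦ deriv (deriv a.1) t / a.1 t)
    (a.contDiff_ratio.differentiable (by simp)).differentiableOn (fun y hy ↦ by
      rw [fderivWithin_of_isOpen isOpen_Ioo hy]
      ext
      simpa using hz y hy) ht ht'
  exact (div_eq_div_iff (a.pos t).ne' (a.pos t').ne').1 this

/-- The derivative of an isometry of a generic metric `dt² + 2 a(t) du dv` preserves the
direction `∂ / ∂t` and its orthogonal. -/
theorem hyperbolic_fderiv_of_deriv_ne_zero {F : EuclideanSpace ℝ (Fin 3) → EuclideanSpace ℝ (Fin 3)}
    (hF : ∀ x, IsLocalIsometryAt (hyperbolicField a) F x) {x : EuclideanSpace ℝ (Fin 3)}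
    (hx : deriv (fun t ↦ deriv (deriv a.1) t / a.1 t) (x 2) ≠ 0) :
    ∃ κ : ℝ, κ ^ 2 = 1 ∧ (∀ v, fderiv ℝ F x v 2 = κ * v 2) ∧
      fderiv ℝ F x (EuclideanSpace.single 2 1) = κ • EuclideanSpace.single 2 1 := by
  have hG := isLeviCivita_hyperbolic a
  have hd : DifferentiableAt ℝ F x := (hF x).contDiffAt.differentiableAt (by simp)
  set σ := fun t ↦ deriv (deriv a.1) t / a.1 t with hσ
  have hsm := a.contDiff_ratio
  -- Differentiating the invariance of `σ = a'' / a` shows that the derivative of `F` preserves `dt`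
  -- up to a factor.
  have h1 : ∀ v, deriv σ (F x 2) * fderiv ℝ F x v 2 = deriv σ (x 2) * v 2 := by
    intro v
    have e : (fun y ↦ σ (F y 2)) = fun y ↦ σ (y 2) := funext fun y ↦ hyperbolic_invariant a (hF y)
    have e1 := fderiv_coord_profile hsm hd v
    rw [e] at e1
    rw [← e1]
    have e2 := fderiv_coord_profile (F := id) hsm differentiableAt_id (x := x) v
    simpa using e2
  have hne : deriv σ (F x 2) ≠ 0 := by
    intro h0
    have := h1 (EuclideanSpace.single 2 1)
    rw [h0, zero_mul] at this
    simp at this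
    exact hx this.symm
  set κ := deriv σ (x 2) / deriv σ (F x 2) with hκ
  have h2 : ∀ v, fderiv ℝ F x v 2 = κ * v 2 := by
    intro v
    rw [hκ, div_mul_eq_mul_div, eq_div_iff hne, mul_comm, h1]
  -- The vector `u` sent to `∂t` has product `κ * w 2` with every `w`, so it is `κ ∂t`. Reading the
  -- last coordinate of its image gives `κ² = 1`.
  obtain ⟨u, hu⟩ := hG.surjective_fderiv (hF x) (EuclideanSpace.single 2 1)
  have h3 : u = κ • EuclideanSpace.single 2 1 := by
    rw [← sub_eq_zero]
    refine hG.nondegenerate x _ fun w ↦ ?_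
    have e1 := (hF x).form_eq u w
    rw [hu, hyperbolicField_apply, hyperbolicForm] at e1
    simp [h2] at e1
    rw [map_sub, sub_apply, ← e1, hyperbolicField_apply, hyperbolicForm]
    simp
  have h4 : κ ^ 2 = 1 := by
    have e1 := h2 u
    rw [hu, h3] at e1
    simp at e1
    rw [e1]; ring
  refine ⟨κ, h4, h2, ?_⟩
  have h5 : fderiv ℝ F x (κ • EuclideanSpace.single 2 1) = EuclideanSpace.single 2 1 := h3 ▸ hu
  rw [map_smul] at h5
  calc fderiv ℝ F x (EuclideanSpace.single 2 1)
      = (κ ^ 2) • fderiv ℝ F x (EuclideanSpace.single 2 1) := by rw [h4, one_smul]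
    _ = κ • EuclideanSpace.single 2 1 := by rw [sq, mul_smul, h5]

/-- The pointwise result extends from a dense set by continuity, with `κ` read off as the `∂t`
component of the image of `∂t`. A differentiable `κ` with `κ² = 1` has zero derivative, so one sign
serves at all points. -/
theorem hyperbolic_fderiv {F : EuclideanSpace ℝ (Fin 3) → EuclideanSpace ℝ (Fin 3)}
    (ha : a.HyperbolicGeneric) (hF : ∀ x, IsLocalIsometryAt (hyperbolicField a) F x) :
    ∃ ε : ℝ, ε ^ 2 = 1 ∧ (∀ x v, fderiv ℝ F x v 2 = ε * v 2) ∧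
      ∀ x, fderiv ℝ F x (EuclideanSpace.single 2 1) = ε • EuclideanSpace.single 2 1 := by
  have hsm : ContDiff ℝ ∞ F := contDiff_iff_contDiffAt.2 fun x ↦ (hF x).contDiffAt
  have hc : Continuous (fderiv ℝ F) := hsm.continuous_fderiv (by simp)
  have hcv : ∀ (v : EuclideanSpace ℝ (Fin 3)) (i : Fin 3), Continuous fun x ↦ fderiv ℝ F x v i :=
    fun v i ↦ (EuclideanSpace.proj i : EuclideanSpace ℝ (Fin 3) →L[ℝ] ℝ).continuous.comp
      (hc.clm_apply continuous_const)
  set κ : EuclideanSpace ℝ (Fin 3) → ℝ := fun x ↦ fderiv ℝ F x (EuclideanSpace.single 2 1) 2 with hκ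
  have hκc : Continuous κ := hcv _ _
  have hκx : ∀ {x : EuclideanSpace ℝ (Fin 3)} {k : ℝ},
      (∀ v, fderiv ℝ F x v 2 = k * v 2) → κ x = k := fun h ↦ by
    rw [hκ]; simp [h]
  have h1 : ∀ x, κ x ^ 2 = 1 := by
    have : IsClosed {x | κ x ^ 2 = 1} := isClosed_eq (hκc.pow 2) continuous_const
    refine mem_of_dense_coord ha.dense_deriv this fun x hx ↦ ?_
    obtain ⟨k, hk, hk2, -⟩ := hyperbolic_fderiv_of_deriv_ne_zero hF hx
    change κ x ^ 2 = 1
    rw [hκx hk2, hk]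
  have h2 : ∀ x v, fderiv ℝ F x v 2 = κ x * v 2 := by
    intro x v
    have : IsClosed {x | fderiv ℝ F x v 2 = κ x * v 2} :=
      isClosed_eq (hcv _ _) (hκc.mul continuous_const)
    refine mem_of_dense_coord ha.dense_deriv this (fun x hx ↦ ?_) x
    obtain ⟨k, hk, hk2, -⟩ := hyperbolic_fderiv_of_deriv_ne_zero hF hx
    change fderiv ℝ F x v 2 = κ x * v 2
    rw [hκx hk2, hk2]
  have h3 : ∀ x, fderiv ℝ F x (EuclideanSpace.single 2 1) = κ x • EuclideanSpace.single 2 1 := by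
    intro x
    have : IsClosed {x | fderiv ℝ F x (EuclideanSpace.single 2 1) =
        κ x • EuclideanSpace.single 2 1} :=
      isClosed_eq (hc.clm_apply continuous_const) (hκc.smul continuous_const)
    refine mem_of_dense_coord ha.dense_deriv this (fun x hx ↦ ?_) x
    obtain ⟨k, hk, hk2, hk3⟩ := hyperbolic_fderiv_of_deriv_ne_zero hF hx
    change fderiv ℝ F x (EuclideanSpace.single 2 1) = κ x • EuclideanSpace.single 2 1
    rw [hκx hk2, hk3]
  have h4 : ∀ x, κ x = κ 0 := by
    intro x
    have hd : Differentiable ℝ κ := by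
      have e : ContDiff ℝ ∞ κ := (EuclideanSpace.proj 2 :
        EuclideanSpace ℝ (Fin 3) →L[ℝ] ℝ).contDiff.comp
        ((hsm.fderiv_right (m := ∞) (by simp)).clm_apply contDiff_const)
      exact e.differentiable (by simp)
    refine is_const_of_fderiv_eq_zero hd (fun y ↦ ?_) x 0
    have e := ((hd y).hasFDerivAt.pow 2)
    have e2 : HasFDerivAt (fun y ↦ κ y ^ 2) (0 : EuclideanSpace ℝ (Fin 3) →L[ℝ] ℝ) y := by
      rw [show (fun y ↦ κ y ^ 2) = fun _ ↦ 1 from funext h1]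
      exact hasFDerivAt_const _ _
    have e3 := e.unique e2
    ext v
    have e4 := congrArg (fun L : EuclideanSpace ℝ (Fin 3) →L[ℝ] ℝ ↦ L v) e3
    have hne : κ y ≠ 0 := fun h0 ↦ by have := h1 y; rw [h0] at this; norm_num at this
    simpa [hne] using e4
  refine ⟨κ 0, h1 0, fun x v ↦ ?_, fun x ↦ ?_⟩
  · rw [h2, h4]
  · rw [h3, h4]

/-- Isometries of a generic metric `dt² + 2 a(t) du dv` are affine. -/
theorem hyperbolic_rigidity {F : EuclideanSpace ℝ (Fin 3) → EuclideanSpace ℝ (Fin 3)}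
    (ha : a.HyperbolicGeneric) (hF : ∀ x, IsLocalIsometryAt (hyperbolicField a) F x) :
    ∃ (ε : ℝ) (L : EuclideanSpace ℝ (Fin 3) →L[ℝ] EuclideanSpace ℝ (Fin 3)), ε ^ 2 = 1 ∧
      (∀ x, F x = L x + F 0) ∧ (∀ v, L v 2 = ε * v 2) ∧
      (L (EuclideanSpace.single 2 1) = ε • EuclideanSpace.single 2 1) ∧
      ∀ t, a.1 (ε * t + F 0 2) = a.1 t := by
  obtain ⟨ε, hε, h2, h3⟩ := hyperbolic_fderiv ha hF
  have hε0 : ε ≠ 0 := fun h0 ↦ by rw [h0] at hε; norm_num at hε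
  have hG := isLeviCivita_hyperbolic a
  have hsm : ContDiff ℝ ∞ F := contDiff_iff_contDiffAt.2 fun x ↦ (hF x).contDiffAt
  have hT : ∀ x, F x 2 = ε * x 2 + F 0 2 := by
    intro x
    have hd : Differentiable ℝ (fun y ↦ F y 2 - ε * y 2) := by
      have e : ContDiff ℝ ∞ (fun y ↦ F y 2 - ε * y 2) :=
        ((EuclideanSpace.proj 2 : EuclideanSpace ℝ (Fin 3) →L[ℝ] ℝ).contDiff.comp hsm).sub
          (contDiff_const.mul (EuclideanSpace.proj 2 : EuclideanSpace ℝ (Fin 3) →L[ℝ] ℝ).contDiff)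
      exact e.differentiable (by simp)
    have := is_const_of_fderiv_eq_zero hd (fun y ↦ by
      have e1 : HasFDerivAt (fun y ↦ F y 2) _ y :=
        (EuclideanSpace.proj 2 : EuclideanSpace ℝ (Fin 3) →L[ℝ] ℝ).hasFDerivAt.comp y
          (hsm.differentiable (by simp) y).hasFDerivAt
      have e2 : HasFDerivAt (fun y : EuclideanSpace ℝ (Fin 3) ↦ ε * y 2) _ y :=
        (EuclideanSpace.proj 2 : EuclideanSpace ℝ (Fin 3) →L[ℝ] ℝ).hasFDerivAt.const_mul ε
      have e3 : HasFDerivAt (fun y ↦ F y 2 - ε * y 2) _ y := e1.sub e2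
      rw [e3.fderiv]
      ext v
      simp [h2]) x 0
    simp at this
    linarith
  -- The image of `∂t` is a constant vector, so the second derivative of `F` vanishes on `(∂u, ∂t)`.
  -- The Christoffel rule on this pair compares `a' / (2 a)` at `x` and at `F x`.
  have hα : ∀ x, a.halfLogDeriv (x 2) = ε * a.halfLogDeriv (F x 2) := by
    intro x
    have e0 : fderiv ℝ (fderiv ℝ F) x (EuclideanSpace.single 0 1) (EuclideanSpace.single 2 1) = 0 := by
      have e1 := (hasFDerivAt_fderiv (hF x).contDiffAt).clm_apply
        (hasFDerivAt_const (EuclideanSpace.single 2 (1 : ℝ)) x)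
      rw [show (fun y ↦ fderiv ℝ F y (EuclideanSpace.single 2 1)) =
        fun _ ↦ ε • EuclideanSpace.single 2 1 from funext h3] at e1
      have e2 := congrArg (fun L : EuclideanSpace ℝ (Fin 3) →L[ℝ] EuclideanSpace ℝ (Fin 3) ↦
        L (EuclideanSpace.single 0 1)) (e1.unique (hasFDerivAt_const _ x))
      simpa using e2
    rw [hG.fderiv_fderiv (hF x), h3] at e0
    have e1 : hyperbolicConnection a x (EuclideanSpace.single 0 1) (EuclideanSpace.single 2 1) =
        a.halfLogDeriv (x 2) • EuclideanSpace.single 0 1 := by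
      rw [hyperbolicConnection_apply]; apply euclidean_ext <;> simp
    have e2 : hyperbolicConnection a (F x) (fderiv ℝ F x (EuclideanSpace.single 0 1))
        (ε • EuclideanSpace.single 2 1) =
        (ε * a.halfLogDeriv (F x 2)) • fderiv ℝ F x (EuclideanSpace.single 0 1) := by
      have := h2 x (EuclideanSpace.single 0 1)
      simp at this
      rw [hyperbolicConnection_apply]; apply euclidean_ext <;> simp [this] <;> ring
    rw [e1, e2, map_smul, ← sub_smul, smul_eq_zero] at e0
    rcases e0 with e0 | e0
    · linarith
    · have := hG.injective_fderiv (hF x) (e0.trans (map_zero _).symm)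
      simp at this
  -- After the `∂t` components are split off, the connection is carried to itself. Its mixed terms
  -- match by `hα`, its `∂t` component by the isometry equation `fe'`.
  have hD : ∀ x, fderiv ℝ (fderiv ℝ F) x = 0 := by
    intro x
    ext1 v; ext1 w
    rw [hG.fderiv_fderiv (hF x), zero_apply, zero_apply, sub_eq_zero]
    have hv : ∀ v : EuclideanSpace ℝ (Fin 3), ∃ v' : EuclideanSpace ℝ (Fin 3), v' 2 = 0 ∧
        v = v' + v 2 • EuclideanSpace.single 2 1 := fun v ↦
      ⟨v - v 2 • EuclideanSpace.single 2 1, by simp, by abel⟩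
    obtain ⟨v', hv2, hv'⟩ := hv v
    obtain ⟨w', hw2, hw'⟩ := hv w
    have e1 : hyperbolicConnection a x v w = a.halfLogDeriv (x 2) • (w 2 • v' + v 2 • w') -
        (deriv a.1 (x 2) / 2 * (v 0 * w 1 + v 1 * w 0)) • EuclideanSpace.single 2 1 := by
      rw [hyperbolicConnection_apply]
      have c0 := congrArg (fun v : EuclideanSpace ℝ (Fin 3) ↦ v 0) hv'
      have c1 := congrArg (fun v : EuclideanSpace ℝ (Fin 3) ↦ v 1) hv'
      have d0 := congrArg (fun v : EuclideanSpace ℝ (Fin 3) ↦ v 0) hw'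
      have d1 := congrArg (fun v : EuclideanSpace ℝ (Fin 3) ↦ v 1) hw'
      simp at c0 c1 d0 d1
      apply euclidean_ext <;> simp [hv2, hw2, c0, c1, d0, d1] <;> ring
    have f1 : ∀ v v' : EuclideanSpace ℝ (Fin 3), v = v' + v 2 • EuclideanSpace.single 2 1 →
        fderiv ℝ F x v = fderiv ℝ F x v' + (ε * v 2) • EuclideanSpace.single 2 1 := by
      intro v v' h
      conv_lhs => rw [h]
      rw [map_add, map_smul, h3, smul_smul, mul_comm]
    have fe := (hF x).form_eq v w
    simp only [hyperbolicField_apply, hyperbolicForm, h2] at fe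
    have fe' : a.1 (F x 2) * (fderiv ℝ F x v 0 * fderiv ℝ F x w 1 +
        fderiv ℝ F x v 1 * fderiv ℝ F x w 0) = a.1 (x 2) * (v 0 * w 1 + v 1 * w 0) := by
      linear_combination fe - (v 2 * w 2) * hε
    have e2 : hyperbolicConnection a (F x) (fderiv ℝ F x v) (fderiv ℝ F x w) =
        (ε * a.halfLogDeriv (F x 2)) • (w 2 • fderiv ℝ F x v' + v 2 • fderiv ℝ F x w') -
        (deriv a.1 (F x 2) / 2 * (fderiv ℝ F x v 0 * fderiv ℝ F x w 1 +
        fderiv ℝ F x v 1 * fderiv ℝ F x w 0)) • EuclideanSpace.single 2 1 := by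
      rw [hyperbolicConnection_apply]
      have p2 := h2 x v'
      have q2 := h2 x w'
      have r2 := h2 x v
      have s2 := h2 x w
      rw [hv2, mul_zero] at p2
      rw [hw2, mul_zero] at q2
      have c0 := congrArg (fun v : EuclideanSpace ℝ (Fin 3) ↦ v 0) (f1 v v' hv')
      have c1 := congrArg (fun v : EuclideanSpace ℝ (Fin 3) ↦ v 1) (f1 v v' hv')
      have d0 := congrArg (fun v : EuclideanSpace ℝ (Fin 3) ↦ v 0) (f1 w w' hw')
      have d1 := congrArg (fun v : EuclideanSpace ℝ (Fin 3) ↦ v 1) (f1 w w' hw')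
      simp at c0 c1 d0 d1
      apply euclidean_ext <;> simp [p2, q2, r2, s2, c0, c1, d0, d1] <;> ring
    rw [e1, e2, map_sub, map_smul, map_smul, map_add, map_smul, map_smul, h3, hα x, smul_smul]
    congr 2
    have hx := hα x
    have p1 := (a.pos (x 2)).ne'
    have p2 := (a.pos (F x 2)).ne'
    rw [PeriodicProfile.halfLogDeriv, PeriodicProfile.halfLogDeriv, div_eq_iff (by positivity)] at hx
    rw [hx]
    field_simp
    linear_combination (-(deriv a.1 (F x 2)) * ε ^ 2) * fe' + (deriv a.1 (F x 2) * (fderiv ℝ F x v 0 * fderiv ℝ F x w 1 +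
        fderiv ℝ F x v 1 * fderiv ℝ F x w 0) * a.1 (F x 2)) * hε
  refine ⟨ε, fderiv ℝ F 0, hε, eq_affine_of_fderiv_fderiv_eq_zero hsm hD, h2 0, h3 0, ?_⟩
  -- By `hα` numerator and denominator have the same logarithmic derivative. The constant quotient
  -- is then `1` by comparison of maxima.
  have hρ : ∀ t, a.1 (ε * t + F 0 2) / a.1 t = a.1 (ε * 0 + F 0 2) / a.1 0 := by
    have hd : ∀ t, HasDerivAt (fun t ↦ a.1 (ε * t + F 0 2) / a.1 t) 0 t := by
      intro t
      have e1 : HasDerivAt (fun t ↦ ε * t + F 0 2) ε t := by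
        simpa using ((hasDerivAt_id t).const_mul ε).add_const (F 0 2)
      have e2 := ((a.hasDerivAt (ε * t + F 0 2)).comp t e1).div (a.hasDerivAt t) (a.pos t).ne'
      convert! e2 using 1
      have hx := hα (EuclideanSpace.single 2 t)
      rw [hT] at hx
      simp [PeriodicProfile.halfLogDeriv] at hx
      have p1 := (a.pos t).ne'
      have p2 := (a.pos (ε * t + F 0 2)).ne'
      field_simp at hx
      simp only [Function.comp]
      rw [eq_div_iff (by positivity)]
      linear_combination hx
    intro t
    exact is_const_of_deriv_eq_zero (fun t ↦ (hd t).differentiableAt) (fun t ↦ (hd t).deriv) t 0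
  have hρ' : ∀ t, a.1 (ε * t + F 0 2) = (a.1 (ε * 0 + F 0 2) / a.1 0) * a.1 t := fun t ↦ by
    rw [← hρ t, div_mul_cancel₀ _ (a.pos t).ne']
  have := a.homothety_ratio hε0 hρ'
  intro t
  rw [hρ' t, this, one_mul]

end Rigidity

/-! ### Curvature of `a(v) (dt² + 2 du dv)` and its scalar invariant -/

namespace PeriodicProfile

variable (a : PeriodicProfile)

/-- The numerator of the Ricci curvature of the metric `a(v) (dt² + 2 du dv)`. -/
noncomputable def ricciFactor (t : ℝ) : ℝ := 3 * deriv a.1 t ^ 2 - 2 * a.1 t * deriv (deriv a.1) t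

/-- The numerator of the covariant derivative of the Ricci curvature of the metric
`a(v) (dt² + 2 du dv)`. -/
noncomputable def ricciDerivFactor (t : ℝ) : ℝ :=
  a.1 t * deriv a.ricciFactor t - 4 * deriv a.1 t * a.ricciFactor t

theorem contDiff_deriv_deriv : ContDiff ℝ ∞ (deriv (deriv a.1)) :=
  (contDiff_infty_iff_deriv.1 a.contDiff_deriv).2

theorem contDiff_ricciFactor : ContDiff ℝ ∞ a.ricciFactor :=
  (contDiff_const.mul (a.contDiff_deriv.pow 2)).sub
    ((contDiff_const.mul a.contDiff).mul a.contDiff_deriv_deriv)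

theorem hasDerivAt_ricciFactor (t : ℝ) : HasDerivAt a.ricciFactor (deriv a.ricciFactor t) t :=
  (a.contDiff_ricciFactor.differentiable (by simp) t).hasDerivAt

/-- The genericity condition for `a(v) (dt² + 2 du dv)`. -/
def ParabolicGeneric : Prop :=
  ∀ r s : ℝ, r < s → ∃ t ∈ Set.Ioo r s, ∃ t' ∈ Set.Ioo r s,
    a.ricciDerivFactor t ^ 2 * a.ricciFactor t' ^ 3 ≠
      a.ricciDerivFactor t' ^ 2 * a.ricciFactor t ^ 3

variable {a} in
theorem ParabolicGeneric.dense_ricciFactor (h : a.ParabolicGeneric) :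
    Dense {t | a.ricciFactor t ≠ 0} := by
  refine dense_iff_inter_open.2 fun U hU ⟨x, hx⟩ ↦ ?_
  obtain ⟨l, r, hlr, hsub⟩ := mem_nhds_iff_exists_Ioo_subset.1 (hU.mem_nhds hx)
  obtain ⟨t, ht, t', ht', htt⟩ := h l r (hlr.1.trans hlr.2)
  by_cases h0 : a.ricciFactor t = 0
  · refine ⟨t', hsub ht', fun h1 ↦ htt ?_⟩
    rw [h0, h1]; ring
  · exact ⟨t, hsub ht, h0⟩

end PeriodicProfile

section Parabolic

variable (a : PeriodicProfile)

/-- The metric `a(v) (dt² + 2 du dv)` as a field of continuous bilinear forms. -/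
noncomputable def parabolicField (x : EuclideanSpace ℝ (Fin 3)) :
    EuclideanSpace ℝ (Fin 3) →L[ℝ] EuclideanSpace ℝ (Fin 3) →L[ℝ] ℝ :=
  a.1 (x 2) • (coordForm 1 1 + (coordForm 0 2 + coordForm 2 0))

theorem parabolicField_apply (x v w : EuclideanSpace ℝ (Fin 3)) :
    parabolicField a x v w = parabolicForm a x v w := by
  change a.1 (x 2) * (coordForm 1 1 v w + (coordForm 0 2 v w + coordForm 2 0 v w)) = _
  simp only [parabolicForm, coordForm_apply]

/-- The coefficients of the Levi-Civita connection of the metric `a(v) (dt² + 2 du dv)`. -/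
noncomputable def parabolicTensor :
    EuclideanSpace ℝ (Fin 3) →L[ℝ] EuclideanSpace ℝ (Fin 3) →L[ℝ] EuclideanSpace ℝ (Fin 3) :=
  coordMap 1 2 1 + coordMap 2 1 1 + (2 : ℝ) • coordMap 2 2 2 - coordMap 1 1 0

theorem parabolicTensor_apply (v w : EuclideanSpace ℝ (Fin 3)) :
    parabolicTensor v w = !₂[-(v 1 * w 1), v 1 * w 2 + v 2 * w 1, 2 * (v 2 * w 2)] := by
  have h : ∀ l, parabolicTensor v w l = coordMap 1 2 1 v w l + coordMap 2 1 1 v w l +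
      2 * coordMap 2 2 2 v w l - coordMap 1 1 0 v w l := fun l ↦ rfl
  apply euclidean_ext <;> simp [h, coordMap_apply]

/-- The Levi-Civita connection of the metric `a(v) (dt² + 2 du dv)`. -/
noncomputable def parabolicConnection (x : EuclideanSpace ℝ (Fin 3)) :
    EuclideanSpace ℝ (Fin 3) →L[ℝ] EuclideanSpace ℝ (Fin 3) →L[ℝ] EuclideanSpace ℝ (Fin 3) :=
  a.halfLogDeriv (x 2) • parabolicTensor

theorem parabolicConnection_apply (x v w : EuclideanSpace ℝ (Fin 3)) :
    parabolicConnection a x v w = a.halfLogDeriv (x 2) •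
      !₂[-(v 1 * w 1), v 1 * w 2 + v 2 * w 1, 2 * (v 2 * w 2)] := by
  rw [← parabolicTensor_apply]; rfl

theorem fderiv_parabolicField (x u v w : EuclideanSpace ℝ (Fin 3)) :
    fderiv ℝ (parabolicField a) x u v w =
      u 2 * deriv a.1 (x 2) * (v 1 * w 1 + (v 0 * w 2 + v 2 * w 0)) := by
  have h := hasFDerivAt_coord_smul (a.hasDerivAt (x 2))
    (coordForm 1 1 + (coordForm 0 2 + coordForm 2 0))
  have h' : HasFDerivAt (parabolicField a) _ x := h
  rw [h'.fderiv]
  change deriv a.1 (x 2) * u 2 * (coordForm 1 1 v w + (coordForm 0 2 v w + coordForm 2 0 v w)) = _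
  simp only [coordForm_apply]
  ring

theorem fderiv_parabolicConnection (x u v w : EuclideanSpace ℝ (Fin 3)) :
    fderiv ℝ (parabolicConnection a) x u v w =
      (((deriv (deriv a.1) (x 2) * a.1 (x 2) - deriv a.1 (x 2) ^ 2) / (2 * a.1 (x 2) ^ 2)) * u 2) •
      !₂[-(v 1 * w 1), v 1 * w 2 + v 2 * w 1, 2 * (v 2 * w 2)] := by
  have h := hasFDerivAt_coord_smul (a.hasDerivAt_halfLogDeriv (x 2)) parabolicTensor
  have h' : HasFDerivAt (parabolicConnection a) _ x := h
  rw [h'.fderiv, ← parabolicTensor_apply]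
  rfl

theorem isLeviCivita_parabolic : IsLeviCivita (parabolicField a) (parabolicConnection a) where
  contDiff_form := contDiff_coord_smul a.contDiff _
  contDiff_christoffel := contDiff_coord_smul a.contDiff_halfLogDeriv _
  symm x v w := by simp only [parabolicField_apply, parabolicForm]; ring
  nondegenerate x v h := by
    simp only [parabolicField_apply, parabolicForm] at h
    have h0 := h (EuclideanSpace.single 0 1)
    have h1 := h (EuclideanSpace.single 1 1)
    have h2 := h (EuclideanSpace.single 2 1)
    simp [(a.pos (x 2)).ne'] at h0 h1 h2
    exact euclidean_ext h2 h1 h0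
  koszul x u v w := by
    have := (a.pos (x 2)).ne'
    rw [fderiv_parabolicField, fderiv_parabolicField, fderiv_parabolicField,
      parabolicField_apply, parabolicForm, parabolicConnection_apply]
    simp [PeriodicProfile.halfLogDeriv]
    field_simp
    ring

/-- The Ricci tensor has rank at most one. Wherever it is nonzero, isometries must therefore
preserve the plane field `dv = 0`. -/
theorem ricci_parabolic (x v w : EuclideanSpace ℝ (Fin 3)) :
    ricci (parabolicConnection a) x v w =
      a.ricciFactor (x 2) / (4 * a.1 (x 2) ^ 2) * (v 2 * w 2) := by
  have := (a.pos (x 2)).ne'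
  rw [ricci, trace_euclidean]
  simp only [curvature_apply, fderiv_parabolicConnection, parabolicConnection_apply]
  simp [PeriodicProfile.ricciFactor, PeriodicProfile.halfLogDeriv]
  field_simp
  ring

variable {a} {F : EuclideanSpace ℝ (Fin 3) → EuclideanSpace ℝ (Fin 3)}
  {x : EuclideanSpace ℝ (Fin 3)}

theorem parabolic_ricci_eq (h : IsLocalIsometryAt (parabolicField a) F x)
    (v w : EuclideanSpace ℝ (Fin 3)) :
    a.ricciFactor (F x 2) / a.1 (F x 2) ^ 2 * (fderiv ℝ F x v 2 * fderiv ℝ F x w 2) =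
      a.ricciFactor (x 2) / a.1 (x 2) ^ 2 * (v 2 * w 2) := by
  have h1 := (isLeviCivita_parabolic a).ricci_eq h v w
  rw [ricci_parabolic, ricci_parabolic] at h1
  have e : ∀ t, a.ricciFactor t / (4 * a.1 t ^ 2) = a.ricciFactor t / a.1 t ^ 2 / 4 :=
    fun t ↦ by rw [div_div, mul_comm]
  rw [e, e] at h1
  linarith

theorem parabolic_fderiv_of_ne (h : IsLocalIsometryAt (parabolicField a) F x)
    (hx : a.ricciFactor (x 2) ≠ 0) (v : EuclideanSpace ℝ (Fin 3)) :
    fderiv ℝ F x v 2 = fderiv ℝ F x (EuclideanSpace.single 2 1) 2 * v 2 := by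
  have hψ : a.ricciFactor (x 2) / a.1 (x 2) ^ 2 ≠ 0 := div_ne_zero hx (pow_ne_zero _ (a.pos _).ne')
  have h1 := parabolic_ricci_eq h (EuclideanSpace.single 2 1) (EuclideanSpace.single 2 1)
  have hF : a.ricciFactor (F x 2) / a.1 (F x 2) ^ 2 ≠ 0 := by
    intro h0
    rw [h0, zero_mul] at h1
    exact hψ (by simpa using h1.symm)
  have h2 := parabolic_ricci_eq h (v - v 2 • EuclideanSpace.single 2 1)
    (v - v 2 • EuclideanSpace.single 2 1)
  rw [map_sub, map_smul] at h2
  simp only [PiLp.sub_apply, PiLp.smul_apply, smul_eq_mul] at h2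
  simp only [PiLp.single_apply, if_true, mul_one, sub_self, mul_zero, mul_eq_zero, hF, false_or,
    or_self] at h2
  linarith

/-- With `λ` the `∂v` component of the image of `∂v`, the quantity `halfLogDeriv (x 2) -
halfLogDeriv (F x 2) * λ` is the obstruction to `F` being affine along `∂v`. It is eliminated in the
scalar invariant and later shown to vanish. -/
theorem parabolic_fderiv_two (hF : IsLocalIsometryAt (parabolicField a) F x)
    (u v : EuclideanSpace ℝ (Fin 3))
    (h2 : ∀ v, fderiv ℝ F x v 2 = fderiv ℝ F x (EuclideanSpace.single 2 1) 2 * v 2) :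
    fderiv ℝ (fderiv ℝ F) x u v 2 = fderiv ℝ F x (EuclideanSpace.single 2 1) 2 *
      (2 * (a.halfLogDeriv (x 2) - a.halfLogDeriv (F x 2) *
        fderiv ℝ F x (EuclideanSpace.single 2 1) 2)) * (u 2 * v 2) := by
  rw [(isLeviCivita_parabolic a).fderiv_fderiv hF, PiLp.sub_apply, h2,
    parabolicConnection_apply, parabolicConnection_apply]
  simp only [PiLp.smul_apply, smul_eq_mul]
  have e : ∀ a b c : ℝ, ![a, b, c] 2 = c := fun _ _ _ ↦ rfl
  rw [e, e, h2 u, h2 v]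
  ring

theorem hasFDerivAt_fderiv_coord (hF : ContDiffAt ℝ ∞ F x) (v : EuclideanSpace ℝ (Fin 3))
    (i : Fin 3) : HasFDerivAt (fun y ↦ fderiv ℝ F y v i)
      ((EuclideanSpace.proj i : EuclideanSpace ℝ (Fin 3) →L[ℝ] ℝ).comp
        ((fderiv ℝ (fderiv ℝ F) x).flip v)) x := by
  have h1 := (hasFDerivAt_fderiv hF).clm_apply (hasFDerivAt_const v x)
  have h2 := (EuclideanSpace.proj i : EuclideanSpace ℝ (Fin 3) →L[ℝ] ℝ).hasFDerivAt.comp x h1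
  have h3 : HasFDerivAt (fun y ↦ fderiv ℝ F y v i) _ x := h2
  convert! h3 using 1
  ext u
  simp

theorem hasFDerivAt_comp_coord {φ : ℝ → ℝ} {φ' : ℝ} (h : HasDerivAt φ φ' (F x 2))
    (hF : DifferentiableAt ℝ F x) : HasFDerivAt (fun y ↦ φ (F y 2))
      (φ' • (EuclideanSpace.proj 2 : EuclideanSpace ℝ (Fin 3) →L[ℝ] ℝ).comp (fderiv ℝ F x)) x :=
  h.comp_hasFDerivAt x
    ((EuclideanSpace.proj 2 : EuclideanSpace ℝ (Fin 3) →L[ℝ] ℝ).hasFDerivAt.comp x hF.hasFDerivAt)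

/-- A scalar invariant of the metric `a(v) (dt² + 2 du dv)`. -/
theorem parabolic_invariant (h : IsLocalIsometryAt (parabolicField a) F x) :
    a.ricciDerivFactor (x 2) ^ 2 * a.ricciFactor (F x 2) ^ 3 =
      a.ricciDerivFactor (F x 2) ^ 2 * a.ricciFactor (x 2) ^ 3 := by
  by_cases hx : a.ricciFactor (x 2) = 0
  · obtain ⟨v, hv⟩ := (isLeviCivita_parabolic a).surjective_fderiv h (EuclideanSpace.single 2 1)
    have h1 := parabolic_ricci_eq h v v
    rw [hx, hv] at h1
    have h2 : a.ricciFactor (F x 2) = 0 := by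
      simpa [(a.pos (F x 2)).ne'] using h1
    rw [hx, h2]; ring
  have hψ : ∀ t, HasDerivAt (fun t ↦ a.ricciFactor t / a.1 t ^ 2)
      ((deriv a.ricciFactor t * a.1 t - 2 * deriv a.1 t * a.ricciFactor t) / a.1 t ^ 3) t := by
    intro t
    have h0 := (a.pos t).ne'
    convert! (a.hasDerivAt_ricciFactor t).div ((a.hasDerivAt t).pow 2) (pow_ne_zero 2 h0) using 1
    simp
    field_simp
  have h2 := parabolic_fderiv_of_ne h hx
  set e2 : EuclideanSpace ℝ (Fin 3) := EuclideanSpace.single 2 1 with he2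
  have he22 : e2 2 = 1 := by simp [he2]
  have k1 := hasFDerivAt_comp_coord (hψ (F x 2)) (h.contDiffAt.differentiableAt (by simp))
  have k2 := k1.mul ((hasFDerivAt_fderiv_coord h.contDiffAt e2 2).pow 2)
  have k3 := hasFDerivAt_comp_coord (F := id) (hψ (x 2)) differentiableAt_id
  have hev : (fun y ↦ a.ricciFactor (y 2) / a.1 (y 2) ^ 2) =ᶠ[𝓝 x]
      (fun y ↦ a.ricciFactor (F y 2) / a.1 (F y 2) ^ 2 * fderiv ℝ F y e2 2 ^ 2) := by
    filter_upwards [h.eventually] with y hy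
    have := parabolic_ricci_eq hy e2 e2
    rw [he22, mul_one, mul_one, ← sq] at this
    exact this.symm
  have k4 := congrArg (fun L : EuclideanSpace ℝ (Fin 3) →L[ℝ] ℝ ↦ L e2)
    ((k2.congr_of_eventuallyEq hev).unique k3)
  have k5 := parabolic_fderiv_two h e2 e2 h2
  rw [← he2] at k5
  have k6 := hev.self_of_nhds
  simp [k5, he22] at k4
  set lam := fderiv ℝ F x e2 2 with hlam
  simp only [PeriodicProfile.halfLogDeriv] at k4
  have p1 := (a.pos (x 2)).ne'
  have p2 := (a.pos (F x 2)).ne'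
  -- Up to the factor `4`, `ricciFactor / a²` is the `∂v, ∂v` component of Ricci and has weight
  -- `λ²`. Its derivative, corrected by the connection term `2 a' / a`, is the component
  -- `ricciDerivFactor / a³` of the covariant derivative, of weight `λ³`. In the square of the
  -- latter over the cube of the former, both `λ` and `a` cancel.
  have k7 : a.ricciDerivFactor (x 2) / a.1 (x 2) ^ 3 =
      lam ^ 3 * (a.ricciDerivFactor (F x 2) / a.1 (F x 2) ^ 3) := by
    simp only [PeriodicProfile.ricciDerivFactor]
    field_simp at k4 k6 ⊢
    rw [← hlam] at k6
    linear_combination -k4 - 2 * a.1 (F x 2) * deriv a.1 (x 2) * k6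
  have k8 : (a.ricciDerivFactor (x 2) / a.1 (x 2) ^ 3) ^ 2 *
      (a.ricciFactor (F x 2) / a.1 (F x 2) ^ 2) ^ 3 =
      (a.ricciDerivFactor (F x 2) / a.1 (F x 2) ^ 3) ^ 2 *
      (a.ricciFactor (x 2) / a.1 (x 2) ^ 2) ^ 3 := by
    rw [k7]
    change a.ricciFactor (x 2) / a.1 (x 2) ^ 2 = a.ricciFactor (F x 2) / a.1 (F x 2) ^ 2 * lam ^ 2 at k6
    rw [k6]; ring
  field_simp at k8
  exact k8

end Parabolic

/-! ### Isometries of `a(v) (dt² + 2 du dv)` are affine -/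

section ParabolicRigidity

variable {a : PeriodicProfile} {F : EuclideanSpace ℝ (Fin 3) → EuclideanSpace ℝ (Fin 3)}

theorem parabolic_fderiv (ha : a.ParabolicGeneric)
    (hF : ∀ x, IsLocalIsometryAt (parabolicField a) F x) (x v : EuclideanSpace ℝ (Fin 3)) :
    fderiv ℝ F x v 2 = fderiv ℝ F x (EuclideanSpace.single 2 1) 2 * v 2 := by
  have hsm : ContDiff ℝ ∞ F := contDiff_iff_contDiffAt.2 fun x ↦ (hF x).contDiffAt
  have hc : Continuous (fderiv ℝ F) := hsm.continuous_fderiv (by simp)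
  have hcv : ∀ (v : EuclideanSpace ℝ (Fin 3)) (i : Fin 3), Continuous fun x ↦ fderiv ℝ F x v i :=
    fun v i ↦ (EuclideanSpace.proj i : EuclideanSpace ℝ (Fin 3) →L[ℝ] ℝ).continuous.comp
      (hc.clm_apply continuous_const)
  exact mem_of_dense_coord ha.dense_ricciFactor (C := {x | fderiv ℝ F x v 2 =
    fderiv ℝ F x (EuclideanSpace.single 2 1) 2 * v 2})
    (isClosed_eq (hcv _ _) ((hcv _ _).mul continuous_const))
    (fun x hx ↦ parabolic_fderiv_of_ne (hF x) hx v) x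

/-- The algebraic restrictions on the derivative of an isometry of `a(v) (dt² + 2 du dv)`. -/
theorem parabolic_fderiv_entries (ha : a.ParabolicGeneric)
    (hF : ∀ x, IsLocalIsometryAt (parabolicField a) F x) (x : EuclideanSpace ℝ (Fin 3)) :
    fderiv ℝ F x (EuclideanSpace.single 2 1) 2 ≠ 0 ∧
    fderiv ℝ F x (EuclideanSpace.single 0 1) 2 = 0 ∧
    fderiv ℝ F x (EuclideanSpace.single 1 1) 2 = 0 ∧
    fderiv ℝ F x (EuclideanSpace.single 0 1) 1 = 0 ∧
    a.1 (F x 2) * fderiv ℝ F x (EuclideanSpace.single 1 1) 1 ^ 2 = a.1 (x 2) ∧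
    a.1 (F x 2) * (fderiv ℝ F x (EuclideanSpace.single 0 1) 0 *
      fderiv ℝ F x (EuclideanSpace.single 2 1) 2) = a.1 (x 2) := by
  have h2 := parabolic_fderiv ha hF x
  have h0 : fderiv ℝ F x (EuclideanSpace.single 0 1) 2 = 0 := by rw [h2]; simp
  have h1 : fderiv ℝ F x (EuclideanSpace.single 1 1) 2 = 0 := by rw [h2]; simp
  have hp := (a.pos (F x 2)).ne'
  have f00 := (hF x).form_eq (EuclideanSpace.single 0 1) (EuclideanSpace.single 0 1)
  have f11 := (hF x).form_eq (EuclideanSpace.single 1 1) (EuclideanSpace.single 1 1)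
  have f02 := (hF x).form_eq (EuclideanSpace.single 0 1) (EuclideanSpace.single 2 1)
  simp only [parabolicField_apply, parabolicForm, h0, h1] at f00 f11 f02
  simp [hp] at f00 f11 f02
  rw [f00] at f02
  refine ⟨fun h ↦ ?_, h0, h1, f00, by rw [sq]; exact f11, by simpa using f02⟩
  rw [h] at f02
  simp at f02
  exact (a.pos (x 2)).ne f02

theorem affine_ne_zero {m c : ℝ} (h : ∀ s, c + m * s ≠ 0) : m = 0 := by
  by_contra hm
  exact h (-c / m) (by field_simp; ring)

/-- Isometries of a generic metric `a(v) (dt² + 2 du dv)` preserve the affine parameter `v`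
up to affine transformations. -/
theorem parabolic_logDeriv (ha : a.ParabolicGeneric)
    (hF : ∀ x, IsLocalIsometryAt (parabolicField a) F x) (x : EuclideanSpace ℝ (Fin 3)) :
    a.halfLogDeriv (x 2) =
      a.halfLogDeriv (F x 2) * fderiv ℝ F x (EuclideanSpace.single 2 1) 2 := by
  set e2 : EuclideanSpace ℝ (Fin 3) := EuclideanSpace.single 2 1 with he2
  set e1 : EuclideanSpace ℝ (Fin 3) := EuclideanSpace.single 1 1 with he1
  have he22 : e2 2 = 1 := by simp [he2]
  have hG := isLeviCivita_parabolic a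
  -- Let `τ` be the `∂t` component of the image of `∂t`; it has no zero. Along a line in the
  -- direction `∂v` one has `τ' = z τ` and `z' = z²`. So `(1 / τ)' = -z / τ` is constant, `1 / τ` is
  -- affine on the whole line and never zero, hence its slope vanishes and `z = 0`.
  set z : EuclideanSpace ℝ (Fin 3) → ℝ := fun x ↦
    a.halfLogDeriv (x 2) - a.halfLogDeriv (F x 2) * fderiv ℝ F x e2 2 with hz
  have hent := parabolic_fderiv_entries ha hF
  have hτ0 : ∀ x, fderiv ℝ F x e1 1 ≠ 0 := by
    intro x h0
    have := (hent x).2.2.2.2.1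
    rw [← he1, h0] at this
    have := a.pos (x 2)
    simp at *
    linarith
  have hτ : ∀ x u, fderiv ℝ (fderiv ℝ F) x u e1 1 = z x * u 2 * fderiv ℝ F x e1 1 := by
    intro x u
    obtain ⟨l0, h02, h12, h01, -, -⟩ := hent x
    have e : ∀ a b c : ℝ, ![a, b, c] 1 = b := fun _ _ _ ↦ rfl
    rw [hG.fderiv_fderiv (hF x), PiLp.sub_apply]
    have d : parabolicConnection a x u e1 = (-(a.halfLogDeriv (x 2) * u 1)) •
        EuclideanSpace.single 0 1 + (a.halfLogDeriv (x 2) * u 2) • e1 := by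
      rw [parabolicConnection_apply]
      apply euclidean_ext <;> simp [he1]
    rw [d, parabolicConnection_apply, map_add, map_smul, map_smul]
    simp only [PiLp.add_apply, PiLp.smul_apply, smul_eq_mul, e, h01, hz]
    rw [parabolic_fderiv ha hF x u, ← he2]
    rw [← he1] at h12
    rw [h12]
    ring
  have hlam : ∀ x, fderiv ℝ (fderiv ℝ F) x e2 e2 2 = fderiv ℝ F x e2 2 * (2 * z x) := by
    intro x
    have := parabolic_fderiv_two (hF x) e2 e2 (parabolic_fderiv ha hF x)
    rw [this, he22]; ring
  -- With `α = a' / (2 a)` one has `ricciFactor / a² = 4 (α² - α')`. The invariance of Ricci thus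
  -- trades the derivatives `α'` in `z'` for squares, and what remains is `z²`.
  have hzd : ∀ x, ∃ z' : EuclideanSpace ℝ (Fin 3) →L[ℝ] ℝ, HasFDerivAt z z' x ∧
      z' e2 = z x ^ 2 := by
    intro x
    have hd := (hF x).contDiffAt.differentiableAt (by simp)
    have k1 := hasFDerivAt_comp_coord (F := id) (a.hasDerivAt_halfLogDeriv (x 2))
      (differentiableAt_id (x := x))
    have k2 := hasFDerivAt_comp_coord (a.hasDerivAt_halfLogDeriv (F x 2)) hd
    have k3 := k1.sub (k2.mul (hasFDerivAt_fderiv_coord (hF x).contDiffAt e2 2))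
    refine ⟨_, k3, ?_⟩
    have k4 := parabolic_ricci_eq (hF x) e2 e2
    rw [he22] at k4
    have p1 := (a.pos (x 2)).ne'
    have p2 := (a.pos (F x 2)).ne'
    simp [hlam, he22]
    simp only [hz, PeriodicProfile.ricciFactor, PeriodicProfile.halfLogDeriv] at k4 ⊢
    field_simp at k4 ⊢
    linear_combination k4
  have h0 : ∀ s, HasDerivAt (fun s : ℝ ↦ x + s • e2) e2 s := fun s ↦ by
    simpa using ((hasDerivAt_id s).smul_const e2).const_add x
  have h1 : ∀ s, HasDerivAt (fun s : ℝ ↦ (fderiv ℝ F (x + s • e2) e1 1)⁻¹)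
      (-(z (x + s • e2) * (fderiv ℝ F (x + s • e2) e1 1)⁻¹)) s := by
    intro s
    have k1 := HasFDerivAt.comp_hasDerivAt s
      (hasFDerivAt_fderiv_coord (hF (x + s • e2)).contDiffAt e1 1) (h0 s)
    have := k1.fun_inv (hτ0 _)
    convert! this using 1
    simp [hτ, he22]
    have := hτ0 (x + s • e2)
    field_simp
  have h2 : ∀ s, HasDerivAt (fun s : ℝ ↦ -(z (x + s • e2) * (fderiv ℝ F (x + s • e2) e1 1)⁻¹))
      0 s := by
    intro s
    obtain ⟨z', hz', hz2⟩ := hzd (x + s • e2)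
    have := ((HasFDerivAt.comp_hasDerivAt s hz' (h0 s)).mul (h1 s)).neg
    convert! this using 1
    simp [hz2]
    ring
  have h3 : ∀ s, -(z (x + s • e2) * (fderiv ℝ F (x + s • e2) e1 1)⁻¹) =
      -(z x * (fderiv ℝ F x e1 1)⁻¹) := fun s ↦ by
    simpa using is_const_of_deriv_eq_zero (fun s ↦ (h2 s).differentiableAt) (fun s ↦ (h2 s).deriv)
      s 0
  have h4 : ∀ s, (fderiv ℝ F (x + s • e2) e1 1)⁻¹ = (fderiv ℝ F x e1 1)⁻¹ +
      -(z x * (fderiv ℝ F x e1 1)⁻¹) * s := by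
    intro s
    have d : ∀ s, HasDerivAt (fun s ↦ (fderiv ℝ F (x + s • e2) e1 1)⁻¹ -
        -(z x * (fderiv ℝ F x e1 1)⁻¹) * s) 0 s := by
      intro s
      convert! (h1 s).sub ((hasDerivAt_id s).const_mul (-(z x * (fderiv ℝ F x e1 1)⁻¹))) using 1
      rw [h3]; ring
    have := is_const_of_deriv_eq_zero (fun s ↦ (d s).differentiableAt) (fun s ↦ (d s).deriv) s 0
    simp at this
    linarith
  have h5 := affine_ne_zero (fun s ↦ by rw [← h4 s]; exact inv_ne_zero (hτ0 _))
  have h6 : z x = 0 := by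
    simpa [hτ0 x] using h5
  linarith [show z x = a.halfLogDeriv (x 2) - a.halfLogDeriv (F x 2) * fderiv ℝ F x e2 2 from rfl]

/-- Isometries of a generic metric `a(v) (dt² + 2 du dv)` are affine. -/
theorem parabolic_rigidity (ha : a.ParabolicGeneric)
    (hF : ∀ x, IsLocalIsometryAt (parabolicField a) F x) :
    ∃ l τ β : ℝ, l ≠ 0 ∧ τ ^ 2 = 1 ∧ (∀ t, a.1 (l * t + F 0 2) = a.1 t) ∧
      ∀ x, F x 0 = x 0 / l - τ * β / l * x 1 - β ^ 2 / (2 * l) * x 2 + F 0 0 ∧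
        F x 1 = τ * x 1 + β * x 2 + F 0 1 ∧ F x 2 = l * x 2 + F 0 2 := by
  have hG := isLeviCivita_parabolic a
  have hsm : ContDiff ℝ ∞ F := contDiff_iff_contDiffAt.2 fun x ↦ (hF x).contDiffAt
  have hD : ∀ x, fderiv ℝ (fderiv ℝ F) x = 0 := by
    intro x
    ext1 u; ext1 v
    obtain ⟨l0, h02, h12, h01, hττ, hμ⟩ := parabolic_fderiv_entries ha hF x
    have hz := parabolic_logDeriv ha hF x
    have h2 := parabolic_fderiv ha hF x
    have hf := (hF x).form_eq u v
    rw [hG.fderiv_fderiv (hF x), zero_apply, zero_apply, sub_eq_zero]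
    set e0 : EuclideanSpace ℝ (Fin 3) := EuclideanSpace.single 0 1 with he0
    set lam := fderiv ℝ F x (EuclideanSpace.single 2 1) 2 with hlam
    -- The connection in terms of the flat product of `dt² + 2 du dv` and the vector `∂u`. The
    -- derivative of `F` is conformal for that product and preserves the direction of `∂u`, so by
    -- `hz` it carries the connection to itself and the second derivative vanishes.
    have d : ∀ x u v, parabolicConnection a x u v = a.halfLogDeriv (x 2) • (v 2 • u + u 2 • v -
        (u 1 * v 1 + (u 0 * v 2 + u 2 * v 0)) • e0) := by
      intro x u v
      rw [parabolicConnection_apply]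
      apply euclidean_ext <;> simp [he0] <;> ring_nf <;> simp
    simp only [parabolicField_apply, parabolicForm] at hf
    have hμ' : fderiv ℝ F x e0 = fderiv ℝ F x e0 0 • e0 := by
      apply euclidean_ext
      · simp [he0]
      · rw [h01]; simp [he0]
      · rw [h02]; simp [he0]
    have p2 := (a.pos (F x 2)).ne'
    have hμ2 : fderiv ℝ F x e0 0 = a.1 (x 2) / a.1 (F x 2) / lam := by
      field_simp
      linear_combination hμ
    have hf2 : fderiv ℝ F x u 1 * fderiv ℝ F x v 1 + (fderiv ℝ F x u 0 * fderiv ℝ F x v 2 +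
        fderiv ℝ F x u 2 * fderiv ℝ F x v 0) = a.1 (x 2) / a.1 (F x 2) *
        (u 1 * v 1 + (u 0 * v 2 + u 2 * v 0)) := by
      field_simp
      linear_combination hf
    rw [d, d, hf2, map_smul, map_sub, map_add, map_smul, map_smul, map_smul, hμ', hμ2, hz,
      h2 u, h2 v]
    simp only [smul_sub, smul_add, smul_smul]
    have e1 : a.halfLogDeriv (F x 2) * lam * ((u 1 * v 1 + (u 0 * v 2 + u 2 * v 0)) *
        (a.1 (x 2) / a.1 (F x 2) / lam)) = a.halfLogDeriv (F x 2) *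
        (a.1 (x 2) / a.1 (F x 2) * (u 1 * v 1 + (u 0 * v 2 + u 2 * v 0))) := by
      field_simp
    rw [e1, mul_assoc, mul_assoc]
  obtain ⟨l0, h02, h12, h01, hττ, hμ⟩ := parabolic_fderiv_entries ha hF 0
  have f12 := (hF 0).form_eq (EuclideanSpace.single 1 1) (EuclideanSpace.single 2 1)
  have f22 := (hF 0).form_eq (EuclideanSpace.single 2 1) (EuclideanSpace.single 2 1)
  simp only [parabolicField_apply, parabolicForm, h12] at f12 f22
  simp [(a.pos (F 0 2)).ne'] at f12 f22
  have haff := eq_affine_of_fderiv_fderiv_eq_zero hsm hD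
  have hconst : ∀ x, fderiv ℝ F x = fderiv ℝ F 0 := fun x ↦
    is_const_of_fderiv_eq_zero ((hsm.fderiv_right (m := ∞) (by simp)).differentiable (by simp))
      hD x 0
  have h2 := parabolic_fderiv ha hF 0
  have hlog := fun x ↦ parabolic_logDeriv ha hF x
  simp only [hconst] at hlog
  set L := fderiv ℝ F 0
  set l := L (EuclideanSpace.single 2 1) 2
  set τ := L (EuclideanSpace.single 1 1) 1
  set β := L (EuclideanSpace.single 2 1) 1
  have hF2 : ∀ x, F x 2 = l * x 2 + F 0 2 := by
    intro x
    conv_lhs => rw [haff x]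
    rw [PiLp.add_apply, h2]
  have hinv : ∀ t, a.1 (l * t + F 0 2) = a.1 t := by
    have hd : ∀ t, HasDerivAt (fun t ↦ a.1 (l * t + F 0 2) / a.1 t) 0 t := by
      intro t
      have e1 : HasDerivAt (fun t ↦ l * t + F 0 2) l t := by
        simpa using ((hasDerivAt_id t).const_mul l).add_const (F 0 2)
      have e2 := ((a.hasDerivAt (l * t + F 0 2)).comp t e1).div (a.hasDerivAt t) (a.pos t).ne'
      convert! e2 using 1
      have hx := hlog (EuclideanSpace.single 2 t)
      rw [hF2] at hx
      simp [PeriodicProfile.halfLogDeriv] at hx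
      have p1 := (a.pos t).ne'
      have p2 := (a.pos (l * t + F 0 2)).ne'
      field_simp at hx
      simp only [Function.comp]
      rw [eq_div_iff (by positivity)]
      linear_combination hx
    have hρ' : ∀ t, a.1 (l * t + F 0 2) = (a.1 (l * 0 + F 0 2) / a.1 0) * a.1 t := fun t ↦ by
      rw [← is_const_of_deriv_eq_zero (fun t ↦ (hd t).differentiableAt) (fun t ↦ (hd t).deriv) t 0,
        div_mul_cancel₀ _ (a.pos t).ne']
    have := a.homothety_ratio l0 hρ'
    intro t
    rw [hρ' t, this, one_mul]
  have ha0 : a.1 (F 0 2) = a.1 0 := by simpa using hinv 0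
  have p0 := (a.pos 0).ne'
  simp only [PiLp.zero_apply, ha0] at hττ hμ
  have hτ1 : τ ^ 2 = 1 := mul_left_cancel₀ p0 (by rw [hττ, mul_one])
  have hμ1 : L (EuclideanSpace.single 0 1) 0 * l = 1 := mul_left_cancel₀ p0 (by rw [hμ, mul_one])
  refine ⟨l, τ, β, l0, hτ1, hinv, fun x ↦ ?_⟩
  have hx : x = x 0 • EuclideanSpace.single 0 1 + x 1 • EuclideanSpace.single 1 1 +
      x 2 • EuclideanSpace.single 2 1 := by apply euclidean_ext <;> simp
  have hLx : ∀ i, F x i = x 0 * L (EuclideanSpace.single 0 1) i +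
      x 1 * L (EuclideanSpace.single 1 1) i + x 2 * L (EuclideanSpace.single 2 1) i + F 0 i := by
    intro i
    conv_lhs => rw [haff x, hx]
    simp
  refine ⟨?_, ?_, hF2 x⟩
  -- These entries come from the flat products of the images of `∂u`, `∂t`, `∂v` with the image of
  -- `∂v`, which must be `1`, `0`, `0`.
  · rw [hLx, show L (EuclideanSpace.single 0 1) 0 = 1 / l by field_simp; exact hμ1,
      show L (EuclideanSpace.single 1 1) 0 = -(τ * β / l) by
        field_simp; linear_combination f12,
      show L (EuclideanSpace.single 2 1) 0 = -(β ^ 2 / (2 * l)) by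
        field_simp; linear_combination f22]
    ring
  · rw [hLx, h01]; ring

end ParabolicRigidity

/-! ### Periodic functions with prescribed jets -/

section Jets

/-- The derivative of `h ^ (k + 1) * g` is `h ^ k` times a new smooth factor, whose value at the
zero of `h` is `(k + 1) h' g`. The induction therefore has to range over all `g`. -/
theorem iteratedDeriv_pow_mul_of_zero (k : ℕ) : ∀ {h g : ℝ → ℝ}, ContDiff ℝ ∞ h → ContDiff ℝ ∞ g →
    ∀ {t : ℝ}, h t = 0 →
      (∀ j < k, iteratedDeriv j (fun s ↦ h s ^ k * g s) t = 0) ∧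
      iteratedDeriv k (fun s ↦ h s ^ k * g s) t = k.factorial * deriv h t ^ k * g t := by
  induction k with
  | zero => intro h g hh hg t ht; simp
  | succ k ih =>
    intro h g hh hg t ht
    have hd : ∀ s, HasDerivAt h (deriv h s) s := fun s ↦
      (hh.differentiable (by simp) s).hasDerivAt
    have gd : ∀ s, HasDerivAt g (deriv g s) s := fun s ↦
      (hg.differentiable (by simp) s).hasDerivAt
    have e : deriv (fun s ↦ h s ^ (k + 1) * g s) =
        fun s ↦ h s ^ k * ((k + 1) * deriv h s * g s + h s * deriv g s) := by
      funext s
      have e1 : HasDerivAt (fun s ↦ h s ^ (k + 1) * g s) _ s := ((hd s).pow (k + 1)).mul (gd s)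
      rw [e1.deriv]
      simp
      ring
    have hs : ContDiff ℝ ∞ (fun s ↦ ((k : ℝ) + 1) * deriv h s * g s + h s * deriv g s) :=
      ((contDiff_const.mul (contDiff_infty_iff_deriv.1 hh).2).mul hg).add
        (hh.mul (contDiff_infty_iff_deriv.1 hg).2)
    obtain ⟨h1, h2⟩ := ih hh hs ht
    refine ⟨fun j hj ↦ ?_, ?_⟩
    · cases j with
      | zero => simp [ht]
      | succ j => rw [iteratedDeriv_succ', e]; exact h1 j (by omega)
    · rw [iteratedDeriv_succ', e, h2, ht, Nat.factorial_succ]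
      push_cast
      ring

/-- There are periodic functions with a prescribed leading term at a point, which vanish to a high
order at another one. -/
theorem exists_periodic_jet (k : ℕ) {t t' : ℝ} (h : ∀ m : ℤ, t - t' ≠ m) :
    ∃ φ : ℝ → ℝ, ContDiff ℝ ∞ φ ∧ Function.Periodic φ 1 ∧
      (∀ j < k, iteratedDeriv j φ t = 0) ∧ iteratedDeriv k φ t = 1 ∧
      ∀ j < k + 2, iteratedDeriv j φ t' = 0 := by
  -- `f t` has simple zeros, exactly on `t + ℤ`, and changes sign under `s ↦ s + 1`. The product of
  -- powers with exponents `k` and `k + 2` has even total degree, so it is `1`-periodic.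
  set f : ℝ → ℝ → ℝ := fun t s ↦ Real.sin (Real.pi * (s - t)) with hf
  have hfs : ∀ t, ContDiff ℝ ∞ (f t) := fun t ↦
    Real.contDiff_sin.comp (contDiff_const.mul (contDiff_id.sub contDiff_const))
  have hf0 : ∀ t, f t t = 0 := fun t ↦ by simp [hf]
  have hfd : ∀ t, deriv (f t) t = Real.pi := by
    intro t
    have : HasDerivAt (f t) _ t :=
      (((hasDerivAt_id t).sub_const t).const_mul Real.pi).sin
    rw [this.deriv]; simp
  have hfp : ∀ t s, f t (s + 1) = -f t s := fun t s ↦ by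
    rw [hf]
    simp only
    rw [← Real.sin_add_pi]
    congr 1; ring
  have hft : f t' t ≠ 0 := by
    intro h0
    obtain ⟨m, hm⟩ := Real.sin_eq_zero_iff.1 h0
    refine h m ?_
    have := Real.pi_ne_zero
    exact mul_left_cancel₀ this (by rw [← hm, mul_comm])
  set c : ℝ := k.factorial * Real.pi ^ k * f t' t ^ (k + 2) with hc
  have hc0 : c ≠ 0 := mul_ne_zero (mul_ne_zero (by exact_mod_cast k.factorial_ne_zero)
    (pow_ne_zero _ Real.pi_ne_zero)) (pow_ne_zero _ hft)
  have h1 := iteratedDeriv_pow_mul_of_zero k (hfs t)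
    (g := fun s ↦ f t' s ^ (k + 2) * c⁻¹) (((hfs t').pow _).mul contDiff_const) (hf0 t)
  have h2 := iteratedDeriv_pow_mul_of_zero (k + 2) (hfs t')
    (g := fun s ↦ f t s ^ k * c⁻¹) (((hfs t).pow _).mul contDiff_const) (hf0 t')
  have e : (fun s ↦ f t' s ^ (k + 2) * (f t s ^ k * c⁻¹)) =
    fun s ↦ f t s ^ k * (f t' s ^ (k + 2) * c⁻¹) := by funext s; ring
  rw [e] at h2
  refine ⟨fun s ↦ f t s ^ k * (f t' s ^ (k + 2) * c⁻¹),
    ((hfs t).pow _).mul (((hfs t').pow _).mul contDiff_const), fun s ↦ ?_, h1.1, ?_, h2.1⟩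
  · simp only [hfp]
    have : (-f t s) ^ k * (-f t' s) ^ (k + 2) = f t s ^ k * f t' s ^ (k + 2) := by
      rw [neg_pow, neg_pow (f t' s)]
      have : ((-1 : ℝ) ^ k) * (-1) ^ (k + 2) = 1 := by
        rw [← pow_add]; exact Even.neg_one_pow ⟨k + 1, by ring⟩
      linear_combination (f t s ^ k * f t' s ^ (k + 2)) * this
    linear_combination c⁻¹ * this
  · rw [h1.2, hfd, ← mul_assoc, ← hc, mul_inv_cancel₀ hc0]

end Jets

/-! ### Residuality of the genericity conditions -/

namespace PeriodicProfile

theorem _root_.Function.Periodic.iteratedDeriv {f : ℝ → ℝ} {c : ℝ} (h : Function.Periodic f c)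
    (k : ℕ) : Function.Periodic (iteratedDeriv k f) c := fun x ↦ by
  have := iteratedDeriv_comp_add_const k f c
  rw [funext h] at this
  exact (congrFun this x).symm

theorem _root_.Function.Periodic.exists_bound {f : ℝ → ℝ} (h : Function.Periodic f 1)
    (hc : Continuous f) : ∃ C, ∀ x, |f x| ≤ C := by
  obtain ⟨C, hC⟩ := isCompact_Icc.exists_bound_of_continuousOn (s := Set.Icc (0 : ℝ) 1)
    hc.continuousOn
  refine ⟨C, fun x ↦ ?_⟩
  obtain ⟨y, hy, hxy⟩ := h.exists_mem_Ico₀ zero_lt_one x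
  rw [hxy]
  exact hC y ⟨hy.1, hy.2.le⟩

variable (a : PeriodicProfile)

theorem exists_min : ∃ δ > 0, ∀ t, δ ≤ a.1 t := by
  obtain ⟨t₀, -, h⟩ := isCompact_Icc.exists_isMinOn (Set.nonempty_Icc.2 zero_le_one)
    a.contDiff.continuous.continuousOn (s := Set.Icc (0 : ℝ) 1)
  refine ⟨a.1 t₀, a.pos t₀, fun t ↦ ?_⟩
  obtain ⟨s, hs, hst⟩ := a.periodic.exists_mem_Ico₀ zero_lt_one t
  rw [hst]
  exact h ⟨hs.1, hs.2.le⟩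

/-- Small perturbations of a profile. -/
theorem eventually_perturb {U : Set PeriodicProfile} (hU : U ∈ 𝓝 a) {φ : ℝ → ℝ}
    (hφ : ContDiff ℝ ∞ φ) (hp : Function.Periodic φ 1) :
    ∀ᶠ ε in 𝓝 (0 : ℝ), ∃ b ∈ U, b.1 = fun t ↦ a.1 t + ε * φ t := by
  have hpos : ∀ᶠ ε in 𝓝 (0 : ℝ), ∀ t, 0 < a.1 t + ε * φ t := by
    obtain ⟨δ, hδ, hδa⟩ := a.exists_min
    obtain ⟨C, hC⟩ := hp.exists_bound hφ.continuous
    have h1 : Filter.Tendsto (fun ε : ℝ ↦ |ε| * C) (𝓝 0) (𝓝 (|0| * C)) :=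
      (continuous_abs.mul continuous_const).tendsto 0
    rw [abs_zero, zero_mul] at h1
    filter_upwards [h1.eventually_lt_const hδ] with ε hε t
    have h2 : |ε * φ t| ≤ |ε| * C := by
      rw [abs_mul]; exact mul_le_mul_of_nonneg_left (hC t) (abs_nonneg _)
    have := neg_abs_le (ε * φ t)
    have := hδa t
    linarith
  classical
  -- The default value `a`, used when positivity fails, only makes `b` total; it plays no role near
  -- `ε = 0`.
  let b : ℝ → PeriodicProfile := fun ε ↦ if h : ∀ t, 0 < a.1 t + ε * φ t then
    ⟨fun t ↦ a.1 t + ε * φ t, a.contDiff.add (contDiff_const.mul hφ),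
      fun t ↦ by simp only [a.periodic t, hp t], h⟩ else a
  have hb : ∀ᶠ ε in 𝓝 (0 : ℝ), (b ε).1 = fun t ↦ a.1 t + ε * φ t := by
    filter_upwards [hpos] with ε hε
    have : b ε = ⟨fun t ↦ a.1 t + ε * φ t, _⟩ := dif_pos hε
    rw [this]
  have ht : Filter.Tendsto b (𝓝 0) (𝓝 a) := by
    rw [nhds_induced, Filter.tendsto_comap_iff, tendsto_pi_nhds]
    intro k
    rw [UniformFun.tendsto_iff_tendstoUniformly, Metric.tendstoUniformly_iff]
    intro η hη
    have hk : ContDiff ℝ k φ := hφ.of_le (by exact_mod_cast le_top)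
    have hka : ContDiff ℝ k a.1 := a.contDiff.of_le (by exact_mod_cast le_top)
    obtain ⟨C, hC⟩ := (hp.iteratedDeriv k).exists_bound (hφ.continuous_iteratedDeriv k
      (by exact_mod_cast le_top))
    have h1 : Filter.Tendsto (fun ε : ℝ ↦ |ε| * C) (𝓝 0) (𝓝 (|0| * C)) :=
      (continuous_abs.mul continuous_const).tendsto 0
    rw [abs_zero, zero_mul] at h1
    filter_upwards [h1.eventually_lt_const hη, hb] with ε hε hbε t
    change dist (iteratedDeriv k a.1 t) (iteratedDeriv k (b ε).1 t) < η
    have e : iteratedDeriv k (fun t ↦ a.1 t + ε * φ t) t =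
        iteratedDeriv k a.1 t + ε * iteratedDeriv k φ t := by
      rw [iteratedDeriv_fun_add hka.contDiffAt (contDiff_const.mul hk).contDiffAt,
        iteratedDeriv_const_mul_field]
    rw [hbε, e, dist_self_add_right, Real.norm_eq_abs, abs_mul]
    exact (mul_le_mul_of_nonneg_left (hC t) (abs_nonneg _)).trans_lt hε
  filter_upwards [ht hU, hb] with ε h1 h2
  exact ⟨b ε, h1, h2⟩

theorem continuous_iteratedDeriv (k : ℕ) (t : ℝ) :
    Continuous fun a : PeriodicProfile ↦ iteratedDeriv k a.1 t := by
  have h1 : Continuous (fun (a : PeriodicProfile) (k : ℕ) ↦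
      (UniformFun.ofFun (iteratedDeriv k a.1) : UniformFun ℝ ℝ)) := continuous_induced_dom
  exact (UniformFun.uniformContinuous_eval ℝ t).continuous.comp ((continuous_apply k).comp h1)

/-- Adding a small multiple of the function of `exists_periodic_jet` moves one derivative at `t` and
leaves alone the lower ones and a longer jet at `t'`. Periodicity is the reason why `t - t'` must
not be an integer. -/
theorem exists_jet {U : Set PeriodicProfile} (hU : U ∈ 𝓝 a) (k : ℕ) {t t' : ℝ}
    (h : ∀ m : ℤ, t - t' ≠ m) : ∀ᶠ ε in 𝓝 (0 : ℝ), ∃ b ∈ U,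
      (∀ j < k, iteratedDeriv j b.1 t = iteratedDeriv j a.1 t) ∧
      iteratedDeriv k b.1 t = iteratedDeriv k a.1 t + ε ∧
      ∀ j < k + 2, iteratedDeriv j b.1 t' = iteratedDeriv j a.1 t' := by
  obtain ⟨φ, hφ, hp, h1, h2, h3⟩ := exists_periodic_jet k h
  filter_upwards [a.eventually_perturb hU hφ hp] with ε ⟨b, hb, hbφ⟩
  have e : ∀ j t, iteratedDeriv j b.1 t = iteratedDeriv j a.1 t + ε * iteratedDeriv j φ t := by
    intro j t
    rw [hbφ, iteratedDeriv_fun_add (a.contDiff.of_le (by exact_mod_cast le_top)).contDiffAt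
      (contDiff_const.mul (hφ.of_le (by exact_mod_cast le_top))).contDiffAt,
        iteratedDeriv_const_mul_field]
  refine ⟨b, hb, fun j hj ↦ ?_, ?_, fun j hj ↦ ?_⟩
  · rw [e, h1 j hj, mul_zero, add_zero]
  · rw [e, h2, mul_one]
  · rw [e, h3 j hj, mul_zero, add_zero]

theorem deriv_deriv_eq (t : ℝ) : deriv (deriv a.1) t = iteratedDeriv 2 a.1 t := by
  rw [iteratedDeriv_succ, iteratedDeriv_one]

theorem ricciFactor_eq (t : ℝ) : a.ricciFactor t = 3 * iteratedDeriv 1 a.1 t ^ 2 -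
    2 * iteratedDeriv 0 a.1 t * iteratedDeriv 2 a.1 t := by
  rw [ricciFactor, deriv_deriv_eq, iteratedDeriv_one, iteratedDeriv_zero]

theorem ricciDerivFactor_eq (t : ℝ) : a.ricciDerivFactor t = iteratedDeriv 0 a.1 t *
    (4 * iteratedDeriv 1 a.1 t * iteratedDeriv 2 a.1 t -
      2 * iteratedDeriv 0 a.1 t * iteratedDeriv 3 a.1 t) -
    4 * iteratedDeriv 1 a.1 t * a.ricciFactor t := by
  have h : HasDerivAt (deriv (deriv a.1)) (deriv (deriv (deriv a.1)) t) t :=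
    (a.contDiff_deriv_deriv.differentiable (by simp) t).hasDerivAt
  have h1 : HasDerivAt a.ricciFactor _ t := (((a.hasDerivAt_deriv t).pow 2).const_mul 3).sub
    (((a.hasDerivAt t).const_mul 2).mul h)
  rw [ricciDerivFactor, h1.deriv, iteratedDeriv_succ (n := 2), iteratedDeriv_succ (n := 1),
    iteratedDeriv_one, iteratedDeriv_zero]
  simp only [Nat.cast_ofNat, show 2 - 1 = 1 from rfl, pow_one]
  ring

/-- A property of profiles that holds if some continuous functional does not vanish, and that can
be achieved by small perturbations in each interval, is generic. -/
theorem residual_of_dense {Φ : ℝ → ℝ → PeriodicProfile → ℝ} (hc : ∀ t t', Continuous (Φ t t'))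
    (hd : ∀ t t' : ℝ, (∀ m : ℤ, t - t' ≠ m) → Dense {a | Φ t t' a ≠ 0}) :
    ∀ᶠ a in residual PeriodicProfile, ∀ r s : ℝ, r < s → ∃ t ∈ Set.Ioo r s, ∃ t' ∈ Set.Ioo r s,
      Φ t t' a ≠ 0 := by
  have h1 : ∀ p : ℚ × ℚ, p.1 < p.2 → ∀ᶠ a in residual PeriodicProfile,
      ∃ t ∈ Set.Ioo (p.1 : ℝ) p.2, ∃ t' ∈ Set.Ioo (p.1 : ℝ) p.2, Φ t t' a ≠ 0 := by
    intro p hp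
    have hp' : (p.1 : ℝ) < p.2 := by exact_mod_cast hp
    obtain ⟨t, ht1, ht2⟩ := exists_between hp'
    -- Taking `t' < t + 1` keeps `t - t'` off the integers.
    obtain ⟨t', ht1', ht2'⟩ := exists_between (lt_min ht2 (lt_add_one t))
    have hm : ∀ m : ℤ, t - t' ≠ m := by
      intro m hm
      have e1 := lt_of_lt_of_le ht2' (min_le_right _ _)
      have e2 : (-1 : ℝ) < m := by linarith
      have e3 : (m : ℝ) < 0 := by linarith
      norm_cast at e2 e3
      omega
    have : IsOpen {a | Φ t t' a ≠ 0} := isOpen_ne_fun (hc t t') continuous_const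
    filter_upwards [residual_of_dense_open this (hd t t' hm)] with a ha
    exact ⟨t, ⟨ht1, ht2⟩, t', ⟨ht1.trans ht1', lt_of_lt_of_le ht2' (min_le_left _ _)⟩, ha⟩
  have h2 : ∀ᶠ a in residual PeriodicProfile, ∀ p : ℚ × ℚ, p.1 < p.2 →
      ∃ t ∈ Set.Ioo (p.1 : ℝ) p.2, ∃ t' ∈ Set.Ioo (p.1 : ℝ) p.2, Φ t t' a ≠ 0 := by
    rw [eventually_countable_forall]
    intro p
    by_cases hp : p.1 < p.2
    · filter_upwards [h1 p hp] with a ha _ using ha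
    · exact Filter.Eventually.of_forall fun a h ↦ absurd h hp
  filter_upwards [h2] with a ha r s hrs
  obtain ⟨q, hq1, hq2⟩ := exists_rat_btwn hrs
  obtain ⟨q', hq1', hq2'⟩ := exists_rat_btwn hq2
  obtain ⟨t, ht, t', ht', h⟩ := ha (q, q') (by exact_mod_cast hq1')
  exact ⟨t, ⟨hq1.trans ht.1, ht.2.trans hq2'⟩, t', ⟨hq1.trans ht'.1, ht'.2.trans hq2'⟩, h⟩

theorem dense_of_perturb {S : Set PeriodicProfile}
    (h : ∀ (a : PeriodicProfile), ∀ U ∈ 𝓝 a, ∃ b ∈ U, b ∈ S) : Dense S := fun a ↦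
  mem_closure_iff_nhds.2 fun U hU ↦ by
    obtain ⟨b, hb, hS⟩ := h a U hU
    exact ⟨b, hb, hS⟩

theorem dense_of_perturb' {S S' : Set PeriodicProfile} (hS' : Dense S')
    (h : ∀ a ∈ S', ∀ U ∈ 𝓝 a, ∃ b ∈ U, b ∈ S) : Dense S := by
  have : S' ⊆ closure S := fun a ha ↦ mem_closure_iff_nhds.2 fun U hU ↦ by
    obtain ⟨b, hb, hS⟩ := h a ha U hU
    exact ⟨b, hb, hS⟩
  exact dense_closure.1 (hS'.mono this)

theorem eventually_ne_of_nhds {p : ℝ → Prop} (h : ∀ᶠ ε in 𝓝 (0 : ℝ), p ε) (c : ℝ) :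
    ∃ ε, ε ≠ 0 ∧ ε ≠ c ∧ p ε := by
  have h1 : ∀ᶠ ε in 𝓝[>] (0 : ℝ), p ε := nhdsWithin_le_nhds h
  have h2 : ∀ᶠ ε in 𝓝[>] (0 : ℝ), ε ≠ c := by
    rcases eq_or_ne c 0 with rfl | hc
    · filter_upwards [self_mem_nhdsWithin] with ε hε using (ne_of_gt hε)
    · exact nhdsWithin_le_nhds (eventually_ne_nhds hc.symm)
  obtain ⟨ε, ⟨h1, h2⟩, h3⟩ := ((h1.and h2).and self_mem_nhdsWithin).exists
  exact ⟨ε, ne_of_gt h3, h2, h1⟩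

theorem residual_hyperbolicGeneric :
    ∀ᶠ a in residual PeriodicProfile, a.HyperbolicGeneric := by
  have h := residual_of_dense (Φ := fun t t' a ↦ iteratedDeriv 2 a.1 t * iteratedDeriv 0 a.1 t' -
    iteratedDeriv 2 a.1 t' * iteratedDeriv 0 a.1 t)
    (fun t t' ↦ ((continuous_iteratedDeriv _ _).mul (continuous_iteratedDeriv _ _)).sub
      ((continuous_iteratedDeriv _ _).mul (continuous_iteratedDeriv _ _))) ?_
  · filter_upwards [h] with a ha r s hrs
    obtain ⟨t, ht, t', ht', h⟩ := ha r s hrs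
    refine ⟨t, ht, t', ht', fun h' ↦ h ?_⟩
    rw [deriv_deriv_eq, deriv_deriv_eq] at h'
    rw [iteratedDeriv_zero, h', sub_self]
  · intro t t' hm
    refine dense_of_perturb fun a U hU ↦ ?_
    -- Perturbing `a''` at `t` makes the functional affine in `ε` with slope `a t'`. The excluded
    -- value is its root.
    obtain ⟨ε, hε, hc, b, hb, h1, h2, h3⟩ := eventually_ne_of_nhds (a.exists_jet hU 2 hm)
      (-(iteratedDeriv 2 a.1 t * iteratedDeriv 0 a.1 t' -
        iteratedDeriv 2 a.1 t' * iteratedDeriv 0 a.1 t) / a.1 t')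
    refine ⟨b, hb, fun h0 ↦ hc ?_⟩
    rw [h2, h1 0 (by norm_num), h3 0 (by norm_num), h3 2 (by norm_num)] at h0
    rw [eq_div_iff (a.pos t').ne']
    rw [iteratedDeriv_zero] at *
    linear_combination h0

theorem residual_parabolicGeneric :
    ∀ᶠ a in residual PeriodicProfile, a.ParabolicGeneric := by
  have hcN : ∀ t, Continuous fun a : PeriodicProfile ↦ a.ricciFactor t := fun t ↦ by
    simp only [ricciFactor_eq]
    have := fun k ↦ continuous_iteratedDeriv k t
    fun_prop
  have hcN1 : ∀ t, Continuous fun a : PeriodicProfile ↦ a.ricciDerivFactor t := fun t ↦ by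
    simp only [ricciDerivFactor_eq]
    have := fun k ↦ continuous_iteratedDeriv k t
    have := hcN t
    fun_prop
  have h := residual_of_dense (Φ := fun t t' a ↦ a.ricciDerivFactor t ^ 2 * a.ricciFactor t' ^ 3 -
      a.ricciDerivFactor t' ^ 2 * a.ricciFactor t ^ 3)
    (fun t t' ↦ by have := hcN t; have := hcN t'; have := hcN1 t; have := hcN1 t'; fun_prop) ?_
  · filter_upwards [h] with a ha r s hrs
    obtain ⟨t, ht, t', ht', h⟩ := ha r s hrs
    exact ⟨t, ht, t', ht', sub_ne_zero.1 h⟩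
  · intro t t' hm
    -- `ricciFactor t'` enters the leading coefficient of the quadratic in `ε` below, so it is first
    -- made nonzero. It is affine in `a'' t'` with slope `-2 a t'`.
    have hd : Dense {a : PeriodicProfile | a.ricciFactor t' ≠ 0} := by
      refine dense_of_perturb fun a U hU ↦ ?_
      obtain ⟨ε, hε, hc, b, hb, h1, h2, h3⟩ := eventually_ne_of_nhds
        (a.exists_jet hU 2 (t := t') (t' := t) fun m h ↦ hm (-m) (by push_cast; linarith))
        (a.ricciFactor t' / (2 * a.1 t'))
      refine ⟨b, hb, fun h0 ↦ hc ?_⟩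
      rw [ricciFactor_eq, h2, h1 0 (by norm_num), h1 1 (by norm_num)] at h0
      have := (a.pos t').ne'
      rw [eq_div_iff (by positivity), ricciFactor_eq]
      rw [iteratedDeriv_zero] at *
      linear_combination -h0
    refine dense_of_perturb' hd fun a ha U hU ↦ ?_
    have hat := (a.pos t).ne'
    by_cases hΦ : a.ricciDerivFactor t ^ 2 * a.ricciFactor t' ^ 3 -
      a.ricciDerivFactor t' ^ 2 * a.ricciFactor t ^ 3 = 0
    swap
    · exact ⟨a, mem_of_mem_nhds hU, hΦ⟩
    -- Perturbing `a'''` at `t` changes only `ricciDerivFactor t`, by `-2 a² ε`. The functional is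
    -- quadratic in `ε` and vanishes at `0` by `hΦ`; the excluded value is its other root.
    obtain ⟨ε, hε, hc, b, hb, h1, h2, h3⟩ := eventually_ne_of_nhds (a.exists_jet hU 3 hm)
      (a.ricciDerivFactor t / a.1 t ^ 2)
    have e1 : b.ricciFactor t' = a.ricciFactor t' := by
      rw [ricciFactor_eq, ricciFactor_eq, h3 0 (by norm_num), h3 1 (by norm_num),
        h3 2 (by norm_num)]
    have e2 : b.ricciDerivFactor t' = a.ricciDerivFactor t' := by
      rw [ricciDerivFactor_eq, ricciDerivFactor_eq, e1, h3 0 (by norm_num), h3 1 (by norm_num),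
        h3 2 (by norm_num), h3 3 (by norm_num)]
    have e3 : b.ricciFactor t = a.ricciFactor t := by
      rw [ricciFactor_eq, ricciFactor_eq, h1 0 (by norm_num), h1 1 (by norm_num),
        h1 2 (by norm_num)]
    have e4 : b.ricciDerivFactor t = a.ricciDerivFactor t - 2 * a.1 t ^ 2 * ε := by
      rw [ricciDerivFactor_eq, ricciDerivFactor_eq, e3, h1 0 (by norm_num), h1 1 (by norm_num),
        h1 2 (by norm_num), h2, iteratedDeriv_zero]
      ring
    refine ⟨b, hb, ?_⟩
    change b.ricciDerivFactor t ^ 2 * b.ricciFactor t' ^ 3 -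
      b.ricciDerivFactor t' ^ 2 * b.ricciFactor t ^ 3 ≠ 0
    rw [e1, e2, e3, e4]
    have e5 : (a.ricciDerivFactor t - 2 * a.1 t ^ 2 * ε) ^ 2 * a.ricciFactor t' ^ 3 -
        a.ricciDerivFactor t' ^ 2 * a.ricciFactor t ^ 3 =
        4 * a.ricciFactor t' ^ 3 * a.1 t ^ 2 * ε * (ε * a.1 t ^ 2 - a.ricciDerivFactor t) := by
      linear_combination hΦ
    rw [e5]
    rw [Ne, eq_div_iff (pow_ne_zero 2 hat)] at hc
    exact mul_ne_zero (mul_ne_zero (mul_ne_zero (mul_ne_zero four_ne_zero (pow_ne_zero _ ha))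
      (pow_ne_zero _ hat)) hε) (sub_ne_zero.2 hc)

/-! ### An explicit analytic profile -/

/-- The inverse square of `2 + cos (2 π t)`. -/
noncomputable def model : PeriodicProfile :=
  ⟨fun t ↦ (2 + Real.cos (2 * Real.pi * t))⁻¹ ^ 2, by
    have h : ∀ t, 2 + Real.cos (2 * Real.pi * t) ≠ 0 := fun t ↦ by
      have := Real.neg_one_le_cos (2 * Real.pi * t)
      linarith
    refine ⟨ContDiff.pow (ContDiff.inv (by fun_prop) h) 2, fun t ↦ ?_, fun t ↦ ?_⟩
    · simp only [mul_add, mul_one, Real.cos_add_two_pi]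
    · have := h t
      positivity⟩

theorem model_pos (t : ℝ) : 0 < 2 + Real.cos (2 * Real.pi * t) := by
  have := Real.neg_one_le_cos (2 * Real.pi * t)
  linarith

theorem analyticOnNhd_model : AnalyticOnNhd ℝ model.1 Set.univ := fun t _ ↦ by
  change AnalyticAt ℝ (fun t ↦ (2 + Real.cos (2 * Real.pi * t))⁻¹ ^ 2) t
  have := (model_pos t).ne'
  have h : AnalyticAt ℝ (fun t ↦ 2 + Real.cos (2 * Real.pi * t)) t := by fun_prop
  exact (h.inv this).pow 2

theorem analyticOnNhd_iteratedDeriv_model (k : ℕ) :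
    AnalyticOnNhd ℝ (_root_.iteratedDeriv k model.1) Set.univ := by
  induction k with
  | zero => rw [iteratedDeriv_zero]; exact analyticOnNhd_model
  | succ k ih => rw [iteratedDeriv_succ]; exact ih.deriv

/-- An identity between analytic functions propagates from an interval to the line. -/
theorem eq_zero_of_analytic {Φ : ℝ → ℝ} (h : AnalyticOnNhd ℝ Φ Set.univ) {r s : ℝ} (hrs : r < s)
    (h0 : ∀ t ∈ Set.Ioo r s, Φ t = 0) (t : ℝ) : Φ t = 0 := by
  obtain ⟨m, hm⟩ := exists_between hrs
  refine h.eqOn_zero_of_preconnected_of_eventuallyEq_zero isPreconnected_univ (Set.mem_univ m) ?_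
    (Set.mem_univ t)
  filter_upwards [Ioo_mem_nhds hm.1 hm.2] with t ht using h0 t ht

theorem iteratedDeriv_model (t : ℝ) :
    iteratedDeriv 1 model.1 t = 4 * Real.pi * Real.sin (2 * Real.pi * t) *
      (2 + Real.cos (2 * Real.pi * t))⁻¹ ^ 3 ∧
    iteratedDeriv 2 model.1 t = 8 * Real.pi ^ 2 * Real.cos (2 * Real.pi * t) *
      (2 + Real.cos (2 * Real.pi * t))⁻¹ ^ 3 + 24 * Real.pi ^ 2 *
      Real.sin (2 * Real.pi * t) ^ 2 * (2 + Real.cos (2 * Real.pi * t))⁻¹ ^ 4 ∧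
    iteratedDeriv 3 model.1 t = -(16 * Real.pi ^ 3 * Real.sin (2 * Real.pi * t)) *
      (2 + Real.cos (2 * Real.pi * t))⁻¹ ^ 3 + 144 * Real.pi ^ 3 * Real.cos (2 * Real.pi * t) *
      Real.sin (2 * Real.pi * t) * (2 + Real.cos (2 * Real.pi * t))⁻¹ ^ 4 + 192 * Real.pi ^ 3 *
      Real.sin (2 * Real.pi * t) ^ 3 * (2 + Real.cos (2 * Real.pi * t))⁻¹ ^ 5 := by
  have hx : ∀ t : ℝ, HasDerivAt (fun t : ℝ ↦ 2 * Real.pi * t) (2 * Real.pi) t := fun t ↦ by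
    simpa using (hasDerivAt_id t).const_mul (2 * Real.pi)
  have hs := fun t ↦ (hx t).sin
  have hc := fun t ↦ (hx t).cos
  have hy : ∀ t : ℝ, HasDerivAt (fun t ↦ (2 + Real.cos (2 * Real.pi * t))⁻¹)
      (2 * Real.pi * Real.sin (2 * Real.pi * t) * (2 + Real.cos (2 * Real.pi * t))⁻¹ ^ 2) t := by
    intro t
    convert! ((hc t).const_add 2).fun_inv (model_pos t).ne' using 1
    have := (model_pos t).ne'
    field_simp
  have h1 : deriv model.1 = fun t ↦ 4 * Real.pi * Real.sin (2 * Real.pi * t) *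
      (2 + Real.cos (2 * Real.pi * t))⁻¹ ^ 3 := by
    funext t
    have : HasDerivAt model.1 _ t := (hy t).fun_pow 2
    rw [this.deriv]
    simp only [Nat.cast_ofNat, show 2 - 1 = 1 from rfl, pow_one]
    ring
  have h2 : iteratedDeriv 2 model.1 = fun t ↦ 8 * Real.pi ^ 2 * Real.cos (2 * Real.pi * t) *
      (2 + Real.cos (2 * Real.pi * t))⁻¹ ^ 3 + 24 * Real.pi ^ 2 *
      Real.sin (2 * Real.pi * t) ^ 2 * (2 + Real.cos (2 * Real.pi * t))⁻¹ ^ 4 := by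
    rw [iteratedDeriv_succ, iteratedDeriv_one, h1]
    funext t
    have := ((hs t).const_mul (4 * Real.pi)).fun_mul ((hy t).fun_pow 3)
    rw [this.deriv]
    simp only [Nat.cast_ofNat, show 3 - 1 = 2 from rfl]
    ring
  refine ⟨by rw [iteratedDeriv_one, h1], by rw [h2], ?_⟩
  rw [iteratedDeriv_succ, h2]
  have := (((hc t).const_mul (8 * Real.pi ^ 2)).fun_mul ((hy t).fun_pow 3)).fun_add
    ((((hs t).fun_pow 2).const_mul (24 * Real.pi ^ 2)).fun_mul ((hy t).fun_pow 4))
  rw [this.deriv]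
  simp only [Nat.cast_ofNat, show 3 - 1 = 2 from rfl, show 4 - 1 = 3 from rfl,
    show 2 - 1 = 1 from rfl, pow_one]
  ring

/-- By analyticity in each variable in turn, an equality on an interval would hold for all `t`,
`t'`. But `a''` has opposite signs at `0` and `1 / 2`. -/
theorem model_hyperbolicGeneric : model.HyperbolicGeneric := by
  intro r s hrs
  by_contra! h
  simp only [deriv_deriv_eq] at h
  have A := fun k ↦ analyticOnNhd_iteratedDeriv_model k
  have h1 : ∀ t' ∈ Set.Ioo r s, ∀ t, iteratedDeriv 2 model.1 t * model.1 t' -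
      iteratedDeriv 2 model.1 t' * model.1 t = 0 := fun t' ht' ↦
    eq_zero_of_analytic (((A 2).mul analyticOnNhd_const).sub
      (analyticOnNhd_const.mul analyticOnNhd_model)) hrs fun t ht ↦ sub_eq_zero.2 (h t ht t' ht')
  have h2 : ∀ t t', iteratedDeriv 2 model.1 t * model.1 t' -
      iteratedDeriv 2 model.1 t' * model.1 t = 0 := fun t ↦
    eq_zero_of_analytic ((analyticOnNhd_const.mul analyticOnNhd_model).sub
      ((A 2).mul analyticOnNhd_const)) hrs fun t' ht' ↦ h1 t' ht' t
  have h3 := h2 0 (1 / 2)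
  rw [(iteratedDeriv_model _).2.1, (iteratedDeriv_model _).2.1] at h3
  simp only [model] at h3
  rw [show 2 * Real.pi * (1 / 2) = Real.pi by ring] at h3
  norm_num at h3
  have := pow_pos Real.pi_pos 2
  linarith

/-- In general `ricciFactor = 4 a^(5/2) (a^(-1/2))''`, which is why an inverse square is convenient.
Here it has a simple zero at `1 / 4` and does not vanish at `0`. So at the pair `(1 / 4, 0)` exactly
one side of the continued identity is zero. -/
theorem model_parabolicGeneric : model.ParabolicGeneric := by
  intro r s hrs
  by_contra! h
  have A := fun k ↦ analyticOnNhd_iteratedDeriv_model k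
  have A0 : AnalyticOnNhd ℝ model.ricciFactor Set.univ := by
    rw [show model.ricciFactor = _ from funext model.ricciFactor_eq]
    exact (analyticOnNhd_const.mul ((A 1).pow 2)).sub ((analyticOnNhd_const.mul (A 0)).mul (A 2))
  have A1 : AnalyticOnNhd ℝ model.ricciDerivFactor Set.univ := by
    rw [show model.ricciDerivFactor = _ from funext model.ricciDerivFactor_eq]
    exact ((A 0).mul (((analyticOnNhd_const.mul (A 1)).mul (A 2)).sub
      ((analyticOnNhd_const.mul (A 0)).mul (A 3)))).sub ((analyticOnNhd_const.mul (A 1)).mul A0)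
  have h1 : ∀ t' ∈ Set.Ioo r s, ∀ t, model.ricciDerivFactor t ^ 2 * model.ricciFactor t' ^ 3 -
      model.ricciDerivFactor t' ^ 2 * model.ricciFactor t ^ 3 = 0 := fun t' ht' ↦
    eq_zero_of_analytic (((A1.pow 2).mul analyticOnNhd_const).sub
      (analyticOnNhd_const.mul (A0.pow 3))) hrs fun t ht ↦ sub_eq_zero.2 (h t ht t' ht')
  have h2 : ∀ t t', model.ricciDerivFactor t ^ 2 * model.ricciFactor t' ^ 3 -
      model.ricciDerivFactor t' ^ 2 * model.ricciFactor t ^ 3 = 0 := fun t ↦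
    eq_zero_of_analytic ((analyticOnNhd_const.mul (A0.pow 3)).sub
      ((A1.pow 2).mul analyticOnNhd_const)) hrs fun t' ht' ↦ h1 t' ht' t
  have h3 := h2 (1 / 4) 0
  rw [ricciDerivFactor_eq, ricciFactor_eq model 0, ricciFactor_eq model (1 / 4)] at h3
  simp only [iteratedDeriv_zero, (iteratedDeriv_model _).1, (iteratedDeriv_model _).2.1,
    (iteratedDeriv_model _).2.2] at h3
  simp only [model] at h3
  rw [show 2 * Real.pi * (1 / 4) = Real.pi / 2 by ring] at h3
  norm_num at h3
  ring_nf at h3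
  simp [Real.pi_ne_zero] at h3

end PeriodicProfile

/-! ### Topology of the isometry group -/

section IsoTopology

variable {n : ℕ} {M : Type*} [TopologicalSpace M] [ChartedSpace (EuclideanSpace ℝ (Fin n)) M]
  [IsManifold (𝓡 n) ∞ M] {g : LorentzMetric n M}

theorem LorentzMetric.Iso.ext {f f' : g.Iso} (h : ∀ y, f.1 y = f'.1 y) : f = f' :=
  Subtype.ext (Diffeomorph.ext h)

theorem LorentzMetric.Iso.continuous_toContinuousMap :
    Continuous fun f : g.Iso ↦ (⟨f.1, f.1.continuous⟩ : C(M, M)) := continuous_induced_dom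

theorem LorentzMetric.Iso.continuous_eval (y : M) : Continuous fun f : g.Iso ↦ f.1 y :=
  (continuous_eval_const (F := C(M, M)) y).comp LorentzMetric.Iso.continuous_toContinuousMap

/-- A group of isometries that moves points which are close to a point with bounded orbit away is
not relatively compact. -/
theorem LorentzMetric.not_compactSpace_iso [T2Space M] {f : ℕ → g.Iso} {x y y' : M} {u : ℕ → M}
    (hu : Filter.Tendsto u Filter.atTop (𝓝 x)) (hx : ∀ k, (f k).1 x = y)
    (hf : Filter.Tendsto (fun k ↦ (f k).1 (u k)) Filter.atTop (𝓝 y')) (hy : y ≠ y') :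
    ¬ CompactSpace g.Iso := by
  intro hc
  have : LocallyCompactSpace M := ChartedSpace.locallyCompactSpace (EuclideanSpace ℝ (Fin n)) M
  -- In a compact group `f` would converge along an ultrafilter to some `φ`. Evaluation is jointly
  -- continuous because `M` is locally compact, so `(f k).1 (u k)` would tend to `φ x = y` as well
  -- as to `y'`.
  let 𝒰 : Ultrafilter ℕ := Ultrafilter.of Filter.atTop
  have h𝒰 : (𝒰 : Filter ℕ) ≤ Filter.atTop := Ultrafilter.of_le _
  obtain ⟨φ, -, hφ⟩ := isCompact_iff_ultrafilter_le_nhds'.1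
    (isCompact_univ : IsCompact (Set.univ : Set g.Iso)) (𝒰.map f) Filter.univ_mem
  have hφ' : Filter.Tendsto f 𝒰 (𝓝 φ) := hφ
  have h1 : φ.1 x = y := by
    refine tendsto_nhds_unique (((LorentzMetric.Iso.continuous_eval x).tendsto φ).comp hφ') ?_
    simp only [Function.comp_def, hx]
    exact tendsto_const_nhds
  have h2 : Filter.Tendsto (fun k ↦ (f k).1 (u k)) 𝒰 (𝓝 (φ.1 x)) := by
    have e1 : Continuous fun z : C(M, M) × M ↦ z.1 z.2 := continuous_eval
    have e2 := ((LorentzMetric.Iso.continuous_toContinuousMap (g := g)).tendsto φ).comp hφ'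
    exact (e1.tendsto ((⟨φ.1, φ.1.continuous⟩ : C(M, M)), x)).comp
      (e2.prodMk_nhds (hu.mono_left h𝒰))
  exact hy (h1.symm.trans (tendsto_nhds_unique h2 (hf.mono_left h𝒰)))

/-- Countable subsets of a metric space are totally disconnected. Functions with countably many
values thus pin down the elements of the identity component without using a Lie group structure. -/
theorem LorentzMetric.Iso.eq_of_countable {X : Type*} [MetricSpace X] {ψ : g.Iso → X}
    (hψ : Continuous ψ) (hc : (Set.range ψ).Countable) {f : g.Iso}
    (hf : f ∈ LorentzMetric.Iso.identityComponent g) : ψ f = ψ (LorentzMetric.Iso.refl g) := by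
  refine hc.isTotallyDisconnected (ψ '' connectedComponent (LorentzMetric.Iso.refl g))
    (Set.image_subset_range _ _) (isPreconnected_connectedComponent.image _ hψ.continuousOn)
    ⟨f, hf, rfl⟩ ⟨_, mem_connectedComponent, rfl⟩

theorem LorentzMetric.isCompact_identityComponent_of_subset {K : Set g.Iso} (hK : IsCompact K)
    (h : LorentzMetric.Iso.identityComponent g ⊆ K) :
    IsCompact (LorentzMetric.Iso.identityComponent g) :=
  hK.of_isClosed_subset isClosed_connectedComponent h

/-- The component is trivial: if `f` moves `y`, a continuous real function separating `y` from `f y`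
would be nonconstant along the component while taking countably many values on the group. -/
theorem LorentzMetric.isCompact_identityComponent_of_countable [T2Space M] [Countable g.Iso] :
    IsCompact (LorentzMetric.Iso.identityComponent g) := by
  have : LocallyCompactSpace M := ChartedSpace.locallyCompactSpace (EuclideanSpace ℝ (Fin n)) M
  refine LorentzMetric.isCompact_identityComponent_of_subset
    (isCompact_singleton (x := LorentzMetric.Iso.refl g)) fun f hf ↦ ?_
  refine LorentzMetric.Iso.ext fun y ↦ ?_
  by_contra hne
  obtain ⟨χ, h0, h1, -⟩ := exists_continuous_zero_one_of_isCompact (isCompact_singleton (x := y))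
    (isClosed_singleton (x := f.1 y)) (Set.disjoint_singleton.2 (Ne.symm hne))
  have := LorentzMetric.Iso.eq_of_countable (ψ := fun f : g.Iso ↦ χ (f.1 y))
    (χ.continuous.comp (LorentzMetric.Iso.continuous_eval y)) (Set.countable_range _) hf
  change χ (f.1 y) = χ ((LorentzMetric.Iso.refl g).1 y) at this
  rw [h1 rfl, show (LorentzMetric.Iso.refl g).1 y = y from rfl, h0 rfl] at this
  exact one_ne_zero this

/-- Continuity into the compact-open topology follows from joint continuity on `B × M`, which can be
tested on its open cover by `B × ℝⁿ`. It makes compact the families of isometries induced by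
translations. -/
theorem LorentzMetric.Iso.continuous_of_lift {B : Type*} [TopologicalSpace B]
    {p : EuclideanSpace ℝ (Fin n) → M} (hp : IsOpenQuotientMap p) {φ : B → g.Iso}
    {Φ : B × EuclideanSpace ℝ (Fin n) → EuclideanSpace ℝ (Fin n)} (hΦ : Continuous Φ)
    (h : ∀ b x, (φ b).1 (p x) = p (Φ (b, x))) : Continuous φ := by
  refine continuous_induced_rng.2 (ContinuousMap.continuous_of_continuous_uncurry _ ?_)
  have e : (Function.uncurry fun b y ↦ (φ b).1 y) ∘ (Prod.map id p) = p ∘ Φ := by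
    funext ⟨b, x⟩; exact h b x
  refine (((IsOpenQuotientMap.id (X := B)).prodMap hp).continuous_comp_iff (X := B × _)).1 ?_
  change Continuous ((Function.uncurry fun b y ↦ (φ b).1 y) ∘ (Prod.map id p))
  rw [e]
  exact hp.continuous.comp hΦ

end IsoTopology

/-! ### Periods of nonconstant profiles -/

namespace PeriodicProfile

variable {a : PeriodicProfile}

theorem HyperbolicGeneric.not_const (h : a.HyperbolicGeneric) : ¬ ∀ t t', a.1 t = a.1 t' := by
  intro hc
  obtain ⟨t, -, t', -, htt⟩ := h 0 1 one_pos
  have e : a.1 = fun _ ↦ a.1 0 := funext fun t ↦ hc t 0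
  refine htt ?_
  rw [e]; simp

theorem ParabolicGeneric.not_const (h : a.ParabolicGeneric) : ¬ ∀ t t', a.1 t = a.1 t' := by
  intro hc
  obtain ⟨t, -, t', -, htt⟩ := h 0 1 one_pos
  have e : a.1 = fun _ ↦ a.1 0 := funext fun t ↦ hc t 0
  have e0 : ∀ t, a.ricciFactor t = 0 := fun t ↦ by
    rw [ricciFactor, e]; simp
  refine htt ?_
  rw [e0, e0]; ring

/-- The periods of a nonconstant profile form a countable set. -/
theorem countable_shifts (h : ¬ ∀ t t', a.1 t = a.1 t') {l : ℝ} (hl : l ≠ 0) :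
    {c : ℝ | ∀ t, a.1 (l * t + c) = a.1 t}.Countable := by
  let S : AddSubgroup ℝ :=
    { carrier := {c | ∀ t, a.1 (t + c) = a.1 t}
      add_mem' := fun {c c'} hc hc' t ↦ by rw [← add_assoc, hc', hc]
      zero_mem' := fun t ↦ by rw [add_zero]
      neg_mem' := fun {c} hc t ↦ by rw [← hc (t + -c), neg_add_cancel_right] }
  -- A subgroup of `ℝ` is dense or cyclic, and a dense group of periods would make `a` constant.
  have hS : (S : Set ℝ).Countable := by
    rcases S.dense_or_cyclic with hd | ⟨c, hc⟩
    · refine absurd (fun t t' ↦ ?_) h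
      have hcl : IsClosed {c : ℝ | a.1 (t' + c) = a.1 t'} :=
        isClosed_eq (a.contDiff.continuous.comp (continuous_const.add continuous_id))
          continuous_const
      have := hcl.closure_subset_iff.2 (fun c (hc : c ∈ S) ↦ hc t')
      rw [hd.closure_eq] at this
      simpa using this (Set.mem_univ (t - t'))
    · rw [hc, ← AddSubgroup.zmultiples_eq_closure]
      exact Set.countable_range _
  -- For general `l`, two admissible shifts differ by a period.
  by_cases hne : ∃ c₀, ∀ t, a.1 (l * t + c₀) = a.1 t
  · obtain ⟨c₀, h0⟩ := hne
    refine Set.Countable.mono ?_ (hS.image fun c ↦ c + c₀)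
    intro c hc
    refine ⟨c - c₀, ?_, sub_add_cancel c c₀⟩
    change ∀ t, a.1 (t + (c - c₀)) = a.1 t
    intro t
    have e1 := hc ((t - c₀) / l)
    have e2 := h0 ((t - c₀) / l)
    rw [mul_div_cancel₀ _ hl] at e1 e2
    rw [show t + (c - c₀) = t - c₀ + c by ring, e1, ← e2]
    ring_nf
  · exact Set.countable_empty.mono fun c hc ↦ hne ⟨c, hc⟩

end PeriodicProfile

/-! ### Absence of local homogeneity -/

section Homogeneity

variable {M : Type*} [TopologicalSpace M] [ChartedSpace (EuclideanSpace ℝ (Fin 3)) M]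
  [IsManifold (𝓡 3) ∞ M] {g : LorentzMetric 3 M} {a : PeriodicProfile}

/-- If local isometries preserve a scalar invariant of the last coordinate which is not constant
on any interval, no open set is locally homogeneous. -/
theorem LorentzMetric.PullsBackTo.not_isLocallyHomogeneousOn {p : EuclideanSpace ℝ (Fin 3) → M}
    (hs : Function.Surjective p) (hp : IsLocalDiffeomorph (𝓡 3) (𝓡 3) ∞ p)
    {G : EuclideanSpace ℝ (Fin 3) → EuclideanSpace ℝ (Fin 3) →L[ℝ] EuclideanSpace ℝ (Fin 3) →L[ℝ] ℝ}
    (hg : g.PullsBackTo p fun x v w ↦ G x v w) {R : ℝ → ℝ → Prop}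
    (hR : ∀ r s : ℝ, r < s → ∃ t ∈ Set.Ioo r s, ∃ t' ∈ Set.Ioo r s, ¬ R t t')
    (hG : ∀ F x, IsLocalIsometryAt G F x → R (x 2) (F x 2)) (U : Set M) (hU : IsOpen U)
    (hne : U.Nonempty) : ¬ g.IsLocallyHomogeneousOn U := by
  intro h
  obtain ⟨y, hy⟩ := hne
  obtain ⟨x, rfl⟩ := hs y
  -- A short segment through `x` along the last coordinate projects into `U`, and it contains two
  -- points whose heights violate `R`.
  let ι : ℝ → EuclideanSpace ℝ (Fin 3) := fun s ↦ x + s • EuclideanSpace.single 2 1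
  have hι : Continuous ι := by fun_prop
  have hι2 : ∀ s, ι s 2 = x 2 + s := fun s ↦ by simp [ι]
  have hV : IsOpen ((p ∘ ι) ⁻¹' U) := hU.preimage (hp.contMDiff.continuous.comp hι)
  obtain ⟨l, r, hlr, hsub⟩ := mem_nhds_iff_exists_Ioo_subset.1
    (hV.mem_nhds (show (0 : ℝ) ∈ (p ∘ ι) ⁻¹' U by simpa [ι] using hy))
  obtain ⟨t, ht, t', ht', htt⟩ := hR (x 2 + l) (x 2 + r) (by linarith [hlr.1.trans hlr.2])
  obtain ⟨F, hF, hF'⟩ := hg.exists_local_lift hp h (x := ι (t - x 2)) (y := ι (t' - x 2))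
    (hsub ⟨by linarith [ht.1], by linarith [ht.2]⟩)
    (hsub ⟨by linarith [ht'.1], by linarith [ht'.2]⟩)
  refine htt ?_
  have := hG F _ hF'
  rw [hF, hι2, hι2] at this
  simpa using this

theorem hyperbolicForm_eq (a : PeriodicProfile) :
    hyperbolicForm a = fun x v w ↦ hyperbolicField a x v w := by
  funext x v w; rw [hyperbolicField_apply]

theorem parabolicForm_eq (a : PeriodicProfile) :
    parabolicForm a = fun x v w ↦ parabolicField a x v w := by
  funext x v w; rw [parabolicField_apply]

theorem hyperbolic_not_locallyHomogeneous {p : EuclideanSpace ℝ (Fin 3) → M}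
    (hs : Function.Surjective p) (hp : IsLocalDiffeomorph (𝓡 3) (𝓡 3) ∞ p)
    (hg : g.PullsBackTo p (hyperbolicForm a)) (ha : a.HyperbolicGeneric) (U : Set M)
    (hU : IsOpen U) (hne : U.Nonempty) : ¬ g.IsLocallyHomogeneousOn U := by
  rw [hyperbolicForm_eq] at hg
  refine hg.not_isLocallyHomogeneousOn hs hp (R := fun t t' ↦
    deriv (deriv a.1) t * a.1 t' = deriv (deriv a.1) t' * a.1 t) ha (fun F x h ↦ ?_) U hU hne
  exact ((div_eq_div_iff (a.pos _).ne' (a.pos _).ne').1 (hyperbolic_invariant a h)).symm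

theorem parabolic_not_locallyHomogeneous {p : EuclideanSpace ℝ (Fin 3) → M}
    (hs : Function.Surjective p) (hp : IsLocalDiffeomorph (𝓡 3) (𝓡 3) ∞ p)
    (hg : g.PullsBackTo p (parabolicForm a)) (ha : a.ParabolicGeneric) (U : Set M)
    (hU : IsOpen U) (hne : U.Nonempty) : ¬ g.IsLocallyHomogeneousOn U := by
  rw [parabolicForm_eq] at hg
  exact hg.not_isLocallyHomogeneousOn hs hp (R := fun t t' ↦
    a.ricciDerivFactor t ^ 2 * a.ricciFactor t' ^ 3 =
      a.ricciDerivFactor t' ^ 2 * a.ricciFactor t ^ 3) ha (fun F x h ↦ parabolic_invariant h) U hU hne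

end Homogeneity

/-! ### The deck group of a torus bundle -/

section Deck

variable (A : SL(2, ℤ))

/-- The transformation `(x, t) ↦ (A ^ k x + m, t + k)`. -/
noncomputable def deckMap (k : ℤ) (m : Fin 2 → ℤ) (x : EuclideanSpace ℝ (Fin 3)) :
    EuclideanSpace ℝ (Fin 3) :=
  !₂[((A ^ k) 0 0 : ℝ) * x 0 + ((A ^ k) 0 1 : ℝ) * x 1 + m 0,
    ((A ^ k) 1 0 : ℝ) * x 0 + ((A ^ k) 1 1 : ℝ) * x 1 + m 1, x 2 + k]

variable {A}

theorem eq_deckMap_iff {k : ℤ} {m : Fin 2 → ℤ} {x y : EuclideanSpace ℝ (Fin 3)} :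
    (y 2 = x 2 + k ∧ ∀ i : Fin 2, y i.castSucc =
      ∑ j : Fin 2, ((A ^ k) i j : ℝ) * x j.castSucc + m i) ↔ deckMap A k m x = y := by
  constructor
  · rintro ⟨h2, h⟩
    have h0 := h 0
    have h1 := h 1
    simp [Fin.sum_univ_two] at h0 h1
    apply euclidean_ext <;> simp [deckMap, h0, h1, h2]
  · rintro rfl
    refine ⟨by simp [deckMap], fun i ↦ ?_⟩
    fin_cases i <;> simp [deckMap, Fin.sum_univ_two]

theorem deckMap_zero (x : EuclideanSpace ℝ (Fin 3)) : deckMap A 0 0 x = x := by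
  apply euclidean_ext <;> simp [deckMap]

theorem deckMap_deckMap (k k' : ℤ) (m m' : Fin 2 → ℤ) (x : EuclideanSpace ℝ (Fin 3)) :
    deckMap A k m (deckMap A k' m' x) =
      deckMap A (k + k') (fun i ↦ ∑ j, (A ^ k) i j * m' j + m i) x := by
  apply euclidean_ext <;> simp [deckMap, zpow_add, Matrix.mul_apply, Fin.sum_univ_two] <;> ring

theorem deckMap_neg_left (k : ℤ) (m : Fin 2 → ℤ) (x : EuclideanSpace ℝ (Fin 3)) :
    deckMap A (-k) (fun i ↦ -∑ j, (A ^ (-k)) i j * m j) (deckMap A k m x) = x := by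
  rw [deckMap_deckMap]
  convert! deckMap_zero (A := A) x using 2
  · simp
  · funext i; simp

theorem deckMap_neg_right (k : ℤ) (m : Fin 2 → ℤ) (x : EuclideanSpace ℝ (Fin 3)) :
    deckMap A k m (deckMap A (-k) (fun i ↦ -∑ j, (A ^ (-k)) i j * m j) x) = x := by
  rw [deckMap_deckMap]
  convert! deckMap_zero (A := A) x using 2
  · simp
  · have h : ∀ i j, ∑ l, (A ^ k) i l * (A ^ (-k)) l j = (1 : Matrix (Fin 2) (Fin 2) ℤ) i j := by
      intro i j
      have : ((A ^ k * A ^ (-k) : SL(2, ℤ)) : Matrix (Fin 2) (Fin 2) ℤ) i j =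
          ((1 : SL(2, ℤ)) : Matrix (Fin 2) (Fin 2) ℤ) i j := by rw [← zpow_add]; simp
      rwa [Matrix.SpecialLinearGroup.coe_mul, Matrix.SpecialLinearGroup.coe_one,
        Matrix.mul_apply] at this
    have h00 := h 0 0
    have h01 := h 0 1
    have h10 := h 1 0
    have h11 := h 1 1
    simp [Fin.sum_univ_two] at h00 h01 h10 h11
    refine funext (Fin.forall_fin_two.2 ⟨?_, ?_⟩) <;> simp [Fin.sum_univ_two]
    · linear_combination (-m 0) * h00 - m 1 * h01
    · linear_combination (-m 0) * h10 - m 1 * h11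

theorem contDiff_deckMap (k : ℤ) (m : Fin 2 → ℤ) : ContDiff ℝ ∞ (deckMap A k m) := by
  rw [contDiff_euclidean]
  intro i
  fin_cases i <;> simp [deckMap] <;> fun_prop

variable (A) in
/-- The group of the transformations `(x, t) ↦ (A ^ k x + m, t + k)`. -/
noncomputable def deckGroup : Subgroup (Equiv.Perm (EuclideanSpace ℝ (Fin 3))) where
  carrier := {γ | ∃ (k : ℤ) (m : Fin 2 → ℤ), ∀ x, γ x = deckMap A k m x}
  mul_mem' := by
    rintro γ γ' ⟨k, m, h⟩ ⟨k', m', h'⟩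
    exact ⟨_, _, fun x ↦ by rw [Equiv.Perm.mul_apply, h', h, deckMap_deckMap]⟩
  one_mem' := ⟨0, 0, fun x ↦ (deckMap_zero x).symm⟩
  inv_mem' := by
    rintro γ ⟨k, m, h⟩
    refine ⟨-k, fun i ↦ -∑ j, (A ^ (-k)) i j * m j, fun x ↦ ?_⟩
    rw [Equiv.Perm.inv_eq_iff_eq, h, deckMap_neg_right]

theorem exists_mem_deckGroup (k : ℤ) (m : Fin 2 → ℤ) :
    ∃ γ ∈ deckGroup A, ∀ x, γ x = deckMap A k m x :=
  ⟨⟨deckMap A k m, deckMap A (-k) fun i ↦ -∑ j, (A ^ (-k)) i j * m j, deckMap_neg_left k m,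
    deckMap_neg_right k m⟩, ⟨k, m, fun _ ↦ rfl⟩, fun _ ↦ rfl⟩

/-- Open unit cubes are disjoint from their translates: the last coordinate forces `k = 0`, and then
the map is an integral translation moving each coordinate by less than one. -/
theorem abs_lt_of_deckMap {x y : EuclideanSpace ℝ (Fin 3)} {k : ℤ} {m : Fin 2 → ℤ}
    (h : ∀ i, |deckMap A k m y i - x i| < 1 / 2) (h' : ∀ i, |y i - x i| < 1 / 2) :
    k = 0 ∧ m = 0 := by
  have key : ∀ (i : Fin 3) (r : ℤ), deckMap A k m y i - y i = r → r = 0 := by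
    intro i r hr
    have e1 := abs_lt.1 (h i)
    have e2 := abs_lt.1 (h' i)
    have e3 : (-1 : ℝ) < r := by rw [← hr]; linarith
    have e4 : (r : ℝ) < 1 := by rw [← hr]; linarith
    norm_cast at e3 e4
    omega
  have hk : k = 0 := key 2 k (by simp [deckMap])
  subst hk
  refine ⟨rfl, ?_⟩
  funext i
  fin_cases i
  · exact key 0 (m 0) (by simp [deckMap])
  · exact key 1 (m 1) (by simp [deckMap])

variable {M : Type*} [TopologicalSpace M] {q : EuclideanSpace ℝ (Fin 3) → M}

theorem isQuotientCoveringMap_deckGroup (hq : Topology.IsQuotientMap q)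
    (h : ∀ x y, q x = q y ↔ ∃ (k : ℤ) (m : Fin 2 → ℤ), deckMap A k m x = y) :
    IsQuotientCoveringMap q (deckGroup A) where
  __ := hq
  continuous_const_smul := by
    rintro ⟨γ, k, m, hγ⟩
    exact (contDiff_deckMap (A := A) k m).continuous.congr fun x ↦ (hγ x).symm
  apply_eq_iff_mem_orbit := by
    intro x y
    rw [eq_comm, h]
    constructor
    · rintro ⟨k, m, rfl⟩
      obtain ⟨γ, hγ, e⟩ := exists_mem_deckGroup (A := A) k m
      exact ⟨⟨γ, hγ⟩, e y⟩
    · rintro ⟨⟨γ, k, m, hγ⟩, rfl⟩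
      exact ⟨k, m, (hγ y).symm⟩
  disjoint x := by
    refine ⟨{y | ∀ i, |y i - x i| < 1 / 2}, ?_, ?_⟩
    · have : IsOpen {y : EuclideanSpace ℝ (Fin 3) | ∀ i, |y i - x i| < 1 / 2} := by
        rw [Set.ofPred_forall]
        exact isOpen_iInter_of_finite fun i ↦ isOpen_lt (by fun_prop) continuous_const
      exact this.mem_nhds (by simp)
    · rintro ⟨γ, k, m, hγ⟩ ⟨z, ⟨y, hy, rfl⟩, hz⟩
      have hz' : ∀ i, |deckMap A k m y i - x i| < 1 / 2 := fun i ↦ by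
        rw [← hγ]; exact hz i
      obtain ⟨rfl, rfl⟩ := abs_lt_of_deckMap hz' hy
      refine Subtype.ext (Equiv.ext fun z ↦ ?_)
      exact (hγ z).trans (deckMap_zero z)

/-- For fixed `k` the relation asks that certain continuous functions be integers, which is closed.
Different `k` lie over different values of `z.2 2 - z.1 2`, so the union over `k` is locally finite.
-/
theorem isClosed_deckRel : IsClosed {z : EuclideanSpace ℝ (Fin 3) × EuclideanSpace ℝ (Fin 3) |
    ∃ (k : ℤ) (m : Fin 2 → ℤ), deckMap A k m z.1 = z.2} := by
  have e : {z : EuclideanSpace ℝ (Fin 3) × EuclideanSpace ℝ (Fin 3) |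
      ∃ (k : ℤ) (m : Fin 2 → ℤ), deckMap A k m z.1 = z.2} =
      ⋃ k : ℤ, {z | z.2 2 - z.1 2 ∈ ({(k : ℝ)} : Set ℝ)} ∩ (⋂ i : Fin 2,
        {z | z.2 i.castSucc - deckMap A k 0 z.1 i.castSucc ∈ Set.range ((↑) : ℤ → ℝ)}) := by
    ext z
    simp only [Set.mem_ofPred_eq, Set.mem_iUnion, Set.mem_inter_iff, Set.mem_iInter,
      Set.mem_singleton_iff]
    refine exists_congr fun k ↦ ⟨?_, ?_⟩
    · rintro ⟨m, h⟩
      rw [← h]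
      refine ⟨by simp [deckMap], fun i ↦ ⟨m i, ?_⟩⟩
      fin_cases i <;> simp [deckMap]
    · rintro ⟨h, h'⟩
      choose m hm using h'
      refine ⟨m, euclidean_ext ?_ ?_ ?_⟩
      · have := hm 0
        simp [deckMap] at this ⊢
        linarith
      · have := hm 1
        simp [deckMap] at this ⊢
        linarith
      · simp [deckMap]; linarith
  rw [e]
  refine LocallyFinite.isClosed_iUnion ?_ fun k ↦ ?_
  · have h1 : LocallyFinite fun k : ℤ ↦ ({(k : ℝ)} : Set ℝ) := by
      intro x
      refine ⟨Metric.ball x (1 / 2), Metric.ball_mem_nhds x (by norm_num), ?_⟩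
      refine Set.Subsingleton.finite fun k hk k' hk' ↦ ?_
      obtain ⟨-, rfl, h1⟩ := hk
      obtain ⟨-, rfl, h2⟩ := hk'
      rw [Metric.mem_ball, Real.dist_eq, abs_lt] at h1 h2
      have e1 : ((k - k' : ℤ) : ℝ) < 1 := by push_cast; linarith
      have e2 : (-1 : ℝ) < ((k - k' : ℤ) : ℝ) := by push_cast; linarith
      norm_cast at e1 e2
      omega
    have hc : Continuous fun z : EuclideanSpace ℝ (Fin 3) × EuclideanSpace ℝ (Fin 3) ↦
      z.2 2 - z.1 2 := by fun_prop
    exact (h1.preimage_continuous hc).subset fun k ↦ Set.inter_subset_left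
  · refine IsClosed.inter (isClosed_singleton.preimage (by fun_prop)) (isClosed_iInter fun i ↦ ?_)
    refine Int.isClosedEmbedding_coe_real.isClosed_range.preimage ?_
    have := (contDiff_deckMap (A := A) k 0).continuous
    fun_prop

theorem t2Space_of_deck (hq : IsOpenQuotientMap q)
    (h : ∀ x y, q x = q y ↔ ∃ (k : ℤ) (m : Fin 2 → ℤ), deckMap A k m x = y) : T2Space M := by
  rw [t2Space_iff_of_isOpenQuotientMap hq]
  simp only [h]
  exact isClosed_deckRel

end Deck

section TorusBundleProjection

variable {M : Type*} [TopologicalSpace M] [ChartedSpace (EuclideanSpace ℝ (Fin 3)) M]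
  {A : SL(2, ℤ)} {q : EuclideanSpace ℝ (Fin 3) → M}

theorem IsTorusBundleProjection.eq_iff_deck (hq : IsTorusBundleProjection A q)
    (x y : EuclideanSpace ℝ (Fin 3)) :
    q x = q y ↔ ∃ (k : ℤ) (m : Fin 2 → ℤ), deckMap A k m x = y := by
  rw [hq.eq_iff]
  simp only [eq_deckMap_iff]

theorem IsTorusBundleProjection.isOpenQuotientMap (hq : IsTorusBundleProjection A q) :
    IsOpenQuotientMap q :=
  ⟨hq.surjective, hq.isLocalDiffeomorph.isLocalHomeomorph.continuous,
    hq.isLocalDiffeomorph.isLocalHomeomorph.isOpenMap⟩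

theorem IsTorusBundleProjection.isCoveringMap (hq : IsTorusBundleProjection A q) :
    IsCoveringMap q :=
  (isQuotientCoveringMap_deckGroup hq.isOpenQuotientMap.isQuotientMap
    hq.eq_iff_deck).isCoveringMap

theorem IsTorusBundleProjection.t2Space (hq : IsTorusBundleProjection A q) : T2Space M :=
  t2Space_of_deck hq.isOpenQuotientMap hq.eq_iff_deck

theorem IsTorusBundleProjection.map_deckMap (hq : IsTorusBundleProjection A q) (k : ℤ)
    (m : Fin 2 → ℤ) (x : EuclideanSpace ℝ (Fin 3)) : q (deckMap A k m x) = q x :=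
  ((hq.eq_iff_deck _ _).2 ⟨k, m, rfl⟩).symm

end TorusBundleProjection

/-! ### The mapping torus as a smooth quotient of `ℝ³` -/

section SmoothStructure

/-- The quotient of `ℝ³` by a group of diffeomorphisms acting as on a covering is a smooth
manifold. -/
theorem exists_smooth_structure {M : Type*} [TopologicalSpace M] {q : EuclideanSpace ℝ (Fin 3) → M}
    (hs : Function.Surjective q) (hq : IsLocalHomeomorph q)
    (hD : ∀ x y, q x = q y → ∃ γ : EuclideanSpace ℝ (Fin 3) → EuclideanSpace ℝ (Fin 3),
      ContDiff ℝ ∞ γ ∧ γ x = y ∧ ∀ z, q (γ z) = q z) :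
    ∃ (_ : ChartedSpace (EuclideanSpace ℝ (Fin 3)) M) (_ : IsManifold (𝓡 3) ∞ M),
      IsLocalDiffeomorph (𝓡 3) (𝓡 3) ∞ q := by
  choose e he hqe using hq
  let C : ChartedSpace (EuclideanSpace ℝ (Fin 3)) M :=
    -- Charts are the local inverses of `q`. A change of charts then coincides locally with one of
    -- the smooth maps of `hD`.
    { atlas := {φ | ⇑φ.symm = q}
      chartAt := fun y ↦ (e (Function.surjInv hs y)).symm
      mem_chart_source := fun y ↦ by
        have := (e (Function.surjInv hs y)).map_source (he _)
        rwa [← hqe, Function.surjInv_eq hs y] at this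
      chart_mem_atlas := fun y ↦ (hqe _).symm }
  have hM : IsManifold (𝓡 3) ∞ M := by
    refine isManifold_of_contDiffOn (𝓡 3) ∞ M ?_
    intro φ φ' hφ hφ'
    have hφ : ⇑φ.symm = q := hφ
    have hφ' : ⇑φ'.symm = q := hφ'
    rintro x ⟨hx, -⟩
    have hx : x ∈ (φ.symm ≫ₕ φ').source := hx
    rw [OpenPartialHomeomorph.trans_source] at hx
    obtain ⟨hx1, hx2⟩ := hx
    rw [Set.mem_preimage, hφ] at hx2
    obtain ⟨γ, hγ, hγx, hqγ⟩ := hD x (φ' (q x)) (by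
      have := φ'.left_inv hx2
      rw [hφ'] at this; exact this.symm)
    refine ContDiffAt.contDiffWithinAt ?_
    refine hγ.contDiffAt.congr_of_eventuallyEq ?_
    have h1 : ∀ᶠ z in 𝓝 x, γ z ∈ φ'.target := hγ.continuous.continuousAt.eventually
      (φ'.open_target.mem_nhds (by rw [hγx]; exact φ'.map_source hx2))
    filter_upwards [h1] with z hz
    change φ' (φ.symm z) = γ z
    rw [hφ, ← hqγ, ← hφ', φ'.right_inv hz]
  refine ⟨C, hM, fun x ↦ ?_⟩
  have hmem : (e x).symm ∈ IsManifold.maximalAtlas (𝓡 3) ∞ M :=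
    IsManifold.subset_maximalAtlas (show (e x).symm ∈ atlas _ M from (hqe x).symm)
  refine ⟨⟨(e x).toPartialEquiv, (e x).open_source, (e x).open_target,
    contMDiffOn_symm_of_mem_maximalAtlas hmem, contMDiffOn_of_mem_maximalAtlas hmem⟩, he x,
    fun z _ ↦ ?_⟩
  rw [hqe x]; rfl

variable (A : SL(2, ℤ))

/-- The orbit relation of the group of the maps `(x, t) ↦ (A ^ k x + m, t + k)`. -/
def deckSetoid : Setoid (EuclideanSpace ℝ (Fin 3)) where
  r x y := ∃ (k : ℤ) (m : Fin 2 → ℤ), deckMap A k m x = y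
  iseqv :=
    { refl := fun x ↦ ⟨0, 0, deckMap_zero x⟩
      symm := by
        rintro x y ⟨k, m, rfl⟩
        exact ⟨_, _, deckMap_neg_left k m x⟩
      trans := by
        rintro x y z ⟨k, m, rfl⟩ ⟨k', m', rfl⟩
        exact ⟨_, _, (deckMap_deckMap k' k m' m x).symm⟩ }

theorem deckSetoid_eq_iff (x y : EuclideanSpace ℝ (Fin 3)) :
    Quotient.mk (deckSetoid A) x = Quotient.mk (deckSetoid A) y ↔
      ∃ (k : ℤ) (m : Fin 2 → ℤ), deckMap A k m x = y := Quotient.eq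

variable {A} in
/-- The effect of a deck transformation on the fundamental domain `[0, 1] × ℝ²`. -/
theorem torusBundle_sound {t t' : Set.Icc (0 : ℝ) 1} {x x' : Fin 2 → ℝ} {k : ℤ} {m : Fin 2 → ℤ}
    (hk : 0 ≤ k) (h : deckMap A k m !₂[x 0, x 1, (t : ℝ)] = !₂[x' 0, x' 1, (t' : ℝ)]) :
    (Quot.mk _ (t, fun i ↦ (x i : UnitAddCircle)) : TorusBundle A) =
      Quot.mk _ (t', fun i ↦ (x' i : UnitAddCircle)) := by
  have h0 := congrArg (fun v : EuclideanSpace ℝ (Fin 3) ↦ v 0) h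
  have h1 := congrArg (fun v : EuclideanSpace ℝ (Fin 3) ↦ v 1) h
  have h2 := congrArg (fun v : EuclideanSpace ℝ (Fin 3) ↦ v 2) h
  simp [deckMap] at h0 h1 h2
  have hint : ∀ m : ℤ, ((m : ℝ) : UnitAddCircle) = 0 := fun m ↦ by
    rw [AddCircle.coe_eq_zero_iff]; exact ⟨m, by simp⟩
  obtain ⟨ht0, ht1⟩ := t.2
  obtain ⟨ht0', ht1'⟩ := t'.2
  -- Both heights lie in `[0, 1]`. So `k = 0`, a lattice translation at fixed height, or `k = 1`,
  -- the gluing of height `0` to height `1`.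
  have hk1 : (k : ℝ) ≤ 1 := by linarith
  norm_cast at hk1
  obtain rfl | rfl : k = 0 ∨ k = 1 := by omega
  · simp at h0 h1 h2
    have e : t = t' := Subtype.ext h2
    have e2 : (fun i ↦ (x i : UnitAddCircle)) = fun i ↦ (x' i : UnitAddCircle) := by
      refine funext (Fin.forall_fin_two.2 ⟨?_, ?_⟩)
      · rw [← h0, AddCircle.coe_add, hint, add_zero]
      · rw [← h1, AddCircle.coe_add, hint, add_zero]
    rw [e, e2]
  · refine Quot.sound ⟨Subtype.ext ?_, Subtype.ext ?_, ?_⟩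
    · change (t : ℝ) = 0
      simp at h2; linarith
    · change (t' : ℝ) = 1
      simp at h2; linarith
    · have hz : ∀ (m : ℤ) (y : ℝ), ((m * y : ℝ) : UnitAddCircle) = m • (y : UnitAddCircle) :=
        fun m y ↦ by rw [← zsmul_eq_mul]; rfl
      rw [zpow_one] at h0 h1
      refine funext (Fin.forall_fin_two.2 ⟨?_, ?_⟩)
      · simp only [torusAutomorphism, Fin.sum_univ_two]
        rw [← h0, AddCircle.coe_add, AddCircle.coe_add, hint, add_zero, hz, hz]
      · simp only [torusAutomorphism, Fin.sum_univ_two]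
        rw [← h1, AddCircle.coe_add, AddCircle.coe_add, hint, add_zero, hz, hz]

theorem isOpenQuotientMap_deckSetoid : IsOpenQuotientMap (Quotient.mk (deckSetoid A)) :=
  (isQuotientCoveringMap_deckGroup (A := A) isQuotientMap_quotient_mk'
    (deckSetoid_eq_iff A)).isOpenQuotientMap

/-- The mapping torus is homeomorphic to the quotient of `ℝ³`. -/
theorem nonempty_homeomorph_torusBundle :
    Nonempty (TorusBundle A ≃ₜ Quotient (deckSetoid A)) := by
  have : T2Space (Quotient (deckSetoid A)) :=
    t2Space_of_deck (isOpenQuotientMap_deckSetoid A) (deckSetoid_eq_iff A)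
  let ρ : Set.Icc (0 : ℝ) 1 × (Fin 2 → ℝ) → Set.Icc (0 : ℝ) 1 × (Fin 2 → UnitAddCircle) :=
    Prod.map id (Pi.map fun _ : Fin 2 ↦ fun x : ℝ ↦ (x : UnitAddCircle))
  have hρ : IsOpenQuotientMap ρ := IsOpenQuotientMap.id.prodMap
    (IsOpenQuotientMap.piMap fun _ ↦ QuotientAddGroup.isOpenQuotientMap_mk)
  let pt : Set.Icc (0 : ℝ) 1 × (Fin 2 → ℝ) → EuclideanSpace ℝ (Fin 3) :=
    fun w ↦ !₂[w.2 0, w.2 1, (w.1 : ℝ)]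
  have hpt : Continuous pt := by
    refine (PiLp.continuous_toLp 2 _).comp (continuous_pi fun i ↦ ?_)
    fin_cases i <;> simp <;> fun_prop
  let f : Set.Icc (0 : ℝ) 1 × (Fin 2 → UnitAddCircle) → Quotient (deckSetoid A) :=
    fun z ↦ Quotient.mk _ (pt (Function.surjInv hρ.surjective z))
  have hf : ∀ w, f (ρ w) = Quotient.mk _ (pt w) := by
    intro w
    have e := Function.surjInv_eq hρ.surjective (ρ w)
    set w' := Function.surjInv hρ.surjective (ρ w) with hw'
    change Quotient.mk (deckSetoid A) (pt w') = _
    rw [deckSetoid_eq_iff]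
    have e1 : w'.1 = w.1 := congrArg (fun z ↦ z.1) e
    have e2 : ∀ i, ∃ m : ℤ, w'.2 i + m = w.2 i := by
      intro i
      have : ((w'.2 i : ℝ) : UnitAddCircle) = (w.2 i : ℝ) := congrFun (congrArg (fun z ↦ z.2) e) i
      rw [← sub_eq_zero, ← AddCircle.coe_sub, AddCircle.coe_eq_zero_iff] at this
      obtain ⟨m, hm⟩ := this
      exact ⟨-m, by simp at hm; push_cast; linarith⟩
    choose m hm using e2
    refine ⟨0, m, ?_⟩
    apply euclidean_ext <;> simp [deckMap, pt, e1, hm]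
  have hfc : Continuous f := by
    rw [← hρ.continuous_comp_iff]
    rw [show f ∘ ρ = fun w ↦ Quotient.mk _ (pt w) from funext hf]
    exact (isOpenQuotientMap_deckSetoid A).continuous.comp hpt
  have hfr : ∀ z z' : Set.Icc (0 : ℝ) 1 × (Fin 2 → UnitAddCircle),
      (z.1 = 0 ∧ z'.1 = 1 ∧ z'.2 = torusAutomorphism A z.2) → f z = f z' := by
    rintro z z' ⟨h0, h1, h2⟩
    obtain ⟨⟨t, x⟩, rfl⟩ := hρ.surjective z
    have h0 : t = 0 := h0
    subst h0
    have e : z' = ρ (1, fun i ↦ ∑ j, (A i j : ℝ) * x j) := by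
      refine Prod.ext h1 (h2.trans ?_)
      funext i
      simp only [torusAutomorphism, ρ, Prod.map, Pi.map, Fin.sum_univ_two]
      rw [AddCircle.coe_add, ← zsmul_eq_mul, ← zsmul_eq_mul]
      rfl
    rw [e, hf, hf, deckSetoid_eq_iff]
    refine ⟨1, 0, ?_⟩
    apply euclidean_ext <;> simp [deckMap, pt, Fin.sum_univ_two]
  let F : TorusBundle A → Quotient (deckSetoid A) := Quot.lift f hfr
  have hF : Continuous F := continuous_quot_lift hfr hfc
  have hFb : Function.Bijective F := by
    constructor
    · intro z z' h
      obtain ⟨z, rfl⟩ := Quot.exists_rep z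
      obtain ⟨z', rfl⟩ := Quot.exists_rep z'
      obtain ⟨⟨t, x⟩, rfl⟩ := hρ.surjective z
      obtain ⟨⟨t', x'⟩, rfl⟩ := hρ.surjective z'
      have h : f (ρ (t, x)) = f (ρ (t', x')) := h
      rw [hf, hf, deckSetoid_eq_iff] at h
      obtain ⟨k, m, h⟩ := h
      rcases le_or_gt 0 k with hk | hk
      · exact torusBundle_sound hk h
      · have h' := deckMap_neg_left (A := A) k m (pt (t, x))
        rw [h] at h'
        exact (torusBundle_sound (by omega) h').symm
    · intro y
      obtain ⟨x, rfl⟩ := (isOpenQuotientMap_deckSetoid A).surjective y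
      let y := deckMap A (-⌊x 2⌋) 0 x
      refine ⟨Quot.mk _ (ρ (⟨Int.fract (x 2), Int.fract_nonneg _, (Int.fract_lt_one _).le⟩,
        ![y 0, y 1])), ?_⟩
      change f (ρ _) = _
      rw [hf, eq_comm, deckSetoid_eq_iff]
      refine ⟨-⌊x 2⌋, 0, ?_⟩
      apply euclidean_ext
      · simp [pt, y]
      · simp [pt, y]
      · simp [pt, deckMap, ← sub_eq_add_neg]
  exact ⟨Continuous.homeoOfEquivCompactToT2 (f := Equiv.ofBijective F hFb) hF⟩

/-- A space homeomorphic to the mapping torus carries the smooth structure of the quotient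
of `ℝ³`. -/
theorem exists_isTorusBundleProjection {M : Type*} [TopologicalSpace M]
    (h : Nonempty (M ≃ₜ TorusBundle A)) :
    ∃ (_ : ChartedSpace (EuclideanSpace ℝ (Fin 3)) M) (_ : IsManifold (𝓡 3) ∞ M),
      ∃ q : EuclideanSpace ℝ (Fin 3) → M, IsTorusBundleProjection A q := by
  obtain ⟨Φ⟩ := h
  obtain ⟨Ψ⟩ := nonempty_homeomorph_torusBundle A
  let Θ := Ψ.symm.trans Φ.symm
  let q : EuclideanSpace ℝ (Fin 3) → M := fun x ↦ Θ (Quotient.mk _ x)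
  have hq : ∀ x y, q x = q y ↔ ∃ (k : ℤ) (m : Fin 2 → ℤ), deckMap A k m x = y := fun x y ↦ by
    rw [← deckSetoid_eq_iff]; exact Θ.injective.eq_iff
  have hqq : Topology.IsQuotientMap q :=
    Θ.isQuotientMap.comp (isOpenQuotientMap_deckSetoid A).isQuotientMap
  have hc := (isQuotientCoveringMap_deckGroup hqq hq).isCoveringMap
  obtain ⟨C, hM, hl⟩ := exists_smooth_structure hqq.surjective hc.isLocalHomeomorph
    (fun x y hxy ↦ by
      obtain ⟨k, m, rfl⟩ := (hq x y).1 hxy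
      exact ⟨_, contDiff_deckMap k m, rfl, fun z ↦ ((hq _ _).2 ⟨k, m, rfl⟩).symm⟩)
  refine ⟨C, hM, q, hqq.surjective, hl, fun x y ↦ ?_⟩
  rw [hq]
  simp only [eq_deckMap_iff]

end SmoothStructure

/-! ### Affine maps, integer-valued functions, changes of coordinates -/

section Tools

/-- The derivative of an affine map. -/
theorem fderiv_of_affine {E : Type*} [NormedAddCommGroup E] [NormedSpace ℝ E] {F : E → E} {x : E}
    (hF : DifferentiableAt ℝ F x) {D : E → E}
    (h : ∀ (v : E) (s : ℝ), F (x + s • v) = F x + s • D v) (v : E) : fderiv ℝ F x v = D v := by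
  rw [← hF.lineDeriv_eq_fderiv]
  have h1 : HasDerivAt (fun s : ℝ ↦ F x + s • D v) (D v) 0 := by
    simpa using ((hasDerivAt_id (0 : ℝ)).smul_const (D v)).const_add (F x)
  rw [← funext (h v)] at h1
  exact h1.deriv

theorem exists_int_of_coe_eq {x y : ℝ} (h : (x : UnitAddCircle) = y) : ∃ m : ℤ, x = y + m := by
  rw [← sub_eq_zero, ← AddCircle.coe_sub, AddCircle.coe_eq_zero_iff] at h
  obtain ⟨m, hm⟩ := h
  exact ⟨m, by simp at hm; linarith⟩

theorem coe_add_int (x : ℝ) (m : ℤ) : ((x + m : ℝ) : UnitAddCircle) = x := by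
  rw [AddCircle.coe_add, add_eq_left, AddCircle.coe_eq_zero_iff]
  exact ⟨m, by simp⟩

/-- A linear function with integer values vanishes. -/
theorem eq_zero_of_forall_int {α c : ℝ} (h : ∀ s : ℝ, ∃ m : ℤ, α * s + c = m) : α = 0 := by
  by_contra hα
  obtain ⟨m, hm⟩ := h 0
  -- Moving `s` by this amount changes the value by one half.
  obtain ⟨m', hm'⟩ := h (1 / (2 * α))
  have e : α * (1 / (2 * α)) = 1 / 2 := by field_simp
  have e2 : (2 * (m' - m) : ℝ) = 1 := by rw [← hm, ← hm', e]; ring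
  norm_cast at e2
  omega

variable {M : Type*} [TopologicalSpace M] [ChartedSpace (EuclideanSpace ℝ (Fin 3)) M]

theorem IsTorusBundleProjection.comp_diffeo {A : SL(2, ℤ)} {q : EuclideanSpace ℝ (Fin 3) → M}
    (hq : IsTorusBundleProjection A q) {Φ Ψ : EuclideanSpace ℝ (Fin 3) → EuclideanSpace ℝ (Fin 3)}
    (hΦ : ContDiff ℝ ∞ Φ) (hΨ : ContDiff ℝ ∞ Ψ) (h : ∀ x, Φ (Ψ x) = x) (h' : ∀ x, Ψ (Φ x) = x) :
    Function.Surjective (q ∘ Φ) ∧ IsLocalDiffeomorph (𝓡 3) (𝓡 3) ∞ (q ∘ Φ) ∧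
      IsCoveringMap (q ∘ Φ) := by
  let e : EuclideanSpace ℝ (Fin 3) ≃ₘ^∞⟮𝓡 3, 𝓡 3⟯ EuclideanSpace ℝ (Fin 3) :=
    { toFun := Φ
      invFun := Ψ
      left_inv := h'
      right_inv := h
      contMDiff_toFun := hΦ.contMDiff
      contMDiff_invFun := hΨ.contMDiff }
  refine ⟨hq.surjective.comp fun x ↦ ⟨Ψ x, h x⟩, fun x ↦ ?_, ?_⟩
  · exact (e.isLocalDiffeomorph x).comp _ _ (hq.isLocalDiffeomorph (Φ x))
  · exact hq.isCoveringMap.comp_homeomorph e.toHomeomorph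

/-- A local diffeomorphism separates a point from nearby ones. -/
theorem exists_ne_of_isLocalDiffeomorph {p : EuclideanSpace ℝ (Fin 3) → M}
    (hp : IsLocalDiffeomorph (𝓡 3) (𝓡 3) ∞ p) {v : EuclideanSpace ℝ (Fin 3)} (hv : v ≠ 0) :
    ∃ δ : ℝ, δ ≠ 0 ∧ p 0 ≠ p (δ • v) := by
  obtain ⟨Φ, h0, hΦ⟩ := hp 0
  have h1 : ∀ᶠ δ in 𝓝 (0 : ℝ), δ • v ∈ Φ.source := by
    have : Continuous fun δ : ℝ ↦ δ • v := by fun_prop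
    exact this.continuousAt.eventually (Φ.open_source.mem_nhds (by simpa using h0))
  have h2 : ∀ᶠ δ in 𝓝[>] (0 : ℝ), δ • v ∈ Φ.source := nhdsWithin_le_nhds h1
  obtain ⟨δ, hδ, hδ0⟩ := (h2.and self_mem_nhdsWithin).exists
  refine ⟨δ, ne_of_gt hδ0, fun h ↦ ?_⟩
  rw [hΦ h0, hΦ hδ] at h
  have := Φ.injOn h0 hδ h
  exact smul_ne_zero (ne_of_gt hδ0) hv this.symm

end Tools

/-! ### Coordinates that diagonalize the monodromy -/

section Diagonal

variable {A B : SL(2, ℤ)} {P : Matrix (Fin 2) (Fin 2) ℝ} {l : ℝ}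

theorem zpow_eigenvector (A : SL(2, ℤ)) {v : Fin 2 → ℝ} {μ : ℝ} (hμ : μ ≠ 0)
    (h : ∀ i, (A i 0 : ℝ) * v 0 + (A i 1 : ℝ) * v 1 = μ * v i) (k : ℤ) (i : Fin 2) :
    ((A ^ k) i 0 : ℝ) * v 0 + ((A ^ k) i 1 : ℝ) * v 1 = μ ^ k * v i := by
  have hsucc : ∀ (k : ℤ) (i : Fin 2), ((A ^ (k + 1)) i 0 : ℝ) * v 0 + ((A ^ (k + 1)) i 1 : ℝ) * v 1
      = μ * (((A ^ k) i 0 : ℝ) * v 0 + ((A ^ k) i 1 : ℝ) * v 1) := by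
    intro k i
    have h0 := h 0
    have h1 := h 1
    have e : ∀ j, ((A ^ (k + 1)) i j : ℝ) = (A ^ k) i 0 * A 0 j + (A ^ k) i 1 * A 1 j := by
      intro j
      rw [zpow_add_one, Matrix.SpecialLinearGroup.coe_mul, Matrix.mul_apply, Fin.sum_univ_two]
      push_cast; ring
    rw [e, e]
    linear_combination ((A ^ k) i 0 : ℝ) * h0 + ((A ^ k) i 1 : ℝ) * h1
  induction k using Int.induction_on generalizing i with
  | zero => fin_cases i <;> simp
  | succ k ih => rw [hsucc, ih, zpow_add_one₀ hμ]; ring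
  | pred k ih =>
    have h1 := hsucc (-k - 1) i
    rw [sub_add_cancel, ih] at h1
    rw [zpow_sub_one₀ hμ]
    field_simp
    linear_combination -h1

theorem Diagonalizes.apply (h : Diagonalizes A P l) (i : Fin 2) :
    (A i 0 : ℝ) * P 0 0 + (A i 1 : ℝ) * P 1 0 = l * P i 0 ∧
      (A i 0 : ℝ) * P 0 1 + (A i 1 : ℝ) * P 1 1 = l⁻¹ * P i 1 := by
  have h2 := h.2
  have e0 := congrArg (fun N : Matrix (Fin 2) (Fin 2) ℝ ↦ N i 0) h2
  have e1 := congrArg (fun N : Matrix (Fin 2) (Fin 2) ℝ ↦ N i 1) h2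
  simp [Matrix.mul_apply, Fin.sum_univ_two, Matrix.diagonal] at e0 e1
  exact ⟨by linarith, by linarith⟩

/-- As `0⁻¹ = 0`, for `l = 0` the diagonal matrix would be zero, while `A` and `P` are invertible.
-/
theorem Diagonalizes.ne_zero (h : Diagonalizes A P l) : l ≠ 0 := by
  rintro rfl
  have h2 := congrArg Matrix.det h.2
  rw [Matrix.det_mul, Matrix.det_mul, Matrix.det_diagonal] at h2
  simp at h2
  rcases h2 with h2 | h2
  · have h3 := A.2
    rw [Matrix.det_fin_two] at h2 h3
    simp at h2
    have h4 : ((A 0 0 * A 1 1 - A 0 1 * A 1 0 : ℤ) : ℝ) = 0 := by push_cast; linarith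
    norm_cast at h4
    omega
  · exact h.1 h2

theorem Diagonalizes.zpow_apply (h : Diagonalizes A P l) (k : ℤ) (i : Fin 2) :
    ((A ^ k) i 0 : ℝ) * P 0 0 + ((A ^ k) i 1 : ℝ) * P 1 0 = l ^ k * P i 0 ∧
      ((A ^ k) i 0 : ℝ) * P 0 1 + ((A ^ k) i 1 : ℝ) * P 1 1 = (l ^ k)⁻¹ * P i 1 := by
  refine ⟨zpow_eigenvector A h.ne_zero (v := fun i ↦ P i 0) (fun i ↦ (h.apply i).1) k i, ?_⟩
  rw [← inv_zpow]
  exact zpow_eigenvector A (inv_ne_zero h.ne_zero) (v := fun i ↦ P i 1) (fun i ↦ (h.apply i).2) k i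

theorem Diagonalizes.trace_eq (h : Diagonalizes A P l) :
    ((A : Matrix (Fin 2) (Fin 2) ℤ).trace : ℝ) = l + l⁻¹ := by
  have hd := h.1
  rw [Matrix.det_fin_two] at hd
  have e0 := h.apply 0
  have e1 := h.apply 1
  rw [Matrix.trace_fin_two]
  push_cast
  refine mul_left_cancel₀ hd ?_
  linear_combination P 1 1 * e0.1 - P 0 1 * e1.1 + P 0 0 * e1.2 - P 1 0 * e0.2

theorem planeChange_add (P : Matrix (Fin 2) (Fin 2) ℝ) (x y : EuclideanSpace ℝ (Fin 3)) :
    planeChange P (x + y) = planeChange P x + planeChange P y := by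
  apply euclidean_ext <;> simp [planeChange] <;> ring

theorem planeChange_smul (P : Matrix (Fin 2) (Fin 2) ℝ) (c : ℝ) (x : EuclideanSpace ℝ (Fin 3)) :
    planeChange P (c • x) = c • planeChange P x := by
  apply euclidean_ext <;> simp [planeChange] <;> ring

theorem contDiff_planeChange (P : Matrix (Fin 2) (Fin 2) ℝ) : ContDiff ℝ ∞ (planeChange P) := by
  rw [contDiff_euclidean]
  intro i
  fin_cases i <;> simp [planeChange] <;> fun_prop

theorem planeChange_planeChange (P Q : Matrix (Fin 2) (Fin 2) ℝ) (x : EuclideanSpace ℝ (Fin 3)) :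
    planeChange P (planeChange Q x) = planeChange (P * Q) x := by
  apply euclidean_ext <;> simp [planeChange, Matrix.mul_apply, Fin.sum_univ_two] <;> ring

theorem planeChange_one (x : EuclideanSpace ℝ (Fin 3)) : planeChange 1 x = x := by
  apply euclidean_ext <;> simp [planeChange]

theorem planeChange_inv (hP : P.det ≠ 0) (x : EuclideanSpace ℝ (Fin 3)) :
    planeChange P (planeChange P⁻¹ x) = x ∧ planeChange P⁻¹ (planeChange P x) = x := by
  rw [planeChange_planeChange, planeChange_planeChange,
    Matrix.mul_nonsing_inv _ (isUnit_iff_ne_zero.2 hP),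
    Matrix.nonsing_inv_mul _ (isUnit_iff_ne_zero.2 hP), planeChange_one]
  exact ⟨rfl, rfl⟩

/-- The affine map `(u, v, t) ↦ (α u, α⁻¹ v, t) + c`. -/
noncomputable def boostMap (α : ℝ) (c x : EuclideanSpace ℝ (Fin 3)) : EuclideanSpace ℝ (Fin 3) :=
  !₂[α * x 0 + c 0, α⁻¹ * x 1 + c 1, x 2 + c 2]

theorem contDiff_boostMap (α : ℝ) (c : EuclideanSpace ℝ (Fin 3)) :
    ContDiff ℝ ∞ (boostMap α c) := by
  rw [contDiff_euclidean]
  intro i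
  fin_cases i <;> simp [boostMap] <;> fun_prop

theorem fderiv_boostMap (α : ℝ) (c x v : EuclideanSpace ℝ (Fin 3)) :
    fderiv ℝ (boostMap α c) x v = !₂[α * v 0, α⁻¹ * v 1, v 2] :=
  fderiv_of_affine (D := fun v ↦ !₂[α * v 0, α⁻¹ * v 1, v 2])
    ((contDiff_boostMap α c).differentiable (by simp) x)
    (fun v s ↦ by apply euclidean_ext <;> simp [boostMap] <;> ring) v

theorem hyperbolicForm_boostMap (a : PeriodicProfile) {α : ℝ} (hα : α ≠ 0)
    (c x v w : EuclideanSpace ℝ (Fin 3)) (k : ℤ) (hc : c 2 = k) :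
    hyperbolicForm a (boostMap α c x) (fderiv ℝ (boostMap α c) x v)
      (fderiv ℝ (boostMap α c) x w) = hyperbolicForm a x v w := by
  rw [fderiv_boostMap, fderiv_boostMap]
  have h : a.1 (x 2 + k) = a.1 (x 2) := by simpa using a.periodic.int_mul k (x 2)
  simp only [hyperbolicForm, boostMap, PiLp.toLp_apply, Matrix.cons_val, hc, h]
  field_simp

/-- In the coordinates that diagonalize `A`, the deck transformations are boosts. -/
theorem Diagonalizes.deckMap_planeChange (h : Diagonalizes A P l) (k : ℤ) (m : Fin 2 → ℤ)
    (x : EuclideanSpace ℝ (Fin 3)) :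
    deckMap A k m (planeChange P x) =
      planeChange P (boostMap (l ^ k) (planeChange P⁻¹ !₂[(m 0 : ℝ), (m 1 : ℝ), (k : ℝ)]) x) := by
  have e : boostMap (l ^ k) (planeChange P⁻¹ !₂[(m 0 : ℝ), (m 1 : ℝ), (k : ℝ)]) x =
      !₂[l ^ k * x 0, (l ^ k)⁻¹ * x 1, x 2] + planeChange P⁻¹ !₂[(m 0 : ℝ), (m 1 : ℝ), (k : ℝ)] := by
    apply euclidean_ext <;> simp [boostMap]
  rw [e, planeChange_add, (planeChange_inv h.1 _).1]
  have e0 := h.zpow_apply k 0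
  have e1 := h.zpow_apply k 1
  apply euclidean_ext
  · simp [deckMap, planeChange]
    linear_combination x 0 * e0.1 + x 1 * e0.2
  · simp [deckMap, planeChange]
    linear_combination x 0 * e1.1 + x 1 * e1.2
  · simp [deckMap, planeChange]

/-- The linear map `(x, t) ↦ (B ^ k x, t)`. -/
noncomputable def planeMap (B : SL(2, ℤ)) (k : ℤ) (x : EuclideanSpace ℝ (Fin 3)) :
    EuclideanSpace ℝ (Fin 3) :=
  !₂[((B ^ k) 0 0 : ℝ) * x 0 + ((B ^ k) 0 1 : ℝ) * x 1,
    ((B ^ k) 1 0 : ℝ) * x 0 + ((B ^ k) 1 1 : ℝ) * x 1, x 2]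

/-- Powers of `B` normalize the deck group because they commute with `A` and preserve `ℤ²`. This is
why the corresponding boosts descend. -/
theorem planeMap_deckMap (hAB : Commute A B) (n k : ℤ) (m : Fin 2 → ℤ)
    (x : EuclideanSpace ℝ (Fin 3)) : planeMap B n (deckMap A k m x) =
      deckMap A k (fun i ↦ ∑ j, (B ^ n) i j * m j) (planeMap B n x) := by
  have h : ∀ i j, ((A ^ k) i 0 : ℝ) * (B ^ n) 0 j + (A ^ k) i 1 * (B ^ n) 1 j =
      (B ^ n) i 0 * (A ^ k) 0 j + (B ^ n) i 1 * (A ^ k) 1 j := by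
    intro i j
    have e := congrArg (fun C : SL(2, ℤ) ↦ (C : Matrix (Fin 2) (Fin 2) ℤ) i j)
      ((hAB.zpow_zpow k n).eq)
    simp only [Matrix.SpecialLinearGroup.coe_mul, Matrix.mul_apply, Fin.sum_univ_two] at e
    exact_mod_cast e
  have h00 := h 0 0
  have h01 := h 0 1
  have h10 := h 1 0
  have h11 := h 1 1
  apply euclidean_ext
  · simp [planeMap, deckMap, Fin.sum_univ_two]
    linear_combination (-x 0) * h00 - x 1 * h01
  · simp [planeMap, deckMap, Fin.sum_univ_two]
    linear_combination (-x 0) * h10 - x 1 * h11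
  · simp [planeMap, deckMap]

theorem Diagonalizes.planeMap_planeChange (h : Diagonalizes B P l) (n : ℤ)
    (x : EuclideanSpace ℝ (Fin 3)) :
    planeMap B n (planeChange P x) = planeChange P (boostMap (l ^ n) 0 x) := by
  have e0 := h.zpow_apply n 0
  have e1 := h.zpow_apply n 1
  apply euclidean_ext
  · simp [planeMap, planeChange, boostMap]
    linear_combination x 0 * e0.1 + x 1 * e0.2
  · simp [planeMap, planeChange, boostMap]
    linear_combination x 0 * e1.1 + x 1 * e1.2
  · simp [planeMap, planeChange, boostMap]

end Diagonal

/-! ### Identity component for metrics of the `3`-torus -/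

section Torus

variable {M : Type*} [TopologicalSpace M] [ChartedSpace (EuclideanSpace ℝ (Fin 3)) M]
  {q : EuclideanSpace ℝ (Fin 3) → M}

theorem IsTorusBundleProjection.eq_iff_int (hq : IsTorusBundleProjection 1 q)
    (x y : EuclideanSpace ℝ (Fin 3)) : q x = q y ↔ ∀ i, ∃ m : ℤ, y i = x i + m := by
  rw [hq.eq_iff_deck]
  constructor
  · rintro ⟨k, m, rfl⟩ i
    fin_cases i
    · exact ⟨m 0, by simp [deckMap]⟩
    · exact ⟨m 1, by simp [deckMap]⟩
    · exact ⟨k, by simp [deckMap]⟩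
  · intro h
    choose m hm using h
    exact ⟨m 2, ![m 0, m 1], by apply euclidean_ext <;> simp [deckMap, hm]⟩

/-- The coordinate functions of the torus. -/
theorem IsTorusBundleProjection.exists_character (hq : IsTorusBundleProjection 1 q) (i : Fin 3) :
    ∃ χ : M → UnitAddCircle, Continuous χ ∧ ∀ x, χ (q x) = (x i : ℝ) := by
  have key : ∀ x, ((Function.surjInv hq.surjective (q x) i : ℝ) : UnitAddCircle) = (x i : ℝ) := by
    intro x
    obtain ⟨m, hm⟩ := (hq.eq_iff_int _ _).1 (Function.surjInv_eq hq.surjective (q x)).symm i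
    rw [hm, coe_add_int]
  refine ⟨fun y ↦ (Function.surjInv hq.surjective y i : ℝ), ?_, key⟩
  rw [hq.isOpenQuotientMap.isQuotientMap.continuous_iff]
  refine Continuous.congr ?_ fun x ↦ (key x).symm
  exact (AddCircle.continuous_mk' 1).comp (by fun_prop)

variable [IsManifold (𝓡 3) ∞ M] {g : LorentzMetric 3 M}

theorem basis_expansion (x : EuclideanSpace ℝ (Fin 3)) :
    x = x 0 • EuclideanSpace.single 0 1 + x 1 • EuclideanSpace.single 1 1 +
      x 2 • EuclideanSpace.single 2 (1 : ℝ) := by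
  apply euclidean_ext <;> simp

/-- If the isometries of a metric of the torus are affine and their translation parts in the last
direction form a countable set, the isometries of the identity component are translations. -/
theorem IsTorusBundleProjection.isCompact_identityComponent (hq : IsTorusBundleProjection 1 q)
    {C : Set ℝ} (hC : C.Countable)
    (hg : ∀ f : g.Iso, ∃ (L : EuclideanSpace ℝ (Fin 3) →L[ℝ] EuclideanSpace ℝ (Fin 3))
      (b : EuclideanSpace ℝ (Fin 3)), b 2 ∈ C ∧ ∀ x, f.1 (q x) = q (L x + b))
    (ht : ∀ b : EuclideanSpace ℝ (Fin 3), b 2 = 0 → ∃ f : g.Iso, ∀ x, f.1 (q x) = q (x + b)) :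
    IsCompact (LorentzMetric.Iso.identityComponent g) := by
  choose χ hχ hχq using hq.exists_character
  choose L b hb hf using hg
  -- A lift maps points that differ by an integral vector to such points, so linear parts have
  -- integer entries. This is the source of countability.
  have hL : ∀ (f : g.Iso) (j i : Fin 3), ∃ m : ℤ, L f (EuclideanSpace.single j 1) i = m := by
    intro f j i
    have h1 : q 0 = q (EuclideanSpace.single j 1) :=
      (hq.eq_iff_int _ _).2 fun i ↦ ⟨if i = j then 1 else 0, by simp⟩
    have h2 := congrArg f.1 h1
    rw [hf, hf, map_zero, zero_add] at h2
    obtain ⟨m, hm⟩ := (hq.eq_iff_int _ _).1 h2 i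
    refine ⟨m, ?_⟩
    simp at hm
    linarith
  choose N hN using hL
  have hLx : ∀ f x i, L f x i = x 0 * N f 0 i + x 1 * N f 1 i + x 2 * N f 2 i := by
    intro f x i
    conv_lhs => rw [basis_expansion x]
    simp [← hN]
  -- Translations in the first two directions, with parameters reduced modulo `1`; their compact set
  -- will contain the identity component.
  let φ : Set.Icc (0 : ℝ) 1 × Set.Icc (0 : ℝ) 1 → g.Iso := fun c ↦
    (ht !₂[(c.1 : ℝ), (c.2 : ℝ), 0] (by simp)).choose
  have hφ : ∀ c x, (φ c).1 (q x) = q (x + !₂[(c.1 : ℝ), (c.2 : ℝ), 0]) := fun c ↦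
    (ht !₂[(c.1 : ℝ), (c.2 : ℝ), 0] (by simp)).choose_spec
  have hφc : Continuous φ := by
    refine LorentzMetric.Iso.continuous_of_lift hq.isOpenQuotientMap
      (Φ := fun c ↦ c.2 + !₂[(c.1.1 : ℝ), (c.1.2 : ℝ), 0]) ?_ hφ
    refine continuous_snd.add ((PiLp.continuous_toLp 2 _).comp (continuous_pi fun i ↦ ?_))
    fin_cases i <;> simp <;> fun_prop
  refine LorentzMetric.isCompact_identityComponent_of_subset (isCompact_range hφc) fun f hfc ↦ ?_
  have hrefl : ∀ y, (LorentzMetric.Iso.refl g).1 y = y := fun y ↦ rfl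
  have hb2 : ∃ m : ℤ, b f 2 = m := by
    have h1 := LorentzMetric.Iso.eq_of_countable (ψ := fun f : g.Iso ↦ χ 2 (f.1 (q 0)))
      ((hχ 2).comp (LorentzMetric.Iso.continuous_eval _)) ((hC.image fun c : ℝ ↦
        (c : UnitAddCircle)).mono ?_) hfc
    · simp only [hrefl, hf, hχq] at h1
      simpa using exists_int_of_coe_eq h1
    · rintro _ ⟨f, rfl⟩
      exact ⟨b f 2, hb f, by simp [hf, hχq]⟩
  -- The difference of the values at `x` and at `0` removes the translation part, so it takes
  -- countably many values on the group. Hence `L f x - x` is integral for every real `x`, which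
  -- forces `L f = id`.
  have hid : ∀ x i, ∃ m : ℤ, L f x i = x i + m := by
    intro x i
    have h1 := LorentzMetric.Iso.eq_of_countable
      (ψ := fun f : g.Iso ↦ χ i (f.1 (q x)) - χ i (f.1 (q 0)))
      (((hχ i).comp (LorentzMetric.Iso.continuous_eval _)).sub
        ((hχ i).comp (LorentzMetric.Iso.continuous_eval _)))
      ((Set.countable_range fun n : ℤ × ℤ × ℤ ↦
        ((x 0 * n.1 + x 1 * n.2.1 + x 2 * n.2.2 : ℝ) : UnitAddCircle)).mono ?_) hfc
    · simp only [hrefl, hf, hχq, ← AddCircle.coe_sub] at h1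
      refine exists_int_of_coe_eq ?_
      simpa using h1
    · rintro _ ⟨f, rfl⟩
      refine ⟨⟨N f 0 i, N f 1 i, N f 2 i⟩, ?_⟩
      simp only [hf, hχq, ← AddCircle.coe_sub]
      rw [← hLx]
      simp
  have hLid : ∀ x, L f x = x := by
    intro x
    have hj : ∀ j i, L f (EuclideanSpace.single j 1) i =
        (EuclideanSpace.single j 1 : EuclideanSpace ℝ (Fin 3)) i := by
      intro j i
      rw [← sub_eq_zero]
      refine eq_zero_of_forall_int (c := 0) fun s ↦ ?_
      obtain ⟨m, hm⟩ := hid (s • EuclideanSpace.single j 1) i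
      refine ⟨m, ?_⟩
      simp only [map_smul, PiLp.smul_apply, smul_eq_mul] at hm
      linarith
    conv_lhs => rw [basis_expansion x]
    conv_rhs => rw [basis_expansion x]
    rw [map_add, map_add, map_smul, map_smul, map_smul]
    congr 1
    · congr 1
      · congr 1; ext i; exact hj 0 i
      · congr 1; ext i; exact hj 1 i
    · congr 1; ext i; exact hj 2 i
  refine ⟨(⟨Int.fract (b f 0), Int.fract_nonneg _, (Int.fract_lt_one _).le⟩,
    ⟨Int.fract (b f 1), Int.fract_nonneg _, (Int.fract_lt_one _).le⟩), ?_⟩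
  refine LorentzMetric.Iso.ext fun y ↦ ?_
  obtain ⟨x, rfl⟩ := hq.surjective y
  rw [hφ, hf, hLid, hq.eq_iff_int]
  intro i
  fin_cases i
  · exact ⟨⌊b f 0⌋, by simp [← Int.self_sub_floor]; ring⟩
  · exact ⟨⌊b f 1⌋, by simp [← Int.self_sub_floor]; ring⟩
  · obtain ⟨m, hm⟩ := hb2
    exact ⟨m, by simp [hm]⟩

end Torus

/-! ### Quotients of `dt² + 2 a(t) du dv` -/

section HyperbolicCase

variable {M : Type*} [TopologicalSpace M] [ChartedSpace (EuclideanSpace ℝ (Fin 3)) M]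
  {q : EuclideanSpace ℝ (Fin 3) → M} {A B : SL(2, ℤ)} {P : Matrix (Fin 2) (Fin 2) ℝ} {l l' : ℝ}
  {a : PeriodicProfile}

/-- The deck transformations of a torus bundle in the coordinates that diagonalize `A`. -/
def boostDeck (P : Matrix (Fin 2) (Fin 2) ℝ) (l : ℝ) :
    Set (EuclideanSpace ℝ (Fin 3) → EuclideanSpace ℝ (Fin 3)) :=
  {γ | ∃ (k : ℤ) (m : Fin 2 → ℤ),
    γ = boostMap (l ^ k) (planeChange P⁻¹ !₂[(m 0 : ℝ), (m 1 : ℝ), (k : ℝ)])}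

theorem IsTorusBundleProjection.planeChange_eq_iff (hq : IsTorusBundleProjection A q)
    (h : Diagonalizes A P l) (x y : EuclideanSpace ℝ (Fin 3)) :
    (q ∘ planeChange P) x = (q ∘ planeChange P) y ↔ ∃ (k : ℤ) (m : Fin 2 → ℤ),
      boostMap (l ^ k) (planeChange P⁻¹ !₂[(m 0 : ℝ), (m 1 : ℝ), (k : ℝ)]) x = y := by
  rw [Function.comp_apply, Function.comp_apply, hq.eq_iff_deck]
  simp only [h.deckMap_planeChange]
  refine exists_congr fun k ↦ exists_congr fun m ↦ ⟨fun e ↦ ?_, fun e ↦ by rw [e]⟩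
  have := congrArg (planeChange P⁻¹) e
  rwa [(planeChange_inv h.1 _).2, (planeChange_inv h.1 _).2] at this

theorem IsTorusBundleProjection.planeChange_props (hq : IsTorusBundleProjection A q)
    (hP : P.det ≠ 0) : Function.Surjective (q ∘ planeChange P) ∧
      IsLocalDiffeomorph (𝓡 3) (𝓡 3) ∞ (q ∘ planeChange P) ∧ IsCoveringMap (q ∘ planeChange P) :=
  hq.comp_diffeo (contDiff_planeChange P) (contDiff_planeChange P⁻¹)
    (fun x ↦ (planeChange_inv hP x).1) fun x ↦ (planeChange_inv hP x).2

theorem IsTorusBundleProjection.isDeckFamily (hq : IsTorusBundleProjection A q)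
    (h : Diagonalizes A P l) : IsDeckFamily (q ∘ planeChange P) (boostDeck P l) where
  surjective := (hq.planeChange_props h.1).1
  isLocalDiffeomorph := (hq.planeChange_props h.1).2.1
  differentiable := by
    rintro _ ⟨k, m, rfl⟩
    exact (contDiff_boostMap _ _).differentiable (by simp)
  map_deck := by
    rintro _ ⟨k, m, rfl⟩ x
    exact ((hq.planeChange_eq_iff h _ _).2 ⟨k, m, rfl⟩).symm
  exists_deck := by
    intro x y hxy
    obtain ⟨k, m, e⟩ := (hq.planeChange_eq_iff h _ _).1 hxy
    exact ⟨_, ⟨k, m, rfl⟩, e⟩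

theorem planeChange_apply_two (P : Matrix (Fin 2) (Fin 2) ℝ) (x : EuclideanSpace ℝ (Fin 3)) :
    planeChange P x 2 = x 2 := by simp [planeChange]

variable [IsManifold (𝓡 3) ∞ M] {g : LorentzMetric 3 M}

theorem IsTorusBundleProjection.exists_hyperbolic_metric (hq : IsTorusBundleProjection A q)
    (h : Diagonalizes A P l) (a : PeriodicProfile) :
    ∃ g : LorentzMetric 3 M, g.PullsBackTo (q ∘ planeChange P) (hyperbolicForm a) := by
  suffices h' : _ ∧ _ by
    obtain ⟨g, hg⟩ := (hq.isDeckFamily h).exists_lorentzMetric (B := hyperbolicField a)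
      (isLeviCivita_hyperbolic a).contDiff_form h'.1 (isLeviCivita_hyperbolic a).symm h'.2
    exact ⟨g, by rwa [hyperbolicForm_eq]⟩
  constructor
  · rintro _ ⟨k, m, rfl⟩ x v w
    have := hyperbolicForm_boostMap a (zpow_ne_zero k h.ne_zero)
      (planeChange P⁻¹ !₂[(m 0 : ℝ), (m 1 : ℝ), (k : ℝ)]) x v w k (by simp [planeChange_apply_two])
    rwa [hyperbolicForm_eq] at this
  · intro x
    have ha := a.pos (x 2)
    refine ⟨!₂[1, -1, 0], ?_, fun w hw hne ↦ ?_⟩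
    · rw [hyperbolicField_apply]
      simp [hyperbolicForm]
      linarith
    · rw [hyperbolicField_apply] at hw ⊢
      simp [hyperbolicForm] at hw
      have e : w 1 = w 0 := by
        rcases hw with hw | hw <;> linarith
      simp only [hyperbolicForm, e]
      by_contra hle
      have h0 : w 0 = 0 := by
        by_contra h0
        have : 0 < w 0 * w 0 := mul_self_pos.2 h0
        have := mul_pos ha this
        nlinarith [mul_self_nonneg (w 2)]
      have h2 : w 2 = 0 := by
        by_contra h2
        have : 0 < w 2 * w 2 := mul_self_pos.2 h2
        rw [h0] at hle
        linarith
      refine hne ?_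
      apply euclidean_ext <;> simp [h0, h2, e]

/-- The metrics `dt² + 2 a(t) du dv` are time-orientable if the eigenvalues of `A` are positive. -/
theorem IsTorusBundleProjection.timeOrientable (hq : IsTorusBundleProjection A q)
    (h : Diagonalizes A P l) (hg : g.PullsBackTo (q ∘ planeChange P) (hyperbolicForm a))
    (hA : 0 < (A : Matrix (Fin 2) (Fin 2) ℤ).trace) : g.TimeOrientable := by
  have hl : 0 < l := by
    have h1 : (0 : ℝ) < l + l⁻¹ := by
      rw [← h.trace_eq]; exact_mod_cast hA
    by_contra hl
    have := inv_nonpos.2 (not_lt.1 hl)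
    linarith
  -- The field is `∂u - ∂v` boosted by `l ^ t`. A deck map shifts `t` by `k` and acts on vectors by
  -- the boost `l ^ k`, so the field is invariant.
  refine hg.timeOrientable (hq.isDeckFamily h)
    (X := fun x ↦ !₂[Real.exp (x 2 * Real.log l), -Real.exp (-(x 2 * Real.log l)), 0]) ?_ ?_ ?_
  · rw [contDiff_euclidean]
    intro i
    fin_cases i <;> simp <;> fun_prop
  · rintro _ ⟨k, m, rfl⟩ x
    have e : l ^ k = Real.exp (k * Real.log l) := by
      rw [mul_comm, Real.exp_mul, Real.exp_log hl, Real.rpow_intCast]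
    rw [fderiv_boostMap, e]
    apply euclidean_ext
    · simp [boostMap, planeChange_apply_two, ← Real.exp_add]
      ring
    · simp [boostMap, planeChange_apply_two, ← Real.exp_add, ← Real.exp_neg]
      ring
    · simp
  · intro x
    have ha := a.pos (x 2)
    simp [hyperbolicForm]
    have e : Real.exp (x 2 * Real.log l) * Real.exp (-(x 2 * Real.log l)) = 1 := by
      rw [← Real.exp_add]; simp
    nlinarith

/-- Matrices that commute with `A` act on the torus bundle by isometries. -/
theorem IsTorusBundleProjection.exists_iso_boostMap (hq : IsTorusBundleProjection A q)
    (hP : P.det ≠ 0) (hg : g.PullsBackTo (q ∘ planeChange P) (hyperbolicForm a))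
    (hB : Diagonalizes B P l') (hAB : Commute A B) (n : ℤ) :
    ∃ f : g.Iso, ∀ x, f.1 ((q ∘ planeChange P) x) = (q ∘ planeChange P) (boostMap (l' ^ n) 0 x) := by
  obtain ⟨hs, hp, -⟩ := hq.planeChange_props hP
  have hc : ∀ (n : ℤ) (x y : EuclideanSpace ℝ (Fin 3)),
      (q ∘ planeChange P) x = (q ∘ planeChange P) y →
      (q ∘ planeChange P) (boostMap (l' ^ n) 0 x) = (q ∘ planeChange P) (boostMap (l' ^ n) 0 y) := by
    intro n x y hxy
    simp only [Function.comp_apply] at hxy ⊢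
    obtain ⟨k, m, e⟩ := (hq.eq_iff_deck _ _).1 hxy
    rw [← hB.planeMap_planeChange, ← hB.planeMap_planeChange, ← e, planeMap_deckMap hAB,
      hq.map_deckMap]
  have hinv : ∀ (n : ℤ) x, boostMap (l' ^ n) 0 (boostMap (l' ^ (-n)) 0 x) = x := by
    intro n x
    have := zpow_ne_zero n hB.ne_zero
    apply euclidean_ext <;> simp [boostMap, this]
  exact hg.exists_iso hs hp (contDiff_boostMap _ _) (contDiff_boostMap (l' ^ (-n)) 0) (hinv n)
    (fun x ↦ by simpa using hinv (-n) x) (hc n) (hc (-n)) fun x v w ↦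
    hyperbolicForm_boostMap a (zpow_ne_zero n hB.ne_zero) 0 x v w 0 (by simp)

/-- The boosts fix `p 0`. They send the image of `μ⁻ⁿ δ ∂u`, which tends to `p 0`, to the fixed
point `p (δ ∂u)`, different from `p 0`. -/
theorem LorentzMetric.not_compactSpace_iso_of_boosts [T2Space M]
    {p : EuclideanSpace ℝ (Fin 3) → M} (hp : IsLocalDiffeomorph (𝓡 3) (𝓡 3) ∞ p) {μ : ℝ}
    (hμ : 1 < |μ|)
    (hf : ∀ n : ℕ, ∃ f : g.Iso, ∀ x, f.1 (p x) = p (boostMap (μ ^ n) 0 x)) :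
    ¬ CompactSpace g.Iso := by
  choose f hf using hf
  have hμ0 : μ ≠ 0 := by rintro rfl; simp at hμ; linarith
  obtain ⟨δ, -, hδ⟩ := exists_ne_of_isLocalDiffeomorph hp
    (v := EuclideanSpace.single 0 1) (by simp)
  have hcont : Continuous p := hp.contMDiff.continuous
  have hlim : Filter.Tendsto (fun n : ℕ ↦ ((μ⁻¹) ^ n * δ) • (EuclideanSpace.single 0 1 :
      EuclideanSpace ℝ (Fin 3))) Filter.atTop (𝓝 0) := by
    have h1 : Filter.Tendsto (fun n : ℕ ↦ (μ⁻¹) ^ n) Filter.atTop (𝓝 0) :=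
      tendsto_pow_atTop_nhds_zero_of_abs_lt_one (by
        rw [abs_inv]; exact inv_lt_one_of_one_lt₀ hμ)
    simpa using (h1.mul_const δ).smul_const (EuclideanSpace.single 0 1 : EuclideanSpace ℝ (Fin 3))
  refine LorentzMetric.not_compactSpace_iso (f := f) ((hcont.tendsto 0).comp hlim)
    (y := p 0) (y' := p (δ • EuclideanSpace.single 0 1)) (fun k ↦ ?_) ?_ hδ
  · rw [hf]
    congr 1
    apply euclidean_ext <;> simp [boostMap]
  · refine tendsto_const_nhds.congr fun n ↦ ?_
    rw [Function.comp_apply, hf]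
    congr 1
    have := pow_ne_zero n hμ0
    apply euclidean_ext <;> simp [boostMap]
    field_simp

theorem IsTorusBundleProjection.not_compactSpace_iso (hq : IsTorusBundleProjection A q)
    (hP : P.det ≠ 0) (hg : g.PullsBackTo (q ∘ planeChange P) (hyperbolicForm a))
    (hB : Diagonalizes B P l') (hAB : Commute A B) (hl : |l'| ≠ 1) : ¬ CompactSpace g.Iso := by
  have := hq.t2Space
  obtain ⟨-, hp, -⟩ := hq.planeChange_props hP
  have hiso := hq.exists_iso_boostMap hP hg hB hAB
  rcases lt_or_gt_of_ne hl with h1 | h1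
  · refine LorentzMetric.not_compactSpace_iso_of_boosts hp (μ := l'⁻¹) ?_ fun n ↦ ?_
    · rw [abs_inv]
      exact (one_lt_inv₀ (abs_pos.2 hB.ne_zero)).2 h1
    · simpa using hiso (-n)
  · exact LorentzMetric.not_compactSpace_iso_of_boosts hp h1 fun n ↦ by simpa using hiso n

/-- Isometries lift to affine maps. -/
theorem LorentzMetric.PullsBackTo.hyperbolic_lift {p : EuclideanSpace ℝ (Fin 3) → M}
    (hs : Function.Surjective p) (hc : IsCoveringMap p)
    (hp : IsLocalDiffeomorph (𝓡 3) (𝓡 3) ∞ p) (hg : g.PullsBackTo p (hyperbolicForm a))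
    (ha : a.HyperbolicGeneric) (f : g.Iso) :
    ∃ (ε : ℝ) (L : EuclideanSpace ℝ (Fin 3) →L[ℝ] EuclideanSpace ℝ (Fin 3))
      (b : EuclideanSpace ℝ (Fin 3)), (ε = 1 ∨ ε = -1) ∧ (∀ v, L v 2 = ε * v 2) ∧
      L (EuclideanSpace.single 2 1) = ε • EuclideanSpace.single 2 1 ∧
      (∀ t, a.1 (ε * t + b 2) = a.1 t) ∧ ∀ x, f.1 (p x) = p (L x + b) := by
  obtain ⟨F, hF, hFp, hFb⟩ := hg.exists_lift hs hc hp f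
  obtain ⟨ε, L, h1, h2, h3, h4, h5⟩ := hyperbolic_rigidity (F := F) ha fun x ↦
    Filter.Eventually.of_forall fun z ↦ ⟨hF.contDiffAt, by
      rw [hyperbolicForm_eq] at hFb; exact hFb z⟩
  exact ⟨ε, L, F 0, sq_eq_sq_iff_eq_or_eq_neg.1 (by rw [h1, one_pow]), h3, h4, h5, fun x ↦ by rw [← hFp, h2 x]⟩

end HyperbolicCase

/-! ### Identity component for `dt² + 2 a(t) du dv` -/

section HyperbolicComponent

variable {M : Type*} [TopologicalSpace M] [ChartedSpace (EuclideanSpace ℝ (Fin 3)) M]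
  [IsManifold (𝓡 3) ∞ M] {g : LorentzMetric 3 M} {q : EuclideanSpace ℝ (Fin 3) → M}
  {A B : SL(2, ℤ)} {P : Matrix (Fin 2) (Fin 2) ℝ} {l l' : ℝ} {a : PeriodicProfile}

/-- Lets the `3`-torus be treated as a bundle whose monodromy is diagonal in every basis, while a
separate matrix `B` supplies the boosts. -/
theorem diagonalizes_one (hP : P.det ≠ 0) : Diagonalizes 1 P 1 := by
  refine ⟨hP, ?_⟩
  have e : Matrix.diagonal ![(1 : ℝ), 1⁻¹] = 1 := by
    rw [inv_one, ← Matrix.diagonal_one]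
    congr 1
    funext i; fin_cases i <;> rfl
  rw [e, Matrix.mul_one]
  convert Matrix.one_mul P
  ext i j
  fin_cases i <;> fin_cases j <;> simp

/-- Translations act on the torus by isometries. -/
theorem IsTorusBundleProjection.exists_iso_translation (hq : IsTorusBundleProjection 1 q)
    (hP : P.det ≠ 0) (hg : g.PullsBackTo (q ∘ planeChange P) (hyperbolicForm a))
    (b : EuclideanSpace ℝ (Fin 3)) (hb : b 2 = 0) : ∃ f : g.Iso, ∀ x, f.1 (q x) = q (x + b) := by
  obtain ⟨hs, hp, -⟩ := hq.planeChange_props hP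
  set c := planeChange P⁻¹ b with hc
  have hc2 : c 2 = 0 := by rw [hc, planeChange_apply_two, hb]
  have hadd : ∀ (c x : EuclideanSpace ℝ (Fin 3)), boostMap 1 c x = x + c := fun c x ↦ by
    apply euclidean_ext <;> simp [boostMap]
  have key : ∀ (c x y : EuclideanSpace ℝ (Fin 3)), (q ∘ planeChange P) x = (q ∘ planeChange P) y →
      (q ∘ planeChange P) (boostMap 1 c x) = (q ∘ planeChange P) (boostMap 1 c y) := by
    intro c x y hxy
    rw [Function.comp_apply, Function.comp_apply, hq.eq_iff_int] at hxy ⊢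
    intro i
    obtain ⟨m, hm⟩ := hxy i
    refine ⟨m, ?_⟩
    rw [hadd, hadd, planeChange_add, planeChange_add, PiLp.add_apply, PiLp.add_apply, hm]
    ring
  obtain ⟨f, hf⟩ := hg.exists_iso hs hp (contDiff_boostMap 1 c) (contDiff_boostMap 1 (-c))
    (fun x ↦ by rw [hadd, hadd]; abel) (fun x ↦ by rw [hadd, hadd]; abel) (key c) (key (-c))
    fun x v w ↦ hyperbolicForm_boostMap a one_ne_zero c x v w 0 (by simp [hc2])
  refine ⟨f, fun x ↦ ?_⟩
  have h1 := hf (planeChange P⁻¹ x)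
  rwa [Function.comp_apply, Function.comp_apply, hadd, planeChange_add, hc,
    (planeChange_inv hP _).1, (planeChange_inv hP _).1] at h1

/-- The linear map underlying `planeChange`. -/
noncomputable def planeChangeL (P : Matrix (Fin 2) (Fin 2) ℝ) :
    EuclideanSpace ℝ (Fin 3) →L[ℝ] EuclideanSpace ℝ (Fin 3) :=
  LinearMap.toContinuousLinearMap
    { toFun := planeChange P
      map_add' := planeChange_add P
      map_smul' := planeChange_smul P }

theorem IsTorusBundleProjection.isCompact_identityComponent_hyperbolic
    (hq : IsTorusBundleProjection 1 q) (hP : P.det ≠ 0)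
    (hg : g.PullsBackTo (q ∘ planeChange P) (hyperbolicForm a)) (ha : a.HyperbolicGeneric) :
    IsCompact (LorentzMetric.Iso.identityComponent g) := by
  obtain ⟨hs, hp, hc⟩ := hq.planeChange_props hP
  refine hq.isCompact_identityComponent
    (C := {c | ∀ t, a.1 (1 * t + c) = a.1 t} ∪ {c | ∀ t, a.1 (-1 * t + c) = a.1 t})
    ((PeriodicProfile.countable_shifts ha.not_const one_ne_zero).union
      (PeriodicProfile.countable_shifts ha.not_const (by norm_num))) (fun f ↦ ?_)
    (hq.exists_iso_translation hP hg)
  obtain ⟨ε, L, b, hε, -, -, hb, hf⟩ := hg.hyperbolic_lift hs hc hp ha f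
  refine ⟨(planeChangeL P).comp (L.comp (planeChangeL P⁻¹)), planeChange P b, ?_, fun x ↦ ?_⟩
  · rw [planeChange_apply_two]
    rcases hε with rfl | rfl
    · exact Or.inl hb
    · exact Or.inr hb
  · have h1 := hf (planeChange P⁻¹ x)
    rw [Function.comp_apply, Function.comp_apply, (planeChange_inv hP _).1, planeChange_add] at h1
    exact h1

theorem planeChange_expansion (hP : P.det ≠ 0) (x : EuclideanSpace ℝ (Fin 3)) :
    x = planeChange P x 0 • planeChange P⁻¹ (EuclideanSpace.single 0 1) +
      planeChange P x 1 • planeChange P⁻¹ (EuclideanSpace.single 1 1) +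
      x 2 • EuclideanSpace.single 2 (1 : ℝ) := by
  have e : planeChange P⁻¹ (EuclideanSpace.single 2 (1 : ℝ)) = EuclideanSpace.single 2 (1 : ℝ) := by
    apply euclidean_ext <;> simp [planeChange]
  conv_lhs => rw [← (planeChange_inv hP x).2, basis_expansion (planeChange P x)]
  rw [planeChange_add, planeChange_add, planeChange_smul, planeChange_smul, planeChange_smul, e,
    planeChange_apply_two]

/-- The isometry group of a hyperbolic torus bundle is countable. -/
theorem IsTorusBundleProjection.countable_iso (hq : IsTorusBundleProjection A q)
    (h : Diagonalizes A P l) (hl : |l| ≠ 1)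
    (hg : g.PullsBackTo (q ∘ planeChange P) (hyperbolicForm a)) (ha : a.HyperbolicGeneric) :
    Countable g.Iso := by
  obtain ⟨hs, hp, hc⟩ := hq.planeChange_props h.1
  choose ε L b hε hL hL2 hb hf using hg.hyperbolic_lift hs hc hp ha
  set Λ : Set (EuclideanSpace ℝ (Fin 3)) :=
    Set.range fun m : Fin 2 → ℤ ↦ planeChange P⁻¹ !₂[(m 0 : ℝ), (m 1 : ℝ), 0] with hΛ
  have hl0 := h.ne_zero
  -- A translation of the lattice must be carried to a deck map, and the last coordinate gives `k =
  -- 0`. So the linear part preserves a lattice, which leaves countably many choices.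
  have hLΛ : ∀ f, ∀ u ∈ Λ, L f u ∈ Λ := by
    rintro f _ ⟨m, rfl⟩
    set u := planeChange P⁻¹ !₂[(m 0 : ℝ), (m 1 : ℝ), 0]
    have h1 : (q ∘ planeChange P) 0 = (q ∘ planeChange P) u :=
      (hq.planeChange_eq_iff h _ _).2 ⟨0, m, by
        apply euclidean_ext <;> simp [boostMap, u]⟩
    have h2 := congrArg f.1 h1
    rw [hf, hf, map_zero, zero_add] at h2
    obtain ⟨k, m', e⟩ := (hq.planeChange_eq_iff h _ _).1 h2
    have e2 := congrArg (fun v : EuclideanSpace ℝ (Fin 3) ↦ v 2) e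
    simp [boostMap, hL, u, planeChange_apply_two] at e2
    rw [e2] at e
    refine ⟨m', ?_⟩
    have e3 : ∀ c x : EuclideanSpace ℝ (Fin 3), boostMap (l ^ (0 : ℤ)) c x = c + x := fun c x ↦ by
      apply euclidean_ext <;> simp [boostMap, add_comm]
    rw [e3, add_left_inj] at e
    simpa using e
  -- Compatibility with the deck map `(x, t) ↦ (A x, t + 1)` gives `b = l ^ k b + c` in one
  -- eigendirection and the same with `(l ^ k)⁻¹` in the other, with `k = ±1` and `c` from the
  -- lattice. As `|l| ≠ 1` this determines the planar part of `b`. No continuous family of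
  -- translations survives.
  have hbS : ∀ f, ∃ (k : ℤ) (m : Fin 2 → ℤ), l ^ k ≠ 1 ∧
      b f 0 = planeChange P⁻¹ !₂[(m 0 : ℝ), (m 1 : ℝ), 0] 0 / (1 - l ^ k) ∧
      b f 1 = planeChange P⁻¹ !₂[(m 0 : ℝ), (m 1 : ℝ), 0] 1 / (1 - (l ^ k)⁻¹) := by
    intro f
    have h1 : (q ∘ planeChange P) 0 = (q ∘ planeChange P) (EuclideanSpace.single 2 1) :=
      (hq.planeChange_eq_iff h _ _).2 ⟨1, 0, by
        apply euclidean_ext <;> simp [boostMap, planeChange]⟩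
    have h2 := congrArg f.1 h1
    rw [hf, hf, map_zero, zero_add, hL2] at h2
    obtain ⟨k, m, e⟩ := (hq.planeChange_eq_iff h _ _).1 h2
    have e0 := congrArg (fun v : EuclideanSpace ℝ (Fin 3) ↦ v 0) e
    have e1 := congrArg (fun v : EuclideanSpace ℝ (Fin 3) ↦ v 1) e
    have e2 := congrArg (fun v : EuclideanSpace ℝ (Fin 3) ↦ v 2) e
    simp [boostMap, planeChange_apply_two] at e0 e1 e2
    have hk : |l ^ k| ≠ 1 := by
      rcases hε f with hε | hε
      · have : k = 1 := by rw [hε, add_comm] at e2; exact_mod_cast add_right_cancel e2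
        rwa [this, zpow_one]
      · have : k = -1 := by rw [hε, add_comm] at e2; exact_mod_cast add_right_cancel e2
        rw [this, zpow_neg_one, abs_inv]
        exact fun h ↦ hl (inv_eq_one.1 h)
    have hk1 : l ^ k ≠ 1 := fun h ↦ hk (by rw [h, abs_one])
    have hk2 : (l ^ k)⁻¹ ≠ 1 := fun h ↦ hk1 (inv_eq_one.1 h)
    refine ⟨k, m, hk1, ?_, ?_⟩
    · rw [eq_div_iff (sub_ne_zero.2 hk1.symm)]
      simp [planeChange] at e0 ⊢
      linarith
    · rw [eq_div_iff (sub_ne_zero.2 hk2.symm)]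
      simp [planeChange] at e1 ⊢
      linarith
  choose kk mm hk hb0 hb1 using hbS
  set C : Set ℝ := {c | ∀ t, a.1 (1 * t + c) = a.1 t} ∪ {c | ∀ t, a.1 (-1 * t + c) = a.1 t}
  have hC : C.Countable := (PeriodicProfile.countable_shifts ha.not_const one_ne_zero).union
      (PeriodicProfile.countable_shifts ha.not_const (by norm_num))
  have hbC : ∀ f, b f 2 ∈ C := by
    intro f
    have hb := hb f
    rcases hε f with h1 | h1 <;> rw [h1] at hb
    · exact Or.inl hb
    · exact Or.inr hb
  set u : Fin 2 → EuclideanSpace ℝ (Fin 3) :=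
    fun i ↦ planeChange P⁻¹ (EuclideanSpace.single i.castSucc 1)
  have hu : ∀ i, u i ∈ Λ := by
    intro i
    refine ⟨Pi.single i 1, ?_⟩
    simp only [u]
    congr 1
    fin_cases i <;> apply euclidean_ext <;> simp
  have : Countable Λ := (Set.countable_range _).to_subtype
  have : Countable C := hC.to_subtype
  have : Countable ({1, -1} : Set ℝ) := ((Set.countable_singleton _).insert _).to_subtype
  let Φ : g.Iso → (Fin 2 → Λ) × ({1, -1} : Set ℝ) × ℤ × (Fin 2 → ℤ) × C := fun f ↦
    (fun i ↦ ⟨L f (u i), hLΛ f _ (hu i)⟩, ⟨ε f, hε f⟩, kk f, mm f, ⟨b f 2, hbC f⟩)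
  refine Function.Injective.countable (f := Φ) fun f f' hff ↦ ?_
  simp only [Φ, Prod.mk.injEq, Subtype.mk.injEq] at hff
  obtain ⟨hu', hε', hk', hm', hb'⟩ := hff
  have hu0 : L f (u 0) = L f' (u 0) := congrArg Subtype.val (congrFun hu' 0)
  have hu1 : L f (u 1) = L f' (u 1) := congrArg Subtype.val (congrFun hu' 1)
  have hb'' : b f = b f' := by
    apply euclidean_ext
    · rw [hb0, hb0, hk', hm']
    · rw [hb1, hb1, hk', hm']
    · exact hb'
  refine LorentzMetric.Iso.ext fun y ↦ ?_
  obtain ⟨x, rfl⟩ := hs y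
  rw [hf, hf, hb'']
  have e : ∀ f, L f x = planeChange P x 0 • L f (u 0) + planeChange P x 1 • L f (u 1) +
      x 2 • ε f • EuclideanSpace.single 2 (1 : ℝ) := by
    intro f
    conv_lhs => rw [planeChange_expansion h.1 x]
    rw [map_add, map_add, map_smul, map_smul, map_smul, hL2]
    rfl
  rw [e, e, hu0, hu1, show ε f = ε f' from congrArg Subtype.val hε']

/-- Quotients of a generic metric `dt² + 2 a(t) du dv`. -/
theorem IsTorusBundleProjection.exists_hyperbolic (hq : IsTorusBundleProjection A q)
    (h : Diagonalizes A P l) (hA : A = 1 ∨ |l| ≠ 1) (hB : Diagonalizes B P l')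
    (hAB : Commute A B) (hl' : |l'| ≠ 1) (ha : a.HyperbolicGeneric) :
    ∃ g : LorentzMetric 3 M, g.PullsBackTo (q ∘ planeChange P) (hyperbolicForm a) ∧
      g.IsNonhomogeneousWithNoncompactIso ∧
      (0 < (A : Matrix (Fin 2) (Fin 2) ℤ).trace → g.TimeOrientable) := by
  obtain ⟨g, hg⟩ := hq.exists_hyperbolic_metric h a
  obtain ⟨hs, hp, -⟩ := hq.planeChange_props h.1
  refine ⟨g, hg, ⟨hq.not_compactSpace_iso h.1 hg hB hAB hl', ?_, fun U hU hne ↦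
    hyperbolic_not_locallyHomogeneous hs hp hg ha U hU hne⟩, hq.timeOrientable h hg⟩
  rcases hA with rfl | hl
  · exact hq.isCompact_identityComponent_hyperbolic h.1 hg ha
  · have := hq.t2Space
    have := hq.countable_iso h hl hg ha
    exact LorentzMetric.isCompact_identityComponent_of_countable

end HyperbolicComponent

/-! ### Shears and the metric `a(v) (dt² + 2 du dv)` -/

section Shear

/-- The affine maps `(u, t, v) ↦ (u + K t - K² / 2 v, t - K v, v) + c`. -/
noncomputable def shearMap (K : ℝ) (c x : EuclideanSpace ℝ (Fin 3)) : EuclideanSpace ℝ (Fin 3) :=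
  !₂[x 0 + K * x 1 - K ^ 2 / 2 * x 2 + c 0, x 1 - K * x 2 + c 1, x 2 + c 2]

theorem contDiff_shearMap (K : ℝ) (c : EuclideanSpace ℝ (Fin 3)) : ContDiff ℝ ∞ (shearMap K c) := by
  rw [contDiff_euclidean]
  intro i
  fin_cases i <;> simp [shearMap] <;> fun_prop

theorem fderiv_shearMap (K : ℝ) (c x v : EuclideanSpace ℝ (Fin 3)) :
    fderiv ℝ (shearMap K c) x v = shearMap K 0 v :=
  fderiv_of_affine (D := shearMap K 0) ((contDiff_shearMap K c).differentiable (by simp) x)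
    (fun v s ↦ by apply euclidean_ext <;> simp [shearMap] <;> ring) v

theorem parabolicForm_shearMap (a : PeriodicProfile) (K : ℝ) (c x v w : EuclideanSpace ℝ (Fin 3))
    (k : ℤ) (hc : c 2 = k) :
    parabolicForm a (shearMap K c x) (fderiv ℝ (shearMap K c) x v)
      (fderiv ℝ (shearMap K c) x w) = parabolicForm a x v w := by
  rw [fderiv_shearMap, fderiv_shearMap]
  have h : a.1 (x 2 + k) = a.1 (x 2) := by simpa using a.periodic.int_mul k (x 2)
  simp only [parabolicForm, shearMap, PiLp.toLp_apply, Matrix.cons_val, hc, h, PiLp.zero_apply]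
  ring

theorem shearMap_zero_left (c x : EuclideanSpace ℝ (Fin 3)) : shearMap 0 c x = x + c := by
  apply euclidean_ext <;> simp [shearMap]

variable {M : Type*} [TopologicalSpace M] [ChartedSpace (EuclideanSpace ℝ (Fin 3)) M]
  [IsManifold (𝓡 3) ∞ M] {g : LorentzMetric 3 M} {p : EuclideanSpace ℝ (Fin 3) → M}
  {D : Set (EuclideanSpace ℝ (Fin 3) → EuclideanSpace ℝ (Fin 3))} {a : PeriodicProfile}

theorem IsDeckFamily.exists_parabolic_metric (h : IsDeckFamily p D)
    (hD : ∀ γ ∈ D, ∃ (K : ℝ) (c : EuclideanSpace ℝ (Fin 3)) (k : ℤ), c 2 = k ∧ γ = shearMap K c)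
    (a : PeriodicProfile) : ∃ g : LorentzMetric 3 M, g.PullsBackTo p (parabolicForm a) := by
  suffices h' : _ ∧ _ by
    obtain ⟨g, hg⟩ := h.exists_lorentzMetric (B := parabolicField a)
      (isLeviCivita_parabolic a).contDiff_form h'.1 (isLeviCivita_parabolic a).symm h'.2
    exact ⟨g, by rwa [parabolicForm_eq]⟩
  constructor
  · intro γ hγ x v w
    obtain ⟨K, c, k, hc, rfl⟩ := hD γ hγ
    have := parabolicForm_shearMap a K c x v w k hc
    rwa [parabolicForm_eq] at this
  · intro x
    have ha := a.pos (x 2)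
    refine ⟨!₂[1, 0, -1], ?_, fun w hw hne ↦ ?_⟩
    · rw [parabolicField_apply]
      simp [parabolicForm]
      linarith
    · rw [parabolicField_apply] at hw ⊢
      simp [parabolicForm] at hw
      have e : w 2 = w 0 := by
        rcases hw with hw | hw <;> linarith
      simp only [parabolicForm, e]
      refine mul_pos ha ?_
      by_contra hle
      have h0 : w 0 = 0 := by nlinarith [mul_self_nonneg (w 1), mul_self_nonneg (w 0)]
      have h1 : w 1 = 0 := by nlinarith [mul_self_nonneg (w 1), mul_self_nonneg (w 0)]
      refine hne ?_
      apply euclidean_ext <;> simp [h0, h1, e]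

/-- Maps `shearMap K c` that permute the fibres of `p` induce isometries. -/
theorem LorentzMetric.PullsBackTo.exists_iso_shearMap (hs : Function.Surjective p)
    (hp : IsLocalDiffeomorph (𝓡 3) (𝓡 3) ∞ p) (hg : g.PullsBackTo p (parabolicForm a)) {K : ℝ}
    {c : EuclideanSpace ℝ (Fin 3)} (hc : c 2 = 0)
    (h : ∀ x y, p x = p y → p (shearMap K c x) = p (shearMap K c y))
    (h' : ∀ x y, p x = p y →
      p (shearMap (-K) (-shearMap (-K) 0 c) x) = p (shearMap (-K) (-shearMap (-K) 0 c) y)) :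
    ∃ f : g.Iso, ∀ x, f.1 (p x) = p (shearMap K c x) := by
  refine hg.exists_iso hs hp (contDiff_shearMap K c)
    (contDiff_shearMap (-K) (-shearMap (-K) 0 c)) (fun x ↦ ?_) (fun x ↦ ?_) h h'
    fun x v w ↦ parabolicForm_shearMap a K c x v w 0 (by simp [hc])
  · apply euclidean_ext <;> simp [shearMap] <;> ring
  · apply euclidean_ext <;> simp [shearMap] <;> ring

/-- The shears fix `p 0`. The `n`-th one carries `δ / (K (n + 1)) ∂t`, which tends to `0`, to a
vector with `u` coordinate `δ n / (n + 1)`, so the images tend to `p (δ ∂u)`. -/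
theorem LorentzMetric.not_compactSpace_iso_of_shears [T2Space M]
    (hp : IsLocalDiffeomorph (𝓡 3) (𝓡 3) ∞ p) {K : ℝ} (hK : K ≠ 0)
    (hf : ∀ n : ℕ, ∃ f : g.Iso, ∀ x, f.1 (p x) = p (shearMap (K * n) 0 x)) :
    ¬ CompactSpace g.Iso := by
  choose f hf using hf
  obtain ⟨δ, -, hδ⟩ := exists_ne_of_isLocalDiffeomorph hp
    (v := EuclideanSpace.single 0 1) (by simp)
  have hcont : Continuous p := hp.contMDiff.continuous
  have h1 : Filter.Tendsto (fun n : ℕ ↦ (1 : ℝ) / (n + 1)) Filter.atTop (𝓝 0) :=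
    tendsto_one_div_add_atTop_nhds_zero_nat
  have hlim : Filter.Tendsto (fun n : ℕ ↦ (δ / K * (1 / (n + 1))) • (EuclideanSpace.single 1 1 :
      EuclideanSpace ℝ (Fin 3))) Filter.atTop (𝓝 0) := by
    simpa using (h1.const_mul (δ / K)).smul_const
      (EuclideanSpace.single 1 1 : EuclideanSpace ℝ (Fin 3))
  have hlim2 : Filter.Tendsto (fun n : ℕ ↦ (δ * (1 - 1 / (n + 1))) •
      (EuclideanSpace.single 0 1 : EuclideanSpace ℝ (Fin 3)) +
        (δ / K * (1 / (n + 1))) • (EuclideanSpace.single 1 1 : EuclideanSpace ℝ (Fin 3)))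
      Filter.atTop (𝓝 (δ • EuclideanSpace.single 0 1)) := by
    have h2 := ((h1.const_sub 1).const_mul δ).smul_const
      (EuclideanSpace.single 0 1 : EuclideanSpace ℝ (Fin 3))
    simpa using h2.add hlim
  refine LorentzMetric.not_compactSpace_iso (f := f) ((hcont.tendsto 0).comp hlim)
    (y := p 0) (y' := p (δ • EuclideanSpace.single 0 1)) (fun k ↦ ?_) ?_ hδ
  · rw [hf]
    congr 1
    apply euclidean_ext <;> simp [shearMap]
  · refine ((hcont.tendsto _).comp hlim2).congr fun n ↦ ?_
    rw [Function.comp_apply, Function.comp_apply, hf]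
    congr 1
    have : (n : ℝ) + 1 ≠ 0 := by positivity
    apply euclidean_ext
    · simp [shearMap]
      field_simp
      ring
    · simp [shearMap]
    · simp [shearMap]

/-- The affine maps that preserve `dt² + 2 du dv`, up to a factor, and the lines `dv = 0`. -/
noncomputable def parabolicMap (l τ β : ℝ) (b x : EuclideanSpace ℝ (Fin 3)) :
    EuclideanSpace ℝ (Fin 3) :=
  !₂[x 0 / l - τ * β / l * x 1 - β ^ 2 / (2 * l) * x 2 + b 0, τ * x 1 + β * x 2 + b 1, l * x 2 + b 2]

/-- Isometries lift to affine maps. -/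
theorem LorentzMetric.PullsBackTo.parabolic_lift (hs : Function.Surjective p)
    (hc : IsCoveringMap p) (hp : IsLocalDiffeomorph (𝓡 3) (𝓡 3) ∞ p)
    (hg : g.PullsBackTo p (parabolicForm a)) (ha : a.ParabolicGeneric) (f : g.Iso) :
    ∃ (l τ β : ℝ) (b : EuclideanSpace ℝ (Fin 3)), l ≠ 0 ∧ (τ = 1 ∨ τ = -1) ∧
      (∀ t, a.1 (l * t + b 2) = a.1 t) ∧ ∀ x, f.1 (p x) = p (parabolicMap l τ β b x) := by
  obtain ⟨F, hF, hFp, hFb⟩ := hg.exists_lift hs hc hp f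
  obtain ⟨l, τ, β, h1, h2, h3, h4⟩ := parabolic_rigidity (F := F) ha fun x ↦
    Filter.Eventually.of_forall fun z ↦ ⟨hF.contDiffAt, by
      rw [parabolicForm_eq] at hFb; exact hFb z⟩
  refine ⟨l, τ, β, F 0, h1, sq_eq_sq_iff_eq_or_eq_neg.1 (by rw [h2, one_pow]), h3, fun x ↦ ?_⟩
  rw [← hFp]
  congr 1
  apply euclidean_ext
  · rw [(h4 x).1]; simp [parabolicMap]
  · rw [(h4 x).2.1]; simp [parabolicMap]
  · rw [(h4 x).2.2]; simp [parabolicMap]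

end Shear

/-! ### The `3`-torus as a quotient of `a(v) (dt² + 2 du dv)` -/

section ParabolicTorus

variable {M : Type*} [TopologicalSpace M] [ChartedSpace (EuclideanSpace ℝ (Fin 3)) M]
  [IsManifold (𝓡 3) ∞ M] {q : EuclideanSpace ℝ (Fin 3) → M} {a : PeriodicProfile}

/-- Compatibility with the deck group forces the dilation factor of a lift along `v` to be a nonzero
integer, so only these shifts occur. -/
theorem countable_integral_shifts (h : ¬ ∀ t t', a.1 t = a.1 t') :
    {c : ℝ | ∃ k : ℤ, k ≠ 0 ∧ ∀ t, a.1 (k * t + c) = a.1 t}.Countable := by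
  have e : {c : ℝ | ∃ k : ℤ, k ≠ 0 ∧ ∀ t, a.1 (k * t + c) = a.1 t} =
      ⋃ k : {k : ℤ // k ≠ 0}, {c : ℝ | ∀ t, a.1 ((k : ℤ) * t + c) = a.1 t} := by
    ext c; simp
  rw [e]
  exact Set.countable_iUnion fun k ↦
    PeriodicProfile.countable_shifts h (Int.cast_ne_zero.2 k.2)

omit [IsManifold (𝓡 3) ∞ M] in
theorem IsTorusBundleProjection.isDeckFamily_translations (hq : IsTorusBundleProjection 1 q) :
    IsDeckFamily q {γ | ∃ m : Fin 3 → ℤ, γ = shearMap 0 !₂[(m 0 : ℝ), (m 1 : ℝ), (m 2 : ℝ)]} where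
  surjective := hq.surjective
  isLocalDiffeomorph := hq.isLocalDiffeomorph
  differentiable := by
    rintro _ ⟨m, rfl⟩
    exact (contDiff_shearMap _ _).differentiable (by simp)
  map_deck := by
    rintro _ ⟨m, rfl⟩ x
    refine ((hq.eq_iff_int _ _).2 fun i ↦ ⟨m i, ?_⟩).symm
    rw [shearMap_zero_left]
    fin_cases i <;> simp
  exists_deck := by
    intro x y hxy
    choose m hm using (hq.eq_iff_int _ _).1 hxy
    refine ⟨_, ⟨m, rfl⟩, ?_⟩
    rw [shearMap_zero_left]
    apply euclidean_ext <;> simp [hm]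

/-- Quotients of a generic metric `a(v) (dt² + 2 du dv)` by the group of integral translations. -/
theorem IsTorusBundleProjection.exists_parabolic (hq : IsTorusBundleProjection 1 q)
    (ha : a.ParabolicGeneric) : ∃ g : LorentzMetric 3 M, g.PullsBackTo q (parabolicForm a) ∧
      g.IsNonhomogeneousWithNoncompactIso ∧ g.TimeOrientable := by
  have hD := hq.isDeckFamily_translations
  have hp := hq.isLocalDiffeomorph
  have hs := hq.surjective
  have := hq.t2Space
  obtain ⟨g, hg⟩ := hD.exists_parabolic_metric (by
    rintro _ ⟨m, rfl⟩
    exact ⟨0, _, m 2, by simp, rfl⟩) a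
  -- An even parameter makes the coefficient `K² / 2` of the shear integral, so the lattice is
  -- preserved.
  have hshear : ∀ (k : ℤ) (c x y : EuclideanSpace ℝ (Fin 3)), q x = q y →
      q (shearMap (2 * k) c x) = q (shearMap (2 * k) c y) := by
    intro k c x y hxy
    rw [hq.eq_iff_int] at hxy ⊢
    choose m hm using hxy
    intro i
    fin_cases i
    · refine ⟨m 0 + 2 * k * m 1 - 2 * k ^ 2 * m 2, ?_⟩
      simp [shearMap, hm]; ring
    · refine ⟨m 1 - 2 * k * m 2, ?_⟩
      simp [shearMap, hm]; ring
    · exact ⟨m 2, by simp [shearMap, hm]; ring⟩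
  have htrans : ∀ (c x y : EuclideanSpace ℝ (Fin 3)), q x = q y →
      q (shearMap 0 c x) = q (shearMap 0 c y) := fun c ↦ by simpa using hshear 0 c
  refine ⟨g, hg, ⟨?_, ?_, fun U hU hne ↦ parabolic_not_locallyHomogeneous hs hp hg ha U hU hne⟩, ?_⟩
  · refine LorentzMetric.not_compactSpace_iso_of_shears hp two_ne_zero fun n ↦ ?_
    refine hg.exists_iso_shearMap hs hp (by simp) (fun x y h ↦ by simpa using hshear n 0 x y h)
      fun x y h ↦ ?_
    simpa using hshear (-n) (-shearMap (-(2 * n)) 0 0) x y h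
  · refine hq.isCompact_identityComponent (countable_integral_shifts ha.not_const) (fun f ↦ ?_)
      fun b hb ↦ ?_
    · obtain ⟨l, τ, β, b, hl, -, hb, hf⟩ := hg.parabolic_lift hs hq.isCoveringMap hp ha f
      have h1 : q 0 = q (EuclideanSpace.single 2 1) := (hq.eq_iff_int _ _).2 fun i ↦
        ⟨if i = 2 then 1 else 0, by simp⟩
      have h2 := congrArg f.1 h1
      rw [hf, hf] at h2
      obtain ⟨k, hk⟩ := (hq.eq_iff_int _ _).1 h2 2
      simp [parabolicMap] at hk
      have hk' : l = k := by linarith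
      subst hk'
      refine ⟨LinearMap.toContinuousLinearMap
        { toFun := parabolicMap k τ β 0
          map_add' := fun x y ↦ by apply euclidean_ext <;> simp [parabolicMap] <;> ring
          map_smul' := fun s x ↦ by apply euclidean_ext <;> simp [parabolicMap] <;> ring }, b,
        ⟨k, Int.cast_ne_zero.1 hl, hb⟩, fun x ↦ ?_⟩
      rw [hf]
      congr 1
      apply euclidean_ext <;> simp [parabolicMap]
    · obtain ⟨f, hf⟩ := hg.exists_iso_shearMap (K := 0) hs hp hb (htrans b)
        (by rw [neg_zero]; exact htrans _)
      exact ⟨f, fun x ↦ by rw [hf, shearMap_zero_left]⟩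
  · refine hg.timeOrientable hD (X := fun _ ↦ !₂[1, 0, -1]) contDiff_const ?_ fun x ↦ ?_
    · rintro _ ⟨m, rfl⟩ x
      rw [fderiv_shearMap, shearMap_zero_left, add_zero]
    · have := a.pos (x 2)
      simp [parabolicForm]
      linarith

end ParabolicTorus

/-! ### Parabolic monodromy in Heisenberg coordinates -/

section ParabolicMatrix

variable {A : SL(2, ℤ)} {d : Matrix (Fin 2) (Fin 2) ℤ}

/-- The rows of `d` form a basis of `ℚ²` in which `A` is the standard unipotent matrix. -/
structure UnipotentBasis (A : SL(2, ℤ)) (d : Matrix (Fin 2) (Fin 2) ℤ) : Prop where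
  det_ne_zero : d.det ≠ 0
  row_zero : ∀ j, d 0 0 * A 0 j + d 0 1 * A 1 j = d 0 j + d 1 j
  row_one : ∀ j, d 1 0 * A 0 j + d 1 1 * A 1 j = d 1 j

theorem IsParabolicMatrix.exists_unipotentBasis (hA : IsParabolicMatrix A) :
    ∃ d, UnipotentBasis A d := by
  obtain ⟨hne, hn⟩ := hA
  set N : Matrix (Fin 2) (Fin 2) ℤ := (A : Matrix (Fin 2) (Fin 2) ℤ) - 1 with hN
  have htr : N 0 0 + N 1 1 = 0 := by
    have := (Matrix.isNilpotent_trace_of_isNilpotent hn).eq_zero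
    rwa [Matrix.trace_fin_two] at this
  have hdet : N 0 0 * N 1 1 - N 0 1 * N 1 0 = 0 := by
    obtain ⟨k, hk⟩ := hn
    rw [← Matrix.det_fin_two]
    exact IsReduced.eq_zero _ ⟨k, by rw [← Matrix.det_pow, hk, Matrix.det_zero]⟩
  have e00 : A 0 0 = N 0 0 + 1 := by simp [hN]
  have e01 : A 0 1 = N 0 1 := by simp [hN]
  have e10 : A 1 0 = N 1 0 := by simp [hN]
  have e11 : A 1 1 = N 1 1 + 1 := by simp [hN]
  have e : N 1 1 = -N 0 0 := by linarith
  rw [e] at hdet e11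
  -- As `N² = 0`, the rows `r` and `r N` work for any integral `r` with `r N ≠ 0`. The first
  -- coordinate row is taken if `N 0 1 ≠ 0`, the second one otherwise.
  by_cases h01 : N 0 1 = 0
  · have h00 : N 0 0 = 0 := by
      rw [h01] at hdet
      have : N 0 0 * N 0 0 = 0 := by linarith
      exact mul_self_eq_zero.1 this
    have h10 : N 1 0 ≠ 0 := by
      intro h10
      refine hne ?_
      ext i j
      fin_cases i <;> fin_cases j <;> simp [e00, e01, e10, e11, h00, h01, h10]
    refine ⟨!![0, 1; N 1 0, 0], ⟨by simpa [Matrix.det_fin_two] using h10, fun j ↦ ?_, fun j ↦ ?_⟩⟩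
    · fin_cases j <;> simp [e00, e01, e10, e11, h00, h01]
    · fin_cases j <;> simp [e00, e01, e10, e11, h00, h01]
  · refine ⟨!![1, 0; N 0 0, N 0 1], ⟨by simpa [Matrix.det_fin_two] using h01, fun j ↦ ?_,
      fun j ↦ ?_⟩⟩
    · fin_cases j <;> simp [e00, e01, e10, e11]; ring
    · fin_cases j <;> simp [e00, e01, e10, e11] <;> linarith

theorem UnipotentBasis.zpow (h : UnipotentBasis A d) (k : ℤ) (j : Fin 2) :
    d 0 0 * (A ^ k) 0 j + d 0 1 * (A ^ k) 1 j = d 0 j + k * d 1 j ∧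
      d 1 0 * (A ^ k) 0 j + d 1 1 * (A ^ k) 1 j = d 1 j := by
  have hsucc : ∀ (k : ℤ) (i j : Fin 2), d i 0 * (A ^ (k + 1)) 0 j + d i 1 * (A ^ (k + 1)) 1 j =
      (d i 0 * A 0 0 + d i 1 * A 1 0) * (A ^ k) 0 j +
        (d i 0 * A 0 1 + d i 1 * A 1 1) * (A ^ k) 1 j := by
    intro k i j
    have e : ∀ i', (A ^ (k + 1)) i' j = A i' 0 * (A ^ k) 0 j + A i' 1 * (A ^ k) 1 j := by
      intro i'
      rw [add_comm, zpow_add, zpow_one, Matrix.SpecialLinearGroup.coe_mul, Matrix.mul_apply,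
        Fin.sum_univ_two]
    rw [e, e]
    ring
  induction k using Int.induction_on with
  | zero => fin_cases j <;> simp
  | succ k ih =>
    refine ⟨?_, ?_⟩
    · rw [hsucc, h.row_zero, h.row_zero]
      linear_combination ih.1 + ih.2
    · rw [hsucc, h.row_one, h.row_one]
      exact ih.2
  | pred k ih =>
    have h0 := hsucc (-k - 1) 0 j
    have h1 := hsucc (-k - 1) 1 j
    rw [sub_add_cancel, h.row_zero, h.row_zero] at h0
    rw [sub_add_cancel, h.row_one, h.row_one] at h1
    constructor
    · linear_combination ih.1 - ih.2 - h0 + h1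
    · linear_combination ih.2 - h1

/-- The coordinates `(u, t, v)` of `ℝ³` in which the deck transformations of a parabolic torus
bundle are affine maps of the Heisenberg group. -/
noncomputable def heisenbergCoord (d : Matrix (Fin 2) (Fin 2) ℤ) (x : EuclideanSpace ℝ (Fin 3)) :
    EuclideanSpace ℝ (Fin 3) :=
  !₂[d 0 0 * x 0 + d 0 1 * x 1 + (x 2 - x 2 ^ 3) / 6, d 1 0 * x 0 + d 1 1 * x 1 - x 2 ^ 2 / 2, x 2]

/-- The inverse of `heisenbergCoord`. -/
noncomputable def heisenbergParam (d : Matrix (Fin 2) (Fin 2) ℤ) (x : EuclideanSpace ℝ (Fin 3)) :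
    EuclideanSpace ℝ (Fin 3) :=
  !₂[(d 1 1 * (x 0 - (x 2 - x 2 ^ 3) / 6) - d 0 1 * (x 1 + x 2 ^ 2 / 2)) / d.det,
    (-d 1 0 * (x 0 - (x 2 - x 2 ^ 3) / 6) + d 0 0 * (x 1 + x 2 ^ 2 / 2)) / d.det, x 2]

theorem contDiff_heisenbergCoord (d : Matrix (Fin 2) (Fin 2) ℤ) :
    ContDiff ℝ ∞ (heisenbergCoord d) := by
  rw [contDiff_euclidean]
  intro i
  fin_cases i <;> simp [heisenbergCoord] <;> fun_prop

theorem contDiff_heisenbergParam (d : Matrix (Fin 2) (Fin 2) ℤ) :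
    ContDiff ℝ ∞ (heisenbergParam d) := by
  rw [contDiff_euclidean]
  intro i
  fin_cases i <;> simp [heisenbergParam] <;> fun_prop

theorem heisenbergCoord_param (hd : d.det ≠ 0) (x : EuclideanSpace ℝ (Fin 3)) :
    heisenbergCoord d (heisenbergParam d x) = x := by
  have hd' : (d.det : ℝ) = d 0 0 * d 1 1 - d 0 1 * d 1 0 := by
    rw [Matrix.det_fin_two]; push_cast; ring
  have h0 : (d.det : ℝ) ≠ 0 := Int.cast_ne_zero.2 hd
  apply euclidean_ext
  · simp [heisenbergCoord, heisenbergParam]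
    field_simp
    rw [hd']; ring
  · simp [heisenbergCoord, heisenbergParam]
    field_simp
    rw [hd']; ring
  · simp [heisenbergCoord, heisenbergParam]

theorem heisenbergParam_coord (hd : d.det ≠ 0) (x : EuclideanSpace ℝ (Fin 3)) :
    heisenbergParam d (heisenbergCoord d x) = x := by
  have hd' : (d.det : ℝ) = d 0 0 * d 1 1 - d 0 1 * d 1 0 := by
    rw [Matrix.det_fin_two]; push_cast; ring
  have h0 : (d.det : ℝ) ≠ 0 := Int.cast_ne_zero.2 hd
  apply euclidean_ext
  · simp [heisenbergCoord, heisenbergParam]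
    field_simp
    rw [hd']; ring
  · simp [heisenbergCoord, heisenbergParam]
    field_simp
    rw [hd']; ring
  · simp [heisenbergCoord, heisenbergParam]

/-- The translation part of a deck transformation in the coordinates `heisenbergCoord`. -/
noncomputable def heisenbergShift (d : Matrix (Fin 2) (Fin 2) ℤ) (k : ℤ) (m : Fin 2 → ℤ) :
    EuclideanSpace ℝ (Fin 3) :=
  !₂[((k : ℝ) - k ^ 3) / 6 + (d 0 0 * m 0 + d 0 1 * m 1),
    -(k : ℝ) ^ 2 / 2 + (d 1 0 * m 0 + d 1 1 * m 1), k]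

/-- The terms `-v² / 2` and `-v³ / 6` of `heisenbergCoord` are those whose increments under `v ↦ v +
k` supply the `v`-dependent terms of the shear. The extra `v / 6` turns the remaining constant into
`(k - k³) / 6`, an integer. -/
theorem UnipotentBasis.heisenbergCoord_deckMap (h : UnipotentBasis A d) (k : ℤ) (m : Fin 2 → ℤ)
    (x : EuclideanSpace ℝ (Fin 3)) : heisenbergCoord d (deckMap A k m x) =
      shearMap k (heisenbergShift d k m) (heisenbergCoord d x) := by
  have e : ∀ j : Fin 2, ((d 0 0 * (A ^ k) 0 j + d 0 1 * (A ^ k) 1 j : ℤ) : ℝ) =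
      (d 0 j + k * d 1 j : ℤ) ∧ ((d 1 0 * (A ^ k) 0 j + d 1 1 * (A ^ k) 1 j : ℤ) : ℝ) =
      (d 1 j : ℤ) := fun j ↦ by rw [(h.zpow k j).1, (h.zpow k j).2]; exact ⟨rfl, rfl⟩
  push_cast at e
  have e0 := e 0
  have e1 := e 1
  apply euclidean_ext
  · simp [heisenbergCoord, deckMap, shearMap, heisenbergShift]
    linear_combination x 0 * e0.1 + x 1 * e1.1
  · simp [heisenbergCoord, deckMap, shearMap, heisenbergShift]
    linear_combination x 0 * e0.2 + x 1 * e1.2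
  · simp [heisenbergCoord, deckMap, shearMap, heisenbergShift]

end ParabolicMatrix

/-! ### Parabolic bundles as quotients by shears -/

section HeisenbergQuotient

variable {M : Type*} [TopologicalSpace M] [ChartedSpace (EuclideanSpace ℝ (Fin 3)) M]
  {q p : EuclideanSpace ℝ (Fin 3) → M} {A : SL(2, ℤ)} {d : Matrix (Fin 2) (Fin 2) ℤ}

/-- The properties of the presentation of a parabolic torus bundle by affine maps of the
Heisenberg group that determine its geometry. -/
structure IsShearProjection (d : Matrix (Fin 2) (Fin 2) ℤ) (p : EuclideanSpace ℝ (Fin 3) → M) :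
    Prop where
  det_ne_zero : d.det ≠ 0
  surjective : Function.Surjective p
  isLocalDiffeomorph : IsLocalDiffeomorph (𝓡 3) (𝓡 3) ∞ p
  isCoveringMap : IsCoveringMap p
  eq_iff : ∀ x y, p x = p y ↔ ∃ (k : ℤ) (m : Fin 2 → ℤ), shearMap k (heisenbergShift d k m) x = y

theorem IsTorusBundleProjection.isShearProjection (hq : IsTorusBundleProjection A q)
    (h : UnipotentBasis A d) : IsShearProjection d (q ∘ heisenbergParam d) := by
  have hd := h.det_ne_zero
  obtain ⟨hs, hp, hc⟩ := hq.comp_diffeo (contDiff_heisenbergParam d) (contDiff_heisenbergCoord d)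
    (heisenbergParam_coord hd) (heisenbergCoord_param hd)
  refine ⟨hd, hs, hp, hc, fun x y ↦ ?_⟩
  rw [Function.comp_apply, Function.comp_apply, hq.eq_iff_deck]
  refine exists_congr fun k ↦ exists_congr fun m ↦ ⟨fun e ↦ ?_, fun e ↦ ?_⟩
  · have := congrArg (heisenbergCoord d) e
    rwa [h.heisenbergCoord_deckMap, heisenbergCoord_param hd, heisenbergCoord_param hd] at this
  · rw [← e]
    conv_rhs => rw [← heisenbergCoord_param hd x, ← h.heisenbergCoord_deckMap]
    rw [heisenbergParam_coord hd]

theorem heisenbergMap_eq_shearMap (m r s : ℤ) (x : EuclideanSpace ℝ (Fin 3)) :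
    heisenbergMap m r s x = shearMap m !₂[(r : ℝ) / 2, (s : ℝ) / 2, (m : ℝ)] x := by
  apply euclidean_ext <;> simp [heisenbergMap, shearMap]

theorem heisenbergMap_heisenbergMap (m r s m' r' s' : ℤ) (x : EuclideanSpace ℝ (Fin 3)) :
    heisenbergMap m r s (heisenbergMap m' r' s' x) =
      heisenbergMap (m + m') (r + r' + m * s' - m ^ 2 * m') (s + s' - 2 * m * m') x := by
  apply euclidean_ext <;> simp [heisenbergMap] <;> ring

theorem heisenbergMap_inv (m r s : ℤ) (x : EuclideanSpace ℝ (Fin 3)) :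
    heisenbergMap (-m) (-r + m * s + m ^ 3) (-s - 2 * m ^ 2) (heisenbergMap m r s x) = x ∧
      heisenbergMap m r s (heisenbergMap (-m) (-r + m * s + m ^ 3) (-s - 2 * m ^ 2) x) = x := by
  constructor <;> apply euclidean_ext <;> simp [heisenbergMap] <;> ring

theorem six_dvd_sub_cube (k : ℤ) : ∃ j : ℤ, k - k ^ 3 = 6 * j := by
  have h : (6 : ℤ) ∣ k - k ^ 3 := by
    rw [Int.dvd_iff_emod_eq_zero]
    have h6 : k % 6 = 0 ∨ k % 6 = 1 ∨ k % 6 = 2 ∨ k % 6 = 3 ∨ k % 6 = 4 ∨ k % 6 = 5 := by omega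
    rcases h6 with h | h | h | h | h | h <;> simp [Int.sub_emod, pow_succ, Int.mul_emod, h]
  exact h

theorem exists_heisenbergMap_eq (d : Matrix (Fin 2) (Fin 2) ℤ) (k : ℤ) (m : Fin 2 → ℤ) :
    ∃ r s : ℤ, ∀ x, shearMap k (heisenbergShift d k m) x = heisenbergMap k r s x := by
  obtain ⟨j, hj⟩ := six_dvd_sub_cube k
  have hj' : ((k : ℝ) - k ^ 3) = 6 * j := by exact_mod_cast hj
  refine ⟨2 * j + 2 * (d 0 0 * m 0 + d 0 1 * m 1), -k ^ 2 + 2 * (d 1 0 * m 0 + d 1 1 * m 1),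
    fun x ↦ ?_⟩
  rw [heisenbergMap_eq_shearMap]
  congr 1
  apply euclidean_ext
  · simp [heisenbergShift, hj']; ring
  · simp [heisenbergShift]; ring
  · simp [heisenbergShift]

theorem IsShearProjection.isHeisenbergQuotient (h : IsShearProjection d p) :
    IsHeisenbergQuotient p where
  surjective := h.surjective
  isLocalDiffeomorph := h.isLocalDiffeomorph
  exists_group := by
    -- All transformations of the required form that preserve the fibres. They form a group
    -- containing the deck maps, so it acts transitively on fibres.
    refine ⟨{ carrier := {γ | (∀ x, p (γ x) = p x) ∧ ∃ m r s : ℤ, ∀ x, γ x = heisenbergMap m r s x}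
              mul_mem' := ?_
              one_mem' := ⟨fun x ↦ rfl, 0, 0, 0, fun x ↦ by
                apply euclidean_ext <;> simp [heisenbergMap]⟩
              inv_mem' := ?_ }, fun γ hγ ↦ hγ.2, fun x y ↦ ⟨fun hxy ↦ ?_, ?_⟩⟩
    · rintro γ γ' ⟨h1, m, r, s, h2⟩ ⟨h1', m', r', s', h2'⟩
      exact ⟨fun x ↦ by rw [Equiv.Perm.mul_apply, h1, h1'], _, _, _, fun x ↦ by
        rw [Equiv.Perm.mul_apply, h2, h2', heisenbergMap_heisenbergMap]⟩
    · rintro γ ⟨h1, m, r, s, h2⟩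
      refine ⟨fun x ↦ by rw [← h1, ← Equiv.Perm.mul_apply, mul_inv_cancel]; rfl, -m,
        -r + m * s + m ^ 3, -s - 2 * m ^ 2, fun x ↦ ?_⟩
      rw [Equiv.Perm.inv_eq_iff_eq, h2, (heisenbergMap_inv _ _ _ _).2]
    · obtain ⟨k, m, e⟩ := (h.eq_iff x y).1 hxy
      obtain ⟨r, s, hrs⟩ := exists_heisenbergMap_eq d k m
      refine ⟨⟨heisenbergMap k r s, heisenbergMap (-k) (-r + k * s + k ^ 3) (-s - 2 * k ^ 2),
        fun x ↦ (heisenbergMap_inv _ _ _ _).1, fun x ↦ (heisenbergMap_inv _ _ _ _).2⟩,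
        ⟨fun x ↦ ?_, k, r, s, fun x ↦ rfl⟩, ?_⟩
      · exact ((h.eq_iff _ _).2 ⟨k, m, hrs x⟩).symm
      · rw [← e, hrs]; rfl
    · rintro ⟨γ, hγ, rfl⟩
      exact (hγ.1 x).symm

theorem IsShearProjection.isDeckFamily (h : IsShearProjection d p) :
    IsDeckFamily p {γ | ∃ (k : ℤ) (m : Fin 2 → ℤ), γ = shearMap k (heisenbergShift d k m)} where
  surjective := h.surjective
  isLocalDiffeomorph := h.isLocalDiffeomorph
  differentiable := by
    rintro _ ⟨k, m, rfl⟩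
    exact (contDiff_shearMap _ _).differentiable (by simp)
  map_deck := by
    rintro _ ⟨k, m, rfl⟩ x
    exact ((h.eq_iff _ _).2 ⟨k, m, rfl⟩).symm
  exists_deck := by
    intro x y hxy
    obtain ⟨k, m, e⟩ := (h.eq_iff x y).1 hxy
    exact ⟨_, ⟨k, m, rfl⟩, e⟩

/-- Some vertical shears permute the fibres. -/
theorem IsShearProjection.map_shearMap (h : IsShearProjection d p) (j : ℤ) (s : ℝ)
    {x y : EuclideanSpace ℝ (Fin 3)} (hxy : p x = p y) :
    p (shearMap (2 * d.det * j) (s • EuclideanSpace.single 0 1) x) =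
      p (shearMap (2 * d.det * j) (s • EuclideanSpace.single 0 1) y) := by
  obtain ⟨k, m, rfl⟩ := (h.eq_iff x y).1 hxy
  set D := d.det with hD
  have hd' : (D : ℝ) = d 0 0 * d 1 1 - d 0 1 * d 1 0 := by
    rw [hD, Matrix.det_fin_two]; push_cast; ring
  -- Conjugating the deck map `(k, m)` by the shear keeps `k` and adds `(D α, D β)` to its
  -- translation part. The adjugate of `d` converts this into an integral change of `m`. In the
  -- parameter `2 D j` the factor `D` makes this possible and the factor `2` clears the denominator
  -- of `k² / 2`.
  set α : ℤ := -j * k ^ 2 + 2 * j * (d 1 0 * m 0 + d 1 1 * m 1) - 2 * D * j ^ 2 * k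
  set β : ℤ := -2 * j * k
  refine (h.eq_iff _ _).2 ⟨k, ![m 0 + (d 1 1 * α - d 0 1 * β), m 1 + (-d 1 0 * α + d 0 0 * β)], ?_⟩
  apply euclidean_ext
  · simp [shearMap, heisenbergShift, α, β, hd']
    ring
  · simp [shearMap, heisenbergShift, α, β, hd']
    ring
  · simp [shearMap, heisenbergShift]

end HeisenbergQuotient

/-! ### Identity component for parabolic bundles -/

section HeisenbergComponent

variable {M : Type*} [TopologicalSpace M] [ChartedSpace (EuclideanSpace ℝ (Fin 3)) M]
  {p : EuclideanSpace ℝ (Fin 3) → M} {d : Matrix (Fin 2) (Fin 2) ℤ}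

theorem IsShearProjection.isOpenQuotientMap (h : IsShearProjection d p) : IsOpenQuotientMap p :=
  ⟨h.surjective, h.isLocalDiffeomorph.isLocalHomeomorph.continuous,
    h.isLocalDiffeomorph.isLocalHomeomorph.isOpenMap⟩

/-- Functions that are invariant modulo one descend to the circle. -/
theorem IsShearProjection.exists_character (h : IsShearProjection d p)
    {φ : EuclideanSpace ℝ (Fin 3) → ℝ} (hφ : Continuous φ)
    (hinv : ∀ (k : ℤ) (m : Fin 2 → ℤ) x, ∃ n : ℤ, φ (shearMap k (heisenbergShift d k m) x) = φ x + n) :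
    ∃ χ : M → UnitAddCircle, Continuous χ ∧ ∀ x, χ (p x) = (φ x : ℝ) := by
  have key : ∀ x, ((φ (Function.surjInv h.surjective (p x)) : ℝ) : UnitAddCircle) = (φ x : ℝ) := by
    intro x
    obtain ⟨k, m, e⟩ := (h.eq_iff _ _).1 (Function.surjInv_eq h.surjective (p x)).symm
    obtain ⟨n, hn⟩ := hinv k m x
    rw [← e, hn, coe_add_int]
  refine ⟨fun y ↦ (φ (Function.surjInv h.surjective y) : ℝ), ?_, key⟩
  rw [h.isOpenQuotientMap.isQuotientMap.continuous_iff]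
  refine Continuous.congr ?_ fun x ↦ (key x).symm
  exact (AddCircle.continuous_mk' 1).comp hφ

variable [IsManifold (𝓡 3) ∞ M] {g : LorentzMetric 3 M} {a : PeriodicProfile}

/-- Up to translations along `u`, the lifts of isometries form a countable set. -/
theorem IsShearProjection.exists_countable_lifts (h : IsShearProjection d p)
    (hg : g.PullsBackTo p (parabolicForm a)) (ha : a.ParabolicGeneric) :
    ∃ Y : Set (ℝ × ℝ × ℝ × ℝ × ℝ), Y.Countable ∧ ∀ f : g.Iso, ∃ (l τ β : ℝ)
      (b : EuclideanSpace ℝ (Fin 3)), (l, τ, β, b 1, b 2) ∈ Y ∧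
      ∀ x, f.1 (p x) = p (parabolicMap l τ β b x) := by
  let C : Set ℝ := {c : ℝ | ∃ k : ℤ, k ≠ 0 ∧ ∀ t, a.1 (k * t + c) = a.1 t}
  have hC : Countable C := (countable_integral_shifts ha.not_const).to_subtype
  -- These formulas solve, for `β` and `b 1`, the compatibility of the lift with the deck map `k =
  -- 1`, `m = 0`. The inputs are integers and the shift `b 2`, which lies in a countable set. The
  -- coordinate `b 0` cancels and stays free.
  let β : ℤ → ℤ → ℝ → ℤ → ℝ := fun k τ c n ↦ (τ : ℝ) / 2 - k * c - (k : ℝ) ^ 2 / 2 + n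
  let t : ℤ → ℤ → ℝ → ℤ → ℤ → ℝ := fun k τ c n n' ↦
    ((τ : ℝ) * β k τ c n / (2 * k) - β k τ c n ^ 2 / (2 * k) + (k : ℝ) ^ 2 / 2 * c -
      ((k : ℝ) - (k : ℝ) ^ 3) / 6 - n') / k
  refine ⟨Set.range fun z : ℤ × ℤ × C × ℤ × ℤ ↦ ((z.1 : ℝ), (z.2.1 : ℝ),
    β z.1 z.2.1 z.2.2.1 z.2.2.2.1, t z.1 z.2.1 z.2.2.1 z.2.2.2.1 z.2.2.2.2, (z.2.2.1 : ℝ)),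
    Set.countable_range _, fun f ↦ ?_⟩
  obtain ⟨l, τ, β', b, hl, hτ, hb, hf⟩ := hg.parabolic_lift h.surjective h.isCoveringMap
    h.isLocalDiffeomorph ha f
  refine ⟨l, τ, β', b, ?_, hf⟩
  have h1 : p 0 = p !₂[0, -1 / 2, 1] := (h.eq_iff _ _).2 ⟨1, 0, by
    apply euclidean_ext <;> simp [shearMap, heisenbergShift]⟩
  have h2 := congrArg f.1 h1
  rw [hf, hf] at h2
  obtain ⟨k, m, e⟩ := (h.eq_iff _ _).1 h2
  have e0 := congrArg (fun v : EuclideanSpace ℝ (Fin 3) ↦ v 0) e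
  have e1 := congrArg (fun v : EuclideanSpace ℝ (Fin 3) ↦ v 1) e
  have e2 := congrArg (fun v : EuclideanSpace ℝ (Fin 3) ↦ v 2) e
  simp [shearMap, heisenbergShift, parabolicMap] at e0 e1 e2
  have hlk : l = k := by linarith
  subst hlk
  have hk0 : k ≠ 0 := Int.cast_ne_zero.1 hl
  obtain ⟨τ', rfl⟩ : ∃ τ' : ℤ, τ = τ' := by
    rcases hτ with rfl | rfl
    · exact ⟨1, by simp⟩
    · exact ⟨-1, by simp⟩
  have eβ : β' = β k τ' (b 2) (d 1 0 * m 0 + d 1 1 * m 1) := by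
    simp only [β]; push_cast; linarith
  refine ⟨⟨k, τ', ⟨b 2, k, hk0, hb⟩, d 1 0 * m 0 + d 1 1 * m 1, d 0 0 * m 0 + d 0 1 * m 1⟩, ?_⟩
  simp only [Prod.mk.injEq, true_and, and_true]
  refine ⟨eβ.symm, ?_⟩
  simp only [t]
  rw [← eβ, div_eq_iff hl]
  push_cast
  have e3 : (τ' : ℝ) * β' / k * (-1 / 2) = -(τ' * β' / (2 * k)) := by field_simp
  rw [e3] at e0
  linarith

theorem IsShearProjection.isCompact_identityComponent (h : IsShearProjection d p)
    (hg : g.PullsBackTo p (parabolicForm a)) (ha : a.ParabolicGeneric) :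
    IsCompact (LorentzMetric.Iso.identityComponent g) := by
  obtain ⟨Y, hY, hf⟩ := h.exists_countable_lifts hg ha
  choose l τ β b hbY hf using hf
  set D := d.det with hD
  have hd' : (D : ℝ) = d 0 0 * d 1 1 - d 0 1 * d 1 0 := by
    rw [hD, Matrix.det_fin_two]; push_cast; ring
  have hD0 : (D : ℝ) ≠ 0 := Int.cast_ne_zero.2 h.det_ne_zero
  have htrans : ∀ s : ℝ, ∃ f : g.Iso, ∀ x, f.1 (p x) = p (x + s • EuclideanSpace.single 0 1) := by
    intro s
    obtain ⟨f, hf⟩ := hg.exists_iso_shearMap (K := 0) (c := s • EuclideanSpace.single 0 1)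
      h.surjective h.isLocalDiffeomorph (by simp)
      (fun x y hxy ↦ by simpa using h.map_shearMap 0 s hxy)
      (fun x y hxy ↦ by
        have e : -shearMap (-0) 0 (s • EuclideanSpace.single 0 (1 : ℝ)) =
            (-s) • EuclideanSpace.single 0 1 := by
          apply euclidean_ext <;> simp [shearMap]
        rw [e]
        simpa using h.map_shearMap 0 (-s) hxy)
    exact ⟨f, fun x ↦ by rw [hf, shearMap_zero_left]⟩
  -- The translation by `D` along `u` is a deck map, so parameters in `[0, 1]` give all translations
  -- along `u`.
  let φ : Set.Icc (0 : ℝ) 1 → g.Iso := fun s ↦ (htrans (D * s)).choose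
  have hφ : ∀ s x, (φ s).1 (p x) = p (x + (D * (s : ℝ)) • EuclideanSpace.single 0 1) :=
    fun s ↦ (htrans (D * s)).choose_spec
  have hφc : Continuous φ := by
    refine LorentzMetric.Iso.continuous_of_lift h.isOpenQuotientMap
      (Φ := fun c ↦ c.2 + (D * (c.1 : ℝ)) • EuclideanSpace.single 0 1) ?_ hφ
    fun_prop
  refine LorentzMetric.isCompact_identityComponent_of_subset (isCompact_range hφc) fun f hfc ↦ ?_
  have hrefl : ∀ y, (LorentzMetric.Iso.refl g).1 y = y := fun y ↦ rfl
  -- the second row of `d` generates `G ℤ`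
  set G : ℤ := ((Int.gcd (d 1 0) (d 1 1) : ℕ) : ℤ) with hG
  have hG0 : (G : ℝ) ≠ 0 := by
    intro h0
    have h1 : Int.gcd (d 1 0) (d 1 1) = 0 := by
      rw [hG] at h0; exact_mod_cast h0
    rw [Int.gcd_eq_zero_iff] at h1
    refine h.det_ne_zero ?_
    rw [Matrix.det_fin_two, h1.1, h1.2]; ring
  obtain ⟨r0, hr0⟩ : G ∣ d 1 0 := Int.gcd_dvd_left ..
  obtain ⟨r1, hr1⟩ : G ∣ d 1 1 := Int.gcd_dvd_right ..
  have hbez : G = d 1 0 * Int.gcdA (d 1 0) (d 1 1) + d 1 1 * Int.gcdB (d 1 0) (d 1 1) :=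
    Int.gcd_eq_gcd_ab ..
  obtain ⟨χ, hχ, hχp⟩ := h.exists_character (φ := fun x ↦ x 2) (by fun_prop)
    fun k m x ↦ ⟨k, by simp [shearMap, heisenbergShift]⟩
  -- `t + v² / 2` is the linear form given by the second row of `d` in the original coordinates.
  -- Deck maps change it by multiples of `G`. Neither this function nor `v` involves `b 0` after
  -- composition with a lift, so both take countably many values on the group.
  obtain ⟨χ', hχ', hχp'⟩ := h.exists_character (φ := fun x ↦ (x 1 + x 2 ^ 2 / 2) / G)
    (by fun_prop) fun k m x ↦ ⟨r0 * m 0 + r1 * m 1, by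
      simp [shearMap, heisenbergShift, hr0, hr1]
      field_simp
      ring⟩
  have key : ∀ x : EuclideanSpace ℝ (Fin 3), ∃ n : ℤ, l f * x 2 + b f 2 = x 2 + n := by
    intro x
    have h1 := LorentzMetric.Iso.eq_of_countable (ψ := fun f : g.Iso ↦ χ (f.1 (p x)))
      (hχ.comp (LorentzMetric.Iso.continuous_eval _))
      ((hY.image fun y ↦ ((y.1 * x 2 + y.2.2.2.2 : ℝ) : UnitAddCircle)).mono ?_) hfc
    · simp only [hrefl, hf, hχp] at h1
      simpa [parabolicMap] using exists_int_of_coe_eq h1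
    · rintro _ ⟨f, rfl⟩
      exact ⟨_, hbY f, by simp [hf, hχp, parabolicMap]⟩
  have key' : ∀ x : EuclideanSpace ℝ (Fin 3), ∃ n : ℤ,
      (τ f * x 1 + β f * x 2 + b f 1 + (l f * x 2 + b f 2) ^ 2 / 2) / G =
        (x 1 + x 2 ^ 2 / 2) / G + n := by
    intro x
    have h1 := LorentzMetric.Iso.eq_of_countable (ψ := fun f : g.Iso ↦ χ' (f.1 (p x)))
      (hχ'.comp (LorentzMetric.Iso.continuous_eval _))
      ((hY.image fun y ↦ (((y.2.1 * x 1 + y.2.2.1 * x 2 + y.2.2.2.1 +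
        (y.1 * x 2 + y.2.2.2.2) ^ 2 / 2) / G : ℝ) : UnitAddCircle)).mono ?_) hfc
    · simp only [hrefl, hf, hχp'] at h1
      simpa [parabolicMap] using exists_int_of_coe_eq h1
    · rintro _ ⟨f, rfl⟩
      exact ⟨_, hbY f, by simp [hf, hχp', parabolicMap]⟩
  have hl : l f = 1 := by
    rw [← sub_eq_zero]
    refine eq_zero_of_forall_int (c := b f 2) fun s ↦ ?_
    obtain ⟨n, hn⟩ := key (s • EuclideanSpace.single 2 1)
    refine ⟨n, ?_⟩
    simp at hn
    linarith
  have hτ : τ f = 1 := by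
    have h1 : (τ f - 1) / G = 0 := by
      refine eq_zero_of_forall_int (c := (b f 1 + b f 2 ^ 2 / 2) / G) fun s ↦ ?_
      obtain ⟨n, hn⟩ := key' (s • EuclideanSpace.single 1 1)
      refine ⟨n, ?_⟩
      simp at hn
      field_simp at hn ⊢
      linarith
    rw [div_eq_zero_iff, or_iff_left hG0] at h1
    linarith
  have hβ : β f = -b f 2 := by
    have h1 : (β f + b f 2) / G = 0 := by
      refine eq_zero_of_forall_int (c := (b f 1 + b f 2 ^ 2 / 2) / G) fun s ↦ ?_
      obtain ⟨n, hn⟩ := key' (s • EuclideanSpace.single 2 1)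
      refine ⟨n, ?_⟩
      rw [hl] at hn
      simp at hn
      field_simp at hn ⊢
      linarith
    rw [div_eq_zero_iff, or_iff_left hG0] at h1
    linarith
  obtain ⟨k, hk⟩ := key 0
  obtain ⟨n, hn⟩ := key' 0
  simp at hk hn
  rw [hk, div_eq_iff hG0] at hn
  -- the isometry is a translation along `u`
  let m : Fin 2 → ℤ := ![n * Int.gcdA (d 1 0) (d 1 1), n * Int.gcdB (d 1 0) (d 1 1)]
  have hm : (d 1 0 * m 0 + d 1 1 * m 1 : ℝ) = n * G := by
    have : d 1 0 * m 0 + d 1 1 * m 1 = n * G := by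
      simp only [m, Matrix.cons_val]
      linear_combination (-n) * hbez
    exact_mod_cast this
  set s : ℝ := (b f 0 - heisenbergShift d k m 0) / D with hs
  -- By Bézout `m` was chosen to match the `t` translation. The lift is then the deck map `(k, m)`
  -- followed by a translation along `u`.
  have hFs : ∀ x, f.1 (p x) = p (x + (D * s) • EuclideanSpace.single 0 1) := by
    intro x
    rw [hf]
    refine ((h.eq_iff _ _).2 ⟨k, m, ?_⟩).symm
    have e : D * s = b f 0 - heisenbergShift d k m 0 := by rw [hs]; field_simp
    rw [e, hl, hτ, hβ, hk]
    apply euclidean_ext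
    · simp [shearMap, parabolicMap, heisenbergShift, hk]; ring
    · simp [shearMap, parabolicMap, heisenbergShift, hm]; linarith
    · simp [shearMap, parabolicMap, heisenbergShift, hk]
  refine ⟨⟨Int.fract s, Int.fract_nonneg _, (Int.fract_lt_one _).le⟩, ?_⟩
  refine LorentzMetric.Iso.ext fun y ↦ ?_
  obtain ⟨x, rfl⟩ := h.surjective y
  rw [hφ, hFs]
  refine (h.eq_iff _ _).2 ⟨0, ![⌊s⌋ * d 1 1, -⌊s⌋ * d 1 0], ?_⟩
  have e : s = Int.fract s + ⌊s⌋ := (Int.fract_add_floor s).symm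
  apply euclidean_ext
  · simp [shearMap, heisenbergShift, hd']
    linear_combination (-(d 0 0 * d 1 1 - d 0 1 * d 1 0 : ℝ)) * e
  · simp [shearMap, heisenbergShift]
    ring
  · simp [shearMap, heisenbergShift]

/-- Quotients of a generic metric `a(v) (dt² + 2 du dv)` by affine actions of the Heisenberg
group. -/
theorem IsShearProjection.exists_parabolic [T2Space M] (h : IsShearProjection d p)
    (ha : a.ParabolicGeneric) : ∃ g : LorentzMetric 3 M, g.PullsBackTo p (parabolicForm a) ∧
      g.IsNonhomogeneousWithNoncompactIso ∧ g.TimeOrientable := by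
  have hs := h.surjective
  have hp := h.isLocalDiffeomorph
  obtain ⟨g, hg⟩ := h.isDeckFamily.exists_parabolic_metric (by
    rintro _ ⟨k, m, rfl⟩
    exact ⟨k, _, k, by simp [heisenbergShift], rfl⟩) a
  refine ⟨g, hg, ⟨?_, h.isCompact_identityComponent hg ha,
    fun U hU hne ↦ parabolic_not_locallyHomogeneous hs hp hg ha U hU hne⟩, ?_⟩
  · refine LorentzMetric.not_compactSpace_iso_of_shears hp (K := 2 * d.det)
      (mul_ne_zero two_ne_zero (Int.cast_ne_zero.2 h.det_ne_zero)) fun n ↦ ?_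
    refine hg.exists_iso_shearMap hs hp (by simp)
      (fun x y hxy ↦ by simpa using h.map_shearMap n 0 hxy) fun x y hxy ↦ ?_
    have e : -shearMap (-(2 * d.det * n)) 0 0 = 0 := by
      apply euclidean_ext <;> simp [shearMap]
    rw [e]
    simpa using h.map_shearMap (-n) 0 hxy
  -- The field is the image of `∂u - ∂v` under the linear shear with parameter `v`. The deck maps
  -- shift `v` by the parameter of their own shear, so it is invariant, of square `-2 a`.
  · refine hg.timeOrientable h.isDeckFamily (X := fun x ↦ !₂[1 + x 2 ^ 2 / 2, x 2, -1]) ?_ ?_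
      fun x ↦ ?_
    · rw [contDiff_euclidean]
      intro i
      fin_cases i <;> simp <;> fun_prop
    · rintro _ ⟨k, m, rfl⟩ x
      rw [fderiv_shearMap]
      apply euclidean_ext <;> simp [shearMap, heisenbergShift]
      ring
    · have := a.pos (x 2)
      simp [parabolicForm]
      nlinarith

end HeisenbergComponent

/-! ### The theorem -/

/-- A torus bundle with hyperbolic, parabolic or trivial monodromy carries a nowhere locally
homogeneous Lorentz metric with noncompact isometry group. -/
theorem IsTorusBundleProjection.exists_lorentzMetric {M : Type*} [TopologicalSpace M]
    [ChartedSpace (EuclideanSpace ℝ (Fin 3)) M] [IsManifold (𝓡 3) ∞ M]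
    {q : EuclideanSpace ℝ (Fin 3) → M} {A : SL(2, ℤ)} (hq : IsTorusBundleProjection A q)
    (hA : A = 1 ∨ IsHyperbolicMatrix A ∨ IsParabolicMatrix A) :
    ∃ g : LorentzMetric 3 M, g.IsNonhomogeneousWithNoncompactIso ∧
      (0 < (A : Matrix (Fin 2) (Fin 2) ℤ).trace → g.TimeOrientable) := by
  -- The explicit profile gives existence directly, so the Baire property of the space of profiles
  -- is not needed.
  rcases hA with rfl | ⟨P, l, h, hl⟩ | hA
  · obtain ⟨g, -, h1, h2⟩ := hq.exists_parabolic PeriodicProfile.model_parabolicGeneric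
    exact ⟨g, h1, fun _ ↦ h2⟩
  · obtain ⟨g, -, h1, h2⟩ := hq.exists_hyperbolic h (Or.inr hl) h (Commute.refl A) hl
      PeriodicProfile.model_hyperbolicGeneric
    exact ⟨g, h1, h2⟩
  · obtain ⟨d, hd⟩ := hA.exists_unipotentBasis
    have := hq.t2Space
    obtain ⟨g, -, h1, h2⟩ := (hq.isShearProjection hd).exists_parabolic
      PeriodicProfile.model_parabolicGeneric
    exact ⟨g, h1, fun _ ↦ h2⟩

theorem theoremB (A : SL(2, ℤ)) (hA : A = 1 ∨ IsHyperbolicMatrix A ∨ IsParabolicMatrix A) :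
    -- every topological manifold homeomorphic to the torus bundle carries such metrics
    (∀ (M : Type*) [TopologicalSpace M], Nonempty (M ≃ₜ TorusBundle A) →
      ∃ (_ : ChartedSpace (EuclideanSpace ℝ (Fin 3)) M) (_ : IsManifold (𝓡 3) ∞ M),
        (∃ q : EuclideanSpace ℝ (Fin 3) → M, IsTorusBundleProjection A q) ∧
        ∃ g : LorentzMetric 3 M, g.IsNonhomogeneousWithNoncompactIso ∧
          (0 < (A : Matrix (Fin 2) (Fin 2) ℤ).trace → g.TimeOrientable)) ∧
    -- so does every smooth manifold diffeomorphic to it, for its given smooth structure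
    (∀ (M : Type*) [TopologicalSpace M] [ChartedSpace (EuclideanSpace ℝ (Fin 3)) M]
      [IsManifold (𝓡 3) ∞ M] (q : EuclideanSpace ℝ (Fin 3) → M),
      IsTorusBundleProjection A q →
      (∃ g : LorentzMetric 3 M, g.IsNonhomogeneousWithNoncompactIso ∧
        (0 < (A : Matrix (Fin 2) (Fin 2) ℤ).trace → g.TimeOrientable)) ∧
      -- hyperbolic bundles: quotients of `dt² + 2 a(t) du dv`
      (∀ (P : Matrix (Fin 2) (Fin 2) ℝ) (l : ℝ), Diagonalizes A P l → |l| ≠ 1 →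
        ∀ᶠ a in residual PeriodicProfile, ∃ g : LorentzMetric 3 M,
          g.PullsBackTo (q ∘ planeChange P) (hyperbolicForm a) ∧
          g.IsNonhomogeneousWithNoncompactIso ∧
          (0 < (A : Matrix (Fin 2) (Fin 2) ℤ).trace → g.TimeOrientable)) ∧
      -- the 3-torus: quotients of `dt² + 2 a(t) du dv`
      (A = 1 → ∀ (B : SL(2, ℤ)) (P : Matrix (Fin 2) (Fin 2) ℝ) (l : ℝ),
        Diagonalizes B P l → |l| ≠ 1 →
        ∀ᶠ a in residual PeriodicProfile, ∃ g : LorentzMetric 3 M,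
          g.PullsBackTo (q ∘ planeChange P) (hyperbolicForm a) ∧
          g.IsNonhomogeneousWithNoncompactIso ∧ g.TimeOrientable) ∧
      -- the 3-torus: quotients of `a(v) (dt² + 2 du dv)`
      (A = 1 → ∀ᶠ a in residual PeriodicProfile, ∃ g : LorentzMetric 3 M,
        g.PullsBackTo q (parabolicForm a) ∧
        g.IsNonhomogeneousWithNoncompactIso ∧ g.TimeOrientable) ∧
      -- parabolic bundles: quotients of `a(v) (dt² + 2 du dv)`
      (IsParabolicMatrix A → ∃ p : EuclideanSpace ℝ (Fin 3) → M, IsHeisenbergQuotient p ∧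
        ∀ᶠ a in residual PeriodicProfile, ∃ g : LorentzMetric 3 M,
          g.PullsBackTo p (parabolicForm a) ∧
          g.IsNonhomogeneousWithNoncompactIso ∧ g.TimeOrientable)) := by
  refine ⟨fun M _ hM ↦ ?_, fun M _ _ _ q hq ↦ ⟨hq.exists_lorentzMetric hA, ?_, ?_, ?_, ?_⟩⟩
  · obtain ⟨_, _, q, hq⟩ := exists_isTorusBundleProjection A hM
    exact ⟨_, ‹_›, ⟨q, hq⟩, hq.exists_lorentzMetric hA⟩
  · intro P l h hl
    filter_upwards [PeriodicProfile.residual_hyperbolicGeneric] with a ha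
    exact hq.exists_hyperbolic h (Or.inr hl) h (Commute.refl A) hl ha
  · rintro rfl B P l h hl
    filter_upwards [PeriodicProfile.residual_hyperbolicGeneric] with a ha
    obtain ⟨g, hg, h1, h2⟩ := hq.exists_hyperbolic (diagonalizes_one h.1) (Or.inl rfl) h
      (Commute.one_left B) hl ha
    exact ⟨g, hg, h1, h2 (by simp)⟩
  · rintro rfl
    filter_upwards [PeriodicProfile.residual_parabolicGeneric] with a ha
    exact hq.exists_parabolic ha
  · intro hA'
    obtain ⟨d, hd⟩ := hA'.exists_unipotentBasis
    have hp := hq.isShearProjection hd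
    have := hq.t2Space
    refine ⟨_, hp.isHeisenbergQuotient, ?_⟩
    filter_upwards [PeriodicProfile.residual_parabolicGeneric] with a ha
    exact hp.exists_parabolic ha
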